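/- **Setting.** Let $\mathsf X,\mathsf Y$ be Polish spaces with their Borel $\sigma$-algebras, $\nu$ and $\lambda$ $\sigma$-finite measures on $\mathsf X$ and $\mathsf Y$, $\chi$ a probability measure on $\mathsf X$, $m:\mathsf X\times\mathsf X\to[0,\infty)$ a measurable transition density, $\int m(x,x')\,\nu(dx')=1$, with kernel $M(x,dx')=m(x,x')\,\nu(dx')$, and $g:\mathsf X\times\mathsf Y\to[0,\infty)$ measurable with $\int g(x,y)\,\lambda(dy)=1$. Fix an integer $T\ge 0$ and observations $y_0,\dots,y_T\in\mathsf Y$, and put $g_t(x)=g(x,y_t)$. For bounded measurable $h:\mathsf X^{T+1}\to\mathbb R$ and $0\le t\le T$ let $$L_{t,T}(x_{0:t},h)=\int\!\cdots\!\int\prod_{u=t+1}^{T}M(x_{u-1},dx_u)\,g_u(x_u)\;h(x_{0:T}),\qquad \phi_{0:T|T}(h)=\frac{\int\chi(dx_0)\,g_0(x_0)\,L_{0,T}(x_0,h)}{\int\chi(dx_0)\,g_0(x_0)\,L_{0,T}(x_0,\mathbf 1)}.$$ Let $\phi_t=\gamma_t/\gamma_t(\mathsf X)$ be the filter, where $\gamma_0(f)=\chi(g_0f)$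 and $\gamma_t(f)=\gamma_{t-1}M(g_tf)$. For a finite measure $\eta$ on $\mathsf X$ let $B_\eta(x,f)=\int\eta(dx')m(x',x)f(x')\big/\int\eta(dx')m(x',x)$ be the backward kernel (with $0/0=0$), and let $$F_{t,T}(x_t,h)=\int\!\cdots\!\int B_{\phi_{t-1}}(x_t,dx_{t-1})\cdots B_{\phi_0}(x_1,dx_0)\,L_{t,T}(x_{0:t},h),\qquad G_{t,T}(x,h)=F_{t,T}\bigl(x,h-\phi_{0:T|T}(h)\bigr),$$ with $F_{0,T}=L_{0,T}$. **Algorithm.** Let $\rho_0$ be a probability measure on $\mathsf X$ with $\chi\ll\rho_0$ and, for $1\le t\le T$, let $\vartheta_t:\mathsf X\to(0,\infty)$ be measurable and let $p_t:\mathsf X\times\mathsf X\to[0,\infty)$ be a measurable density, $\int p_t(x,x')\,\nu(dx')=1$, with kernel $P_t(x,dx')=p_t(x,x')\,\nu(dx')$. Fix a measurable nonnegative version of $d\chi/d\rho_0$ and put $$\omega_0(x)=\frac{d\chi}{d\rho_0}(x)\,g_0(x),\qquad \omega_t(x,x')=\frac{m(x,x')\,g_t(x')}{\vartheta_t(x)\,p_t(x,x')}\quad(t\ge1),$$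 with the conventions $0/0=0$ and $a/0=\infty$ for $a>0$. For every $N$, let $(\xi_t^i,\omega_t^i)_{1\le i\le N}$, $0\le t\le T$, be the weighted samples of the auxiliary particle filter: $\xi_0^1,\dots,\xi_0^N$ are i.i.d. with law $\rho_0$ and $\omega_0^i=\omega_0(\xi_0^i)$; for $1\le t\le T$, conditionally on $(\xi_s^i,\omega_s^i)_{s\le t-1,\,i\le N}$, the pairs $(I_t^i,\xi_t^i)$, $1\le i\le N$, are i.i.d. on $\{1,\dots,N\}\times\mathsf X$ with law proportional to $\omega_{t-1}^{j}\,\vartheta_t(\xi_{t-1}^{j})\,P_t(\xi_{t-1}^{j},dx)$ (on the event that all weights $\omega_{t-1}^j$ vanish the draw is arbitrary), and $\omega_t^i=\omega_t(\xi_{t-1}^{I_t^i},\xi_t^i)$. Let $\hat\phi_t=\sum_i\omega_t^i\,\delta_{\xi_t^i}\big/\sum_j\omega_t^j$ (zero if all weights vanish). The forward filtering backward smoothing estimator is $$\hat\phi_{0:T|T}(h)=\int\!\cdots\!\int\hat\phi_T(dx_T)\,B_{\hat\phi_{T-1}}(x_T,dx_{T-1})\cdots B_{\hat\phi_0}(x_1,dx_0)\,h(x_{0:T}).$$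 **Theorem.** Assume that 1. $g_t(x)>0$ for all $x\in\mathsf X$ and $0\le t\le T$, and $\sup_{0\le t\le T}\sup_x g_t(x)<\infty$; 2. $\sup_{1\le t\le T}\sup_x\vartheta_t(x)<\infty$ and $\sup_{0\le t\le T}\|\omega_t\|_\infty<\infty$; 3. $\sup_{x,x'}m(x,x')<\infty$ and $\sup_{1\le t\le T}\sup_{x,x'}p_t(x,x')<\infty$. Then for every bounded measurable $h:\mathsf X^{T+1}\to\mathbb R$, as $N\to\infty$, $$\sqrt N\,\bigl(\hat\phi_{0:T|T}(h)-\phi_{0:T|T}(h)\bigr)\;\xrightarrow{\ d\ }\;\mathcal N\bigl(0,\Gamma_{0:T|T}[h]\bigr),$$ where $\Gamma_{0:T|T}[h]\ge 0$ is given by $$\Gamma_{0:T|T}[h]=\frac{\rho_0\bigl[\omega_0^2\,G_{0,T}^2(\cdot,h)\bigr]}{\bigl(\rho_0[\omega_0\,F_{0,T}(\cdot,\mathbf 1)]\bigr)^2}+\sum_{t=1}^{T}\frac{\phi_{t-1}[\upsilon_{t,T}(\cdot,h)]\;\phi_{t-1}(\vartheta_t)}{\bigl(\phi_{t-1}[F_{t-1,T}(\cdot,\mathbf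 1)]\bigr)^2},$$ $$\upsilon_{t,T}(x,h)=\vartheta_t(x)\int P_t(x,dx')\,\omega_t^2(x,x')\,G_{t,T}^2(x',h),$$ and $\mathcal N(0,0)$ denotes the point mass at $0$. -/

import Mathlib

open MeasureTheory ProbabilityTheory Filter Topology
open scoped NNReal ENNReal

noncomputable section

namespace FFBS

variable {X Y : Type*} [MeasurableSpace X] [MeasurableSpace Y]

/-- A fully dominated state space model: initial distribution `χ`, reference measure `ν`,
transition density `m` with respect to `ν`, and observation density `obs` with respect to `lam`. -/
structure HMM (X Y : Type*) [MeasurableSpace X] [MeasurableSpace Y] where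
  χ : Measure X
  isProb_χ : IsProbabilityMeasure χ
  ν : Measure X
  sigmaFinite_ν : SigmaFinite ν
  m : X → X → ℝ
  measurable_m : Measurable (Function.uncurry m)
  m_nonneg : ∀ x x', 0 ≤ m x x'
  lintegral_m : ∀ x, ∫⁻ x', ENNReal.ofReal (m x x') ∂ν = 1
  lam : Measure Y
  sigmaFinite_lam : SigmaFinite lam
  obs : X → Y → ℝ
  measurable_obs : Measurable (Function.uncurry obs)
  obs_nonneg : ∀ x y, 0 ≤ obs x y
  lintegral_obs : ∀ x, ∫⁻ y, ENNReal.ofReal (obs x y) ∂lam = 1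

attribute [instance] HMM.isProb_χ HMM.sigmaFinite_ν HMM.sigmaFinite_lam

namespace HMM

variable (H : HMM X Y) (y : ℕ → Y)

/-- The transition kernel `M(x, dx') = m(x, x') ν(dx')`. -/
def M : Kernel X X :=
  Kernel.withDensity (Kernel.const X H.ν) (fun x x' => ENNReal.ofReal (H.m x x'))

/-- The likelihood `g_t(x) = g(x, y_t)` of the fixed observation record `y`. -/
def g (t : ℕ) (x : X) : ℝ := H.obs x (y t)

/-- The unnormalised filter: `γ_0(h) = χ(g_0 h)` and `γ_s(h) = γ_{s-1} M (g_s h)`. -/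
def γ : ℕ → Measure X
  | 0 => H.χ.withDensity (fun x => ENNReal.ofReal (H.g y 0 x))
  | t + 1 => ((γ t).bind H.M).withDensity (fun x => ENNReal.ofReal (H.g y (t + 1) x))

/-- The filtering distribution `φ_t = γ_t / γ_t(1)`. -/
def φ (t : ℕ) : Measure X := (H.γ y t Set.univ)⁻¹ • H.γ y t

/-- The backward kernel `B_η(x, f) = ∫ η(dx') m(x', x) f(x') / ∫ η(dx') m(x', x)`
(with value `0` where the denominator vanishes). -/
def B (η : Measure X) (x : X) (f : X → ℝ) : ℝ :=
  (∫ x', H.m x' x * f x' ∂η) / (∫ x', H.m x' x ∂η)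

/-- Functions on `X^{T+1}`, seen as functions of the first `T + 1` coordinates of a sequence. -/
def lift {T : ℕ} (h : (Fin (T + 1) → X) → ℝ) (x : ℕ → X) : ℝ := h (fun i => x i)

/-- The iterated integral `∫⋯∫ ∏_{u=t+1}^{t+k} M(x_{u-1}, dx_u) g_u(x_u) f(x)`, where the
coordinates `0, …, t` of the sequence `x` are given. -/
def forwardInt : (k t : ℕ) → ((ℕ → X) → ℝ) → (ℕ → X) → ℝ
  | 0, _, f, x => f x
  | k + 1, t, f, x =>
      ∫ x', H.g y (t + 1) x' * forwardInt k (t + 1) f (Function.update x (t + 1) x') ∂(H.M (x t))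

/-- The iterated integral `∫⋯∫ B_{η_{t-1}}(x_t, dx_{t-1}) ⋯ B_{η_0}(x_1, dx_0) f(x)`, where the
coordinates of `x` from `t` on are given. -/
def backwardInt (η : ℕ → Measure X) : (t : ℕ) → ((ℕ → X) → ℝ) → (ℕ → X) → ℝ
  | 0, f, x => f x
  | t + 1, f, x =>
      H.B (η t) (x (t + 1)) (fun x' => backwardInt η t f (Function.update x t x'))

/-- `L_{t,T}(x_{0:t}, h)`; only the coordinates `0, …, t` of `x` matter. Used for `t ≤ T`. -/
def L {T : ℕ} (t : ℕ) (h : (Fin (T + 1) → X) → ℝ) : (ℕ → X) → ℝ :=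
  H.forwardInt y (T - t) t (lift h)

/-- The unnormalised joint smoothing functional
`∫⋯∫ χ(dx_0) g_0(x_0) ∏_{u=1}^T M(x_{u-1}, dx_u) g_u(x_u) h(x_{0:T})`. -/
def unnormSmooth {T : ℕ} (h : (Fin (T + 1) → X) → ℝ) : ℝ :=
  ∫ x₀, H.g y 0 x₀ * H.forwardInt y T 0 (lift h) (fun _ => x₀) ∂H.χ

/-- The joint smoothing distribution `φ_{0:T|T}(h)`. -/
def smooth {T : ℕ} (h : (Fin (T + 1) → X) → ℝ) : ℝ :=
  H.unnormSmooth y h / H.unnormSmooth y (T := T) (fun _ => 1)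

/-- `F_{t,T}(x_t, h) = ∫⋯∫ B_{φ_{t-1}}(x_t, dx_{t-1}) ⋯ B_{φ_0}(x_1, dx_0) L_{t,T}(x_{0:t}, h)`.
Of the constant sequence only the coordinate `t` is used. -/
def F {T : ℕ} (t : ℕ) (x : X) (h : (Fin (T + 1) → X) → ℝ) : ℝ :=
  H.backwardInt (H.φ y) t (H.L y t h) (fun _ => x)

/-- `G_{t,T}(x, h) = F_{t,T}(x, h - φ_{0:T|T}(h))`. -/
def G {T : ℕ} (t : ℕ) (x : X) (h : (Fin (T + 1) → X) → ℝ) : ℝ :=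
  H.F y t x (fun z => h z - H.smooth y h)

/-- The likelihoods are positive and bounded up to time `T`. -/
def BoundedLikelihood (T : ℕ) : Prop :=
  (∀ t ≤ T, ∀ x, 0 < H.g y t x) ∧ ∃ C : ℝ, ∀ t ≤ T, ∀ x, H.g y t x ≤ C

end HMM

/-- The design of an auxiliary particle filter: the initial instrumental distribution `ρ₀` with a
version `dχ` of the Radon–Nikodym derivative `dχ/dρ₀`, and for every time `t ≥ 1` the adjustment
multiplier function `ϑ t` and the proposal density `p t` with respect to `ν`
(the values at `t = 0` are not used). -/
structure Proposal (H : HMM X Y) where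
  ρ₀ : Measure X
  isProb_ρ₀ : IsProbabilityMeasure ρ₀
  dχ : X → ℝ
  measurable_dχ : Measurable dχ
  dχ_nonneg : ∀ x, 0 ≤ dχ x
  χ_eq : H.χ = ρ₀.withDensity (fun x => ENNReal.ofReal (dχ x))
  ϑ : ℕ → X → ℝ
  measurable_ϑ : ∀ t, Measurable (ϑ t)
  ϑ_pos : ∀ t x, 0 < ϑ t x
  p : ℕ → X → X → ℝ
  measurable_p : ∀ t, Measurable (Function.uncurry (p t))
  p_nonneg : ∀ t x x', 0 ≤ p t x x'
  lintegral_p : ∀ t x, ∫⁻ x', ENNReal.ofReal (p t x x') ∂H.ν = 1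

attribute [instance] Proposal.isProb_ρ₀

namespace Proposal

variable {H : HMM X Y} (A : Proposal H) (y : ℕ → Y)

/-- The proposal kernel `P_t(x, dx') = p_t(x, x') ν(dx')`. -/
def P (t : ℕ) : Kernel X X :=
  Kernel.withDensity (Kernel.const X H.ν) (fun x x' => ENNReal.ofReal (A.p t x x'))

/-- The initial importance weight function `ω_0(x) = (dχ/dρ₀)(x) g_0(x)`. -/
def w₀ (x : X) : ℝ := A.dχ x * H.g y 0 x

/-- The importance weight function `ω_t(x, x') = m(x, x') g_t(x') / (ϑ_t(x) p_t(x, x'))`, `t ≥ 1`. -/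
def w (t : ℕ) (x x' : X) : ℝ := (H.m x x' * H.g y t x') / (A.ϑ t x * A.p t x x')

/-- `υ_{t,T}(x, h) = ϑ_t(x) ∫ P_t(x, dx') ω_t(x, x')² G_{t,T}(x', h)²`. -/
def upsilon {T : ℕ} (t : ℕ) (x : X) (h : (Fin (T + 1) → X) → ℝ) : ℝ :=
  A.ϑ t x * ∫ x', A.w y t x x' ^ 2 * H.G y t x' h ^ 2 ∂(A.P t x)

/-- The asymptotic variance `Γ_{0:T|T}[h]`; the summand of index `t` is the one of time `t + 1`. -/
def asymVar {T : ℕ} (h : (Fin (T + 1) → X) → ℝ) : ℝ :=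
  (∫ x, A.w₀ y x ^ 2 * H.G y 0 x h ^ 2 ∂A.ρ₀)
      / (∫ x, A.w₀ y x * H.F y (T := T) 0 x (fun _ => 1) ∂A.ρ₀) ^ 2
    + ∑ t ∈ Finset.range T,
        ((∫ x, A.upsilon y (t + 1) x h ∂(H.φ y t)) * (∫ x, A.ϑ (t + 1) x ∂(H.φ y t)))
          / (∫ x, H.F y (T := T) t x (fun _ => 1) ∂(H.φ y t)) ^ 2

/-- The adjustment multipliers and the importance weight functions are bounded up to time `T`.
The third clause says that no weight is a quotient of a positive number by zero. -/
def BoundedWeights (T : ℕ) : Prop :=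
  (∃ C : ℝ, ∀ t, 1 ≤ t → t ≤ T → ∀ x, A.ϑ t x ≤ C) ∧
  (∃ C : ℝ, ∀ x, A.w₀ y x ≤ C) ∧
  (∀ t, 1 ≤ t → t ≤ T → ∀ x x', A.p t x x' = 0 → H.m x x' = 0) ∧
  (∃ C : ℝ, ∀ t, 1 ≤ t → t ≤ T → ∀ x x', A.w y t x x' ≤ C)

/-- The transition density and the proposal densities are bounded up to time `T`. -/
def BoundedDensities (T : ℕ) : Prop :=
  (∃ C : ℝ, ∀ x x', H.m x x' ≤ C) ∧
  (∃ C : ℝ, ∀ t, 1 ≤ t → t ≤ T → ∀ x x', A.p t x x' ≤ C)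

section Particles

variable {Ω : Type*} {N : ℕ} (ξ : ℕ → Fin N → Ω → X) (I : ℕ → Fin N → Ω → Fin N)

/-- The importance weight of particle `i` at time `t`, for particles `ξ` and ancestor indices `I`. -/
def weight : (t : ℕ) → Fin N → Ω → ℝ
  | 0, i, ω => A.w₀ y (ξ 0 i ω)
  | t + 1, i, ω => A.w y (t + 1) (ξ t (I (t + 1) i ω) ω) (ξ (t + 1) i ω)

/-- The particle filter `φ̂_t = ∑ᵢ (ω_t^i / ∑ⱼ ω_t^j) δ_{ξ_t^i}` (zero if all weights vanish). -/
def filterHat (t : ℕ) (ω : Ω) : Measure X :=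
  (∑ i, ENNReal.ofReal (A.weight y ξ I t i ω))⁻¹ •
    ∑ i, ENNReal.ofReal (A.weight y ξ I t i ω) • Measure.dirac (ξ t i ω)

/-- The forward filtering backward smoothing estimator
`φ̂_{0:T|T}(h) = ∫⋯∫ φ̂_T(dx_T) B_{φ̂_{T-1}}(x_T, dx_{T-1}) ⋯ B_{φ̂_0}(x_1, dx_0) h(x_{0:T})`. -/
def smoothHat {T : ℕ} (h : (Fin (T + 1) → X) → ℝ) (ω : Ω) : ℝ :=
  ∫ x, H.backwardInt (fun t => A.filterHat y ξ I t ω) T (HMM.lift h) (fun _ => x)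
    ∂(A.filterHat y ξ I T ω)

/-- The instrumental distribution on `{1, …, N} × X` from which the pairs (index, particle) of
time `t + 1` are drawn, proportional to `ω_t^i ϑ_{t+1}(ξ_t^i) P_{t+1}(ξ_t^i, dx)`. -/
def instr (t : ℕ) (ω : Ω) : Measure (Fin N × X) :=
  (∑ i, ENNReal.ofReal (A.weight y ξ I t i ω * A.ϑ (t + 1) (ξ t i ω)))⁻¹ •
    ∑ i, ENNReal.ofReal (A.weight y ξ I t i ω * A.ϑ (t + 1) (ξ t i ω)) •
      (Measure.dirac i).prod (A.P (t + 1) (ξ t i ω))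

/-- The σ-algebra generated by the particles and weights up to time `t`. -/
@[reducible]
def hist (t : ℕ) : MeasurableSpace Ω :=
  ⨆ s ∈ Finset.range (t + 1), ⨆ i : Fin N,
    MeasurableSpace.comap (fun ω => (ξ s i ω, A.weight y ξ I s i ω)) inferInstance

/-- `ξ` and `I` are the particles and ancestor indices of an auxiliary particle filter with `N`
particles run up to time `T`: the initial particles are i.i.d. with law `ρ₀`, and, conditionally
on the particles and weights up to time `t`, the `N` pairs (index, particle) of time `t + 1` are
i.i.d. with the instrumental distribution. Nothing is prescribed on the event that all weights
of time `t` vanish, where that distribution is undefined. -/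
structure IsParticleFilter [MeasurableSpace Ω] (μ : Measure Ω) (T : ℕ) : Prop where
  measurable_ξ : ∀ t i, Measurable (ξ t i)
  measurable_I : ∀ t i, Measurable (I t i)
  indep_init : iIndepFun (fun i => ξ 0 i) μ
  law_init : ∀ i, μ.map (ξ 0 i) = A.ρ₀
  step : ∀ t < T, ∀ S : Set (Fin N → Fin N × X), MeasurableSet S →
    μ[Set.indicator {ω | (fun i => (I (t + 1) i ω, ξ (t + 1) i ω)) ∈ S} (fun _ => (1 : ℝ))
        | A.hist y ξ I t]
      =ᵐ[μ.restrict {ω | 0 < ∑ i, A.weight y ξ I t i ω}]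
        fun ω => (Measure.pi (fun _ : Fin N => A.instr y ξ I t ω)).real S

end Particles

end Proposal

end FFBS

end

namespace FFBS

/-! The error is analysed before normalisation. `gHat` is the weighted empirical measure times the
estimate `zHat` of the normalising constant. The factor `zHat` cancels the normalisation of the
instrumental law, so that `gHat` is an unbiased estimator of `γ`. It also vanishes once all weights
of an earlier time vanish, and this is why nothing need be known about the draw on that event.

The functional `pathHat t` integrates the particle backward kernels against `gHat t`. Evaluate it at
the forward integral of a fixed path function `f`. Because `B_η` reverses `η(dx) M(x, dx')`, also
when `η` is the particle filter itself, the value at time `t` is exactly the conditional mean, given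
the history up to `t`, of the value at time `t + 1` (`integral_integral_B`,
`pathHat_forwardInt_succ`). The backward kernels in the integrand at `t + 1` involve only filters up
to time `t`, so given the history each step is a mean of i.i.d. bounded variables
(`exists_isCondIID`). Hence the values form a martingale in `t`. This gives unbiasedness, a mean
square error of order `1/N`, and, with the quantitative bound `norm_charFun_average_sub_le`, an
induction on characteristic functions: each step contributes a Gaussian factor whose exponent is the
conditional variance (`tendsto_charFun_pathHat`).

The main difficulty is that this conditional variance converges in mean to a constant, because it
contains squares of ratios `B` with random and possibly small denominators. Written as an integral
against `ν(dx')`, its integrand at a fixed `x'` is such a squared ratio times a factor dominated by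
the denominator. It therefore converges without any lower bound on the denominator
(`abs_mul_sq_sub_le`, `integral_abs_sqDensityHat_sub_le_sqrt`). Unbiasedness gives a `ν`-integrable
bound free of `N`, so dominated convergence applies (`tendsto_lintegral_enorm_second_moment`).

To return to the normalised estimator, the backward kernels are almost surely normalised where it
matters: the mass they retain is at most the mass of `gHat`, and the expectations agree
(`pathHat_one_ae_eq`). Thus `pathHat` of the centred function is the mass of `gHat` times the error
of the smoother, and a Slutsky argument divides by that mass (`tendstoInDistribution_of_ae_eq_mul`).
-/

lemma integrable_of_abs_le {α : Type*} [MeasurableSpace α] {μ : Measure α} [IsFiniteMeasure μ]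
    {f : α → ℝ} (hf : Measurable f) {K : ℝ} (hK : ∀ x, |f x| ≤ K) : Integrable f μ :=
  Integrable.of_bound hf.aestronglyMeasurable K (ae_of_all _ hK)

lemma abs_integral_le_of_abs_le {α : Type*} [MeasurableSpace α] {μ : Measure α}
    [IsProbabilityMeasure μ] {f : α → ℝ} {K : ℝ} (hK : ∀ x, |f x| ≤ K) : |∫ x, f x ∂μ| ≤ K := by
  simpa using norm_integral_le_of_norm_le_const (μ := μ) (f := f) (ae_of_all _ hK)

/-! ### Means of bounded i.i.d. variables: moments and Gaussian approximation. -/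

section IID

variable {𝒵 : Type*} [MeasurableSpace 𝒵] {N : ℕ} {ρ : Measure 𝒵} [IsProbabilityMeasure ρ]
  {Y : 𝒵 → ℝ} {K : ℝ}

lemma integral_pi_average (hN : N ≠ 0) (hY : Measurable Y) (hK : ∀ z, |Y z| ≤ K) :
    ∫ z, (N : ℝ)⁻¹ * ∑ i, Y (z i) ∂(Measure.pi fun _ : Fin N => ρ) = ∫ z, Y z ∂ρ := by
  rw [integral_const_mul, integral_finsetSum]
  · have (i : Fin N) : ∫ z, Y (z i) ∂(Measure.pi fun _ : Fin N => ρ) = ∫ z, Y z ∂ρ :=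
      integral_comp_eval (μ := fun _ : Fin N => ρ) hY.aestronglyMeasurable
    simp [this, hN]
  · exact fun i _ => integrable_of_abs_le (hY.comp (measurable_pi_apply i)) (fun z => hK (z i))

lemma integral_pi_average_sub_sq_le (hN : N ≠ 0) (hY : Measurable Y) (hK : ∀ z, |Y z| ≤ K) :
    ∫ z, ((N : ℝ)⁻¹ * ∑ i, Y (z i) - ∫ z, Y z ∂ρ) ^ 2 ∂(Measure.pi fun _ : Fin N => ρ)
      ≤ K ^ 2 / N := by
  have hmem : MemLp Y 2 ρ := MemLp.of_bound hY.aestronglyMeasurable K (ae_of_all _ hK)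
  have hv := variance_sum_pi (μ := fun _ : Fin N => ρ) (X := fun _ => Y) (fun _ => hmem)
  have hVar : Var[Y; ρ] ≤ K ^ 2 := by
    refine (variance_le_expectation_sq hY.aestronglyMeasurable).trans ?_
    refine (le_abs_self _).trans (abs_integral_le_of_abs_le fun z => ?_)
    simp only [Pi.pow_apply, abs_pow]
    exact pow_le_pow_left₀ (abs_nonneg _) (hK z) 2
  have hmean : ∫ z, (∑ i, fun z : Fin N → 𝒵 => Y (z i)) z ∂(Measure.pi fun _ : Fin N => ρ)
      = N * ∫ z, Y z ∂ρ := by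
    have := integral_pi_average (ρ := ρ) hN hY hK
    rw [integral_const_mul, inv_mul_eq_iff_eq_mul₀ (by positivity)] at this
    simpa using this
  rw [variance_eq_integral (by fun_prop), hmean] at hv
  have hN' : (0 : ℝ) < N := by positivity
  have : ∀ z : Fin N → 𝒵, ((N : ℝ)⁻¹ * ∑ i, Y (z i) - ∫ z, Y z ∂ρ) ^ 2
      = ((N : ℝ) ^ 2)⁻¹ * ((∑ i, fun z : Fin N → 𝒵 => Y (z i)) z - N * ∫ z, Y z ∂ρ) ^ 2 := by
    intro z
    simp only [Finset.sum_apply]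
    field_simp
  simp_rw [this]
  rw [integral_const_mul, hv]
  simp only [Finset.sum_const, Finset.card_univ, Fintype.card_fin, nsmul_eq_mul]
  rw [div_eq_mul_inv, show ((N : ℝ) ^ 2)⁻¹ * (N * Var[Y; ρ]) = Var[Y; ρ] * (N : ℝ)⁻¹ by field_simp]
  gcongr

/-- Telescoping in the closed unit disc. It transfers a one-variable approximation of a
characteristic function to its `N`-th power at the cost of a factor `N`. -/
lemma norm_pow_sub_pow_le {a b : ℂ} (ha : ‖a‖ ≤ 1) (hb : ‖b‖ ≤ 1) (n : ℕ) :
    ‖a ^ n - b ^ n‖ ≤ n * ‖a - b‖ := by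
  induction n with
  | zero => simp
  | succ n ih =>
    have : a ^ (n + 1) - b ^ (n + 1) = a * (a ^ n - b ^ n) + (a - b) * b ^ n := by ring
    rw [this]
    refine (norm_add_le _ _).trans ?_
    rw [norm_mul, norm_mul, norm_pow]
    have h1 : ‖a‖ * ‖a ^ n - b ^ n‖ ≤ 1 * (n * ‖a - b‖) := by gcongr
    have h2 : ‖a - b‖ * ‖b‖ ^ n ≤ ‖a - b‖ * 1 := by
      gcongr; exact pow_le_one₀ (norm_nonneg _) hb
    push_cast
    linarith

/-- The constant in the Gaussian approximation of the characteristic function of a normalised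
sum of i.i.d. variables bounded by `K`. -/
noncomputable def cltConst (u K : ℝ) : ℝ :=
  (2 * |u| * K) ^ 3 * Real.exp (2 * |u| * K) + ((u * K) ^ 2) ^ 2 * Real.exp ((u * K) ^ 2)

/-- Taylor expansion of the exponential with a third order remainder; centring removes the linear
term. -/
lemma norm_charFun_sub_le {s : ℝ} (hY : Measurable Y) (hK : ∀ z, |Y z| ≤ K)
    (h0 : ∫ z, Y z ∂ρ = 0) :
    ‖∫ z, Complex.exp (Complex.I * (s * Y z : ℝ)) ∂ρ
      - (1 - (s ^ 2 * (∫ z, Y z ^ 2 ∂ρ) / 2 : ℝ))‖ ≤ (|s| * K) ^ 3 * Real.exp (|s| * K) := by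
  have hi : Integrable Y ρ := integrable_of_abs_le hY hK
  have hi2 : Integrable (fun z => Y z ^ 2) ρ :=
    integrable_of_abs_le (K := K ^ 2) (by fun_prop) fun z => by
      rw [abs_pow]; exact pow_le_pow_left₀ (abs_nonneg _) (hK z) 2
  have he : Integrable (fun z => Complex.exp (Complex.I * (s * Y z : ℝ))) ρ :=
    Integrable.of_bound (by fun_prop) 1
      (ae_of_all _ fun z => by rw [Complex.norm_exp_I_mul_ofReal])
  have hlin : ∫ z, ((1 : ℂ) + Complex.I * s * (Y z : ℂ) - (s ^ 2 / 2 : ℝ) * ((Y z ^ 2 : ℝ) : ℂ)) ∂ρ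
      = 1 - (s ^ 2 * (∫ z, Y z ^ 2 ∂ρ) / 2 : ℝ) := by
    rw [integral_sub, integral_add, integral_const_mul, integral_const_mul,
      integral_complex_ofReal, integral_complex_ofReal, h0]
    · simp; ring
    · simp
    · exact (hi.ofReal (𝕜 := ℂ)).const_mul _
    · exact (integrable_const _).add ((hi.ofReal (𝕜 := ℂ)).const_mul _)
    · exact (hi2.ofReal (𝕜 := ℂ)).const_mul _
  rw [← hlin, ← integral_sub he]
  · refine (norm_integral_le_of_norm_le_const (C := (|s| * K) ^ 3 * Real.exp (|s| * K))
      (ae_of_all _ fun z => ?_)).trans (by simp)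
    have h := Complex.norm_exp_sub_sum_le_norm_mul_exp (Complex.I * (s * Y z : ℝ)) 3
    have hn : ‖Complex.I * (s * Y z : ℝ)‖ ≤ |s| * K := by
      rw [norm_mul, Complex.norm_I, one_mul, Complex.norm_real, Real.norm_eq_abs, abs_mul]
      exact mul_le_mul_of_nonneg_left (hK z) (abs_nonneg _)
    have hs : ∑ m ∈ Finset.range 3, (Complex.I * (s * Y z : ℝ)) ^ m / (m.factorial : ℂ)
        = (1 : ℂ) + Complex.I * s * (Y z : ℂ) - (s ^ 2 / 2 : ℝ) * ((Y z ^ 2 : ℝ) : ℂ) := by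
      simp [Finset.sum_range_succ, mul_pow, Nat.factorial]
      ring
    rw [hs] at h
    refine h.trans ?_
    have := (norm_nonneg _).trans hn
    gcongr
  · exact ((integrable_const _).add ((hi.ofReal (𝕜 := ℂ)).const_mul _)).sub
      ((hi2.ofReal (𝕜 := ℂ)).const_mul _)

/-- After centring, the characteristic function is an `N`-th power, compared factor by factor with
the Gaussian one. The bound depends on the law `ρ` only through `K`, so it can be integrated over
random conditional laws, whose variance may be arbitrarily small. -/
lemma norm_charFun_average_sub_le (hN : N ≠ 0) (hY : Measurable Y) (hK : ∀ z, |Y z| ≤ K) (u : ℝ) :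
    ‖∫ z, Complex.exp (Complex.I * (u * (√N * ((N : ℝ)⁻¹ * ∑ i, Y (z i))) : ℝ))
        ∂(Measure.pi fun _ : Fin N => ρ)
      - Complex.exp (Complex.I * (u * (√N * ∫ z, Y z ∂ρ) : ℝ))
        * Real.exp (-(u ^ 2 * ((∫ z, Y z ^ 2 ∂ρ) - (∫ z, Y z ∂ρ) ^ 2) / 2))‖
      ≤ cltConst u K / √N := by
  set a := ∫ z, Y z ∂ρ with ha
  set v := (∫ z, Y z ^ 2 ∂ρ) - a ^ 2 with hv
  have hN' : (0 : ℝ) < N := by positivity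
  have hsq : 0 < √(N : ℝ) := Real.sqrt_pos.2 hN'
  have hsqN : √(N : ℝ) * √(N : ℝ) = N := Real.mul_self_sqrt hN'.le
  have hsq1 : 1 ≤ √(N : ℝ) := by
    rw [Real.one_le_sqrt]; exact_mod_cast Nat.one_le_iff_ne_zero.2 hN
  have e3 : (√(N : ℝ))⁻¹ * √(N : ℝ) = 1 := inv_mul_cancel₀ hsq.ne'
  have e2 : (√(N : ℝ))⁻¹ * N = √(N : ℝ) := by rw [inv_mul_eq_div, Real.div_sqrt]
  have e1 : √(N : ℝ) * (N : ℝ)⁻¹ = (√(N : ℝ))⁻¹ := by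
    rw [← div_eq_mul_inv, Real.sqrt_div_self', one_div]
  set s := u / √N with hs
  have hi : Integrable Y ρ := integrable_of_abs_le hY hK
  have hi2 : Integrable (fun z => Y z ^ 2) ρ :=
    integrable_of_abs_le (K := K ^ 2) (by fun_prop) fun z => by
      rw [abs_pow]; exact pow_le_pow_left₀ (abs_nonneg _) (hK z) 2
  have haK : |a| ≤ K := abs_integral_le_of_abs_le hK
  have hK0 : 0 ≤ K := (abs_nonneg _).trans haK
  have hX0 : ∫ z, (Y z - a) ∂ρ = 0 := by
    rw [integral_sub hi (integrable_const _)]; simp [ha]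
  have hXv : ∫ z, (Y z - a) ^ 2 ∂ρ = v := by
    have : ∀ z, (Y z - a) ^ 2 = Y z ^ 2 - 2 * a * Y z + a ^ 2 := fun z => by ring
    simp_rw [this]
    have h1 : Integrable (fun z => Y z ^ 2 - 2 * a * Y z) ρ := hi2.sub (hi.const_mul _)
    rw [integral_add h1 (integrable_const _), integral_sub hi2 (hi.const_mul _),
      integral_const_mul]
    simp [hv, ← ha]; ring
  have hv0 : 0 ≤ v := hXv ▸ integral_nonneg fun z => sq_nonneg _
  have hvK : v ≤ K ^ 2 := by
    have : ∫ z, Y z ^ 2 ∂ρ ≤ K ^ 2 := by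
      refine (le_abs_self _).trans (abs_integral_le_of_abs_le fun z => ?_)
      rw [abs_pow]; exact pow_le_pow_left₀ (abs_nonneg _) (hK z) 2
    rw [hv]; nlinarith [sq_nonneg a]
  -- Centring at most doubles the bound `K`.
  have hcf := norm_charFun_sub_le (ρ := ρ) (Y := fun z => Y z - a) (K := 2 * K) (s := s)
    (by fun_prop) (fun z => (abs_sub _ _).trans (by linarith [hK z])) hX0
  rw [hXv] at hcf
  set c := ∫ z, Complex.exp (Complex.I * (s * (Y z - a) : ℝ)) ∂ρ with hc
  set d : ℂ := ((Real.exp (-(s ^ 2 * v / 2)) : ℝ) : ℂ) with hd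
  have hprod : ∫ z, Complex.exp (Complex.I * (u * (√N * ((N : ℝ)⁻¹ * ∑ i, Y (z i))) : ℝ))
        ∂(Measure.pi fun _ : Fin N => ρ)
      = Complex.exp (Complex.I * (u * (√N * a) : ℝ)) * c ^ N := by
    have hcp := integral_fintype_prod_eq_pow (ι := Fin N) (μ := ρ)
      (fun z => Complex.exp (Complex.I * (s * (Y z - a) : ℝ)))
    rw [Fintype.card_fin] at hcp
    rw [hc, ← hcp, ← integral_const_mul]
    refine integral_congr_ae (ae_of_all _ fun z => ?_)
    simp only
    rw [← Complex.exp_sum, ← Complex.exp_add, ← Finset.mul_sum, ← mul_add, ← Complex.ofReal_sum,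
      ← Complex.ofReal_add]
    congr 3
    rw [← Finset.mul_sum, Finset.sum_sub_distrib]
    simp only [Finset.sum_const, Finset.card_univ, Fintype.card_fin, nsmul_eq_mul]
    rw [hs]
    linear_combination (u * ∑ i, Y (z i)) * e1 + (u * a) * e2
  have hdN : d ^ N = Real.exp (-(u ^ 2 * v / 2)) := by
    rw [hd, ← Complex.ofReal_pow, ← Real.exp_nat_mul]
    congr 2
    rw [hs, div_pow, Real.sq_sqrt hN'.le]
    field_simp
  rw [hprod, ← hdN, ← mul_sub, norm_mul, Complex.norm_exp_I_mul_ofReal, one_mul]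
  have hc1 : ‖c‖ ≤ 1 :=
    (norm_integral_le_of_norm_le_const (C := 1)
      (ae_of_all _ fun z => by rw [Complex.norm_exp_I_mul_ofReal])).trans (by simp)
  have hd1 : ‖d‖ ≤ 1 := by
    rw [hd, Complex.norm_real, Real.norm_eq_abs, Real.abs_exp, Real.exp_le_one_iff]
    have := mul_nonneg (sq_nonneg s) hv0
    linarith
  refine (norm_pow_sub_pow_le hc1 hd1 N).trans ?_
  have hs2 : s ^ 2 * v / 2 ≤ (u * K) ^ 2 / N := by
    rw [hs, div_pow, Real.sq_sqrt hN'.le]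
    have : u ^ 2 * v ≤ u ^ 2 * K ^ 2 := by gcongr
    rw [div_mul_eq_mul_div, mul_pow, div_right_comm]
    gcongr
    nlinarith [mul_nonneg (sq_nonneg u) hv0]
  have hs20 : 0 ≤ s ^ 2 * v / 2 := by positivity
  have hdd : ‖d - (1 - (s ^ 2 * v / 2 : ℝ))‖
      ≤ ((u * K) ^ 2 / N) ^ 2 * Real.exp ((u * K) ^ 2) := by
    have h := Complex.norm_exp_sub_sum_le_norm_mul_exp (-(s ^ 2 * v / 2) : ℝ) 2
    have hn : ‖((-(s ^ 2 * v / 2) : ℝ) : ℂ)‖ = s ^ 2 * v / 2 := by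
      rw [Complex.norm_real, Real.norm_eq_abs, abs_neg, abs_of_nonneg hs20]
    rw [hn] at h
    have h' : d - (1 - (s ^ 2 * v / 2 : ℝ)) = Complex.exp ((-(s ^ 2 * v / 2) : ℝ)) -
        ∑ m ∈ Finset.range 2, ((-(s ^ 2 * v / 2) : ℝ) : ℂ) ^ m / (m.factorial : ℂ) := by
      rw [hd]; simp [Finset.sum_range_succ]; ring
    rw [h']
    refine h.trans ?_
    gcongr
    refine hs2.trans (div_le_self (sq_nonneg _) ?_)
    exact_mod_cast Nat.one_le_iff_ne_zero.2 hN
  have hcc : ‖c - (1 - (s ^ 2 * v / 2 : ℝ))‖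
      ≤ (2 * |u| * K / √N) ^ 3 * Real.exp (2 * |u| * K) := by
    have hsK : |s| * (2 * K) = 2 * |u| * K / √N := by
      rw [hs, abs_div, abs_of_pos hsq]; ring
    rw [hsK] at hcf
    refine hcf.trans ?_
    gcongr
    exact div_le_self (by positivity) hsq1
  have hcd : ‖c - d‖ ≤ (2 * |u| * K / √N) ^ 3 * Real.exp (2 * |u| * K)
      + ((u * K) ^ 2 / N) ^ 2 * Real.exp ((u * K) ^ 2) := by
    calc ‖c - d‖ = ‖(c - (1 - (s ^ 2 * v / 2 : ℝ))) - (d - (1 - (s ^ 2 * v / 2 : ℝ)))‖ := by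
          congr 1; ring
      _ ≤ _ := (norm_sub_le _ _).trans (add_le_add hcc hdd)
  -- The cubic term leaves `N · N^{-3/2}` and the quadratic one `N · N^{-2}`; both are at most
  -- `1/√N`.
  calc (N : ℝ) * ‖c - d‖ ≤ N * ((2 * |u| * K / √N) ^ 3 * Real.exp (2 * |u| * K)
      + ((u * K) ^ 2 / N) ^ 2 * Real.exp ((u * K) ^ 2)) := by gcongr
    _ = (2 * |u| * K) ^ 3 * Real.exp (2 * |u| * K) / √N
      + ((u * K) ^ 2) ^ 2 * Real.exp ((u * K) ^ 2) / N := by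
        rw [mul_add]
        congr 1
        · linear_combination ((2 * |u| * K) ^ 3 * Real.exp (2 * |u| * K)) * (√(N : ℝ))⁻¹ ^ 2 * e2
            + ((2 * |u| * K) ^ 3 * Real.exp (2 * |u| * K)) * (√(N : ℝ))⁻¹ * e3
        · field_simp
    _ ≤ (2 * |u| * K) ^ 3 * Real.exp (2 * |u| * K) / √N
      + ((u * K) ^ 2) ^ 2 * Real.exp ((u * K) ^ 2) / √N := by
        gcongr
        nlinarith
    _ = cltConst u K / √N := by rw [cltConst, add_div]

end IID

/-! ### The same estimates for conditionally i.i.d. draws. -/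

section CondIID

variable {Ω E 𝒵 : Type*} [MeasurableSpace Ω] [MeasurableSpace E] [MeasurableSpace 𝒵] {N : ℕ}

/-- The kernel whose values are the laws of `N` independent draws from the values of `κ`. -/
noncomputable def iidKernel (N : ℕ) (κ : Kernel E 𝒵) [IsMarkovKernel κ] :
    Kernel E (Fin N → 𝒵) where
  toFun e := Measure.pi fun _ => κ e
  measurable' := by
    refine Measurable.measure_of_isPiSystem_of_isProbabilityMeasure generateFrom_pi.symm
      isPiSystem_pi ?_
    rintro _ ⟨s, hs, rfl⟩
    simp_rw [Measure.pi_pi]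
    exact Finset.measurable_prod _ fun i _ => κ.measurable_coe (hs i (Set.mem_univ i))

lemma iidKernel_apply (κ : Kernel E 𝒵) [IsMarkovKernel κ] (e : E) :
    iidKernel N κ e = Measure.pi fun _ => κ e := rfl

instance (κ : Kernel E 𝒵) [IsMarkovKernel κ] : IsMarkovKernel (iidKernel N κ) :=
  ⟨fun e => by rw [iidKernel_apply]; infer_instance⟩

/-- On the event `V ∈ D`, the variables `ζ i` are conditionally i.i.d. with law `κ V`, given `V`. -/
def IsCondIID (μ : Measure Ω) (V : Ω → E) (D : Set E) (κ : Kernel E 𝒵) [IsMarkovKernel κ]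
    (ζ : Fin N → Ω → 𝒵) : Prop :=
  (μ.restrict (V ⁻¹' D)).map (fun ω => (V ω, fun i => ζ i ω))
    = (μ.restrict (V ⁻¹' D)).map V ⊗ₘ iidKernel N κ

variable {μ : Measure Ω} [IsProbabilityMeasure μ] {V : Ω → E} {D : Set E} {κ : Kernel E 𝒵}
  [IsMarkovKernel κ] {ζ : Fin N → Ω → 𝒵}

/-- It suffices to test on rectangles `A × S`; there the claim is the defining property of the
conditional expectation on the event `V ∈ A ∩ D`. -/
lemma isCondIID_of_condExp (hV : Measurable V) (hD : MeasurableSet D) (hζ : ∀ i, Measurable (ζ i))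
    (h : ∀ S : Set (Fin N → 𝒵), MeasurableSet S →
      μ[Set.indicator {ω | (fun i => ζ i ω) ∈ S} (fun _ => (1 : ℝ)) | MeasurableSpace.comap V ‹_›]
        =ᵐ[μ.restrict (V ⁻¹' D)] fun ω => (Measure.pi fun _ : Fin N => κ (V ω)).real S) :
    IsCondIID μ V D κ ζ := by
  have hm : MeasurableSpace.comap V ‹_› ≤ ‹MeasurableSpace Ω› := hV.comap_le
  have hζ' : Measurable fun ω i => ζ i ω := measurable_pi_lambda _ hζ
  refine Measure.ext_prod fun {A S} hA hS => ?_
  rw [Measure.compProd_apply_prod hA hS, Measure.map_apply (hV.prodMk hζ') (hA.prod hS),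
    setLIntegral_map hA ((iidKernel N κ).measurable_coe hS) hV]
  have hS' : MeasurableSet {ω | (fun i => ζ i ω) ∈ S} := hζ' hS
  have hA' := hV hA
  have hD' := hV hD
  have hAD : MeasurableSet[MeasurableSpace.comap V ‹_›] (V ⁻¹' (A ∩ D)) := ⟨_, hA.inter hD, rfl⟩
  have key := setIntegral_condExp (μ := μ) hm
    (f := Set.indicator {ω | (fun i => ζ i ω) ∈ S} (fun _ => (1 : ℝ)))
    ((integrable_const _).indicator hS') hAD
  rw [setIntegral_indicator hS', setIntegral_const, smul_eq_mul, mul_one] at key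
  have hr : μ.restrict (V ⁻¹' (A ∩ D)) ≪ μ.restrict (V ⁻¹' D) :=
    Measure.absolutelyContinuous_of_le (Measure.restrict_mono_set _ Set.inter_subset_right)
  rw [integral_congr_ae (hr.ae_eq (h S hS))] at key
  rw [Measure.restrict_restrict hA', ← Set.preimage_inter]
  have hmeas : Measurable fun ω => iidKernel N κ (V ω) S :=
    ((iidKernel N κ).measurable_coe hS).comp hV
  have h1 : ∫⁻ ω in V ⁻¹' (A ∩ D), iidKernel N κ (V ω) S ∂μ
      = ENNReal.ofReal (∫ ω in V ⁻¹' (A ∩ D), (Measure.pi fun _ : Fin N => κ (V ω)).real S ∂μ) := by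
    have := integral_toReal (μ := μ.restrict (V ⁻¹' (A ∩ D))) hmeas.aemeasurable
      (ae_of_all _ fun ω => measure_lt_top _ _)
    simp only [Measure.real, ← iidKernel_apply]
    rw [this, ENNReal.ofReal_toReal]
    refine ne_top_of_le_ne_top (measure_ne_top (μ.restrict (V ⁻¹' (A ∩ D))) Set.univ) ?_
    rw [← lintegral_one]
    exact lintegral_mono fun ω => prob_le_one
  rw [h1, key, ofReal_measureReal, Measure.restrict_apply' hD']
  congr 1
  ext ω
  simp only [Set.mem_inter_iff, Set.mem_preimage, Set.mem_prod, Set.mem_ofPred_eq]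
  tauto

variable {F : Type*} [NormedAddCommGroup F] [NormedSpace ℝ F]

lemma IsCondIID.setIntegral_eq (h : IsCondIID μ V D κ ζ) (hV : Measurable V)
    (hζ : ∀ i, Measurable (ζ i)) {f : E × (Fin N → 𝒵) → F} (hf : StronglyMeasurable f) {K : ℝ}
    (hK : ∀ ω z, ‖f (V ω, z)‖ ≤ K) :
    ∫ ω in V ⁻¹' D, f (V ω, fun i => ζ i ω) ∂μ
      = ∫ ω in V ⁻¹' D, ∫ z, f (V ω, z) ∂(Measure.pi fun _ => κ (V ω)) ∂μ := by
  have hζ' : Measurable fun ω i => ζ i ω := measurable_pi_lambda _ hζ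
  have hp := hV.prodMk hζ'
  have h1 := integral_map (μ := μ.restrict (V ⁻¹' D)) hp.aemeasurable
    hf.aestronglyMeasurable
  have hint : Integrable f ((μ.restrict (V ⁻¹' D)).map (fun ω => (V ω, fun i => ζ i ω))) := by
    rw [integrable_map_measure hf.aestronglyMeasurable hp.aemeasurable]
    exact Integrable.of_bound (hf.comp_measurable hp).aestronglyMeasurable K
      (ae_of_all _ fun ω => hK ω _)
  rw [h] at hint h1
  rw [← h1, Measure.integral_compProd hint, integral_map hV.aemeasurable]
  · rfl
  · exact (hf.integral_kernel_prod_right' (κ := iidKernel N κ)).aestronglyMeasurable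

variable {Y : E → 𝒵 → ℝ} {K : ℝ}

/-- Since `Y` vanishes off `D`, only the part of `Ω` where the conditional law is known contributes.
-/
lemma IsCondIID.integral_average (h : IsCondIID μ V D κ ζ) (hN : N ≠ 0) (hV : Measurable V)
    (hζ : ∀ i, Measurable (ζ i)) (hY : Measurable (Function.uncurry Y))
    (hK : ∀ ω z, |Y (V ω) z| ≤ K) (h0 : ∀ e ∉ D, ∀ z, Y e z = 0) :
    ∫ ω, (N : ℝ)⁻¹ * ∑ i, Y (V ω) (ζ i ω) ∂μ = ∫ ω, ∫ z, Y (V ω) z ∂(κ (V ω)) ∂μ := by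
  have hYm : ∀ e, Measurable (Y e) := fun e => hY.of_uncurry_left
  have hYi : ∀ i : Fin N, Measurable fun p : E × (Fin N → 𝒵) => Y p.1 (p.2 i) := fun i =>
    hY.comp (measurable_fst.prodMk ((measurable_pi_apply i).comp measurable_snd))
  rw [← setIntegral_eq_integral_of_forall_compl_eq_zero (s := V ⁻¹' D),
    ← setIntegral_eq_integral_of_forall_compl_eq_zero (s := V ⁻¹' D)
      (f := fun ω => ∫ z, Y (V ω) z ∂(κ (V ω)))]
  · rw [h.setIntegral_eq hV hζ (f := fun p => (N : ℝ)⁻¹ * ∑ i, Y p.1 (p.2 i)) (K := K)]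
    · refine integral_congr_ae (ae_of_all _ fun ω => ?_)
      exact integral_pi_average hN (hYm _) (hK ω)
    · exact (measurable_const.mul (Finset.measurable_sum _ fun i _ => hYi i)).stronglyMeasurable
    · intro ω z
      simp only [Real.norm_eq_abs, abs_mul, abs_inv, Nat.abs_cast]
      rw [inv_mul_le_iff₀ (by positivity)]
      refine (Finset.abs_sum_le_sum_abs _ _).trans ?_
      refine (Finset.sum_le_sum fun i _ => hK ω (z i)).trans (by simp)
  · exact fun ω hω => by simp [h0 _ hω]
  · exact fun ω hω => by simp [h0 _ hω]

lemma IsCondIID.integral_average_sub_sq_le (h : IsCondIID μ V D κ ζ) (hN : N ≠ 0)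
    (hV : Measurable V) (hζ : ∀ i, Measurable (ζ i))
    (hY : Measurable (Function.uncurry Y)) (hK : ∀ ω z, |Y (V ω) z| ≤ K)
    (h0 : ∀ e ∉ D, ∀ z, Y e z = 0) :
    ∫ ω, ((N : ℝ)⁻¹ * ∑ i, Y (V ω) (ζ i ω) - ∫ z, Y (V ω) z ∂(κ (V ω))) ^ 2 ∂μ ≤ K ^ 2 / N := by
  have hYm : ∀ e, Measurable (Y e) := fun e => hY.of_uncurry_left
  have hYi : ∀ i : Fin N, Measurable fun p : E × (Fin N → 𝒵) => Y p.1 (p.2 i) := fun i =>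
    hY.comp (measurable_fst.prodMk ((measurable_pi_apply i).comp measurable_snd))
  have hbar : Measurable fun e => ∫ z, Y e z ∂(κ e) :=
    (hY.stronglyMeasurable.integral_kernel_prod_right (κ := κ)).measurable
  have hav : ∀ ω (z : Fin N → 𝒵), |(N : ℝ)⁻¹ * ∑ i, Y (V ω) (z i)| ≤ K := by
    intro ω z
    simp only [abs_mul, abs_inv, Nat.abs_cast]
    rw [inv_mul_le_iff₀ (by positivity)]
    refine (Finset.abs_sum_le_sum_abs _ _).trans ?_
    refine (Finset.sum_le_sum fun i _ => hK ω (z i)).trans (by simp)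
  have hK0 : 0 ≤ K ^ 2 / N := by positivity
  rw [← setIntegral_eq_integral_of_forall_compl_eq_zero (s := V ⁻¹' D)]
  · rw [h.setIntegral_eq hV hζ
      (f := fun p => ((N : ℝ)⁻¹ * ∑ i, Y p.1 (p.2 i) - ∫ z, Y p.1 z ∂(κ p.1)) ^ 2)
      (K := (2 * K) ^ 2)]
    · have hC : ∀ ω, ‖∫ z : Fin N → 𝒵, ((N : ℝ)⁻¹ * ∑ i, Y (V ω) (z i)
          - ∫ z, Y (V ω) z ∂(κ (V ω))) ^ 2 ∂(Measure.pi fun _ => κ (V ω))‖ ≤ K ^ 2 / N := by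
        intro ω
        rw [Real.norm_eq_abs, abs_of_nonneg (integral_nonneg fun z => sq_nonneg _)]
        exact integral_pi_average_sub_sq_le hN (hYm _) (hK ω)
      refine (Real.le_norm_self _).trans
        ((norm_integral_le_of_norm_le_const (ae_of_all _ hC)).trans ?_)
      refine mul_le_of_le_one_right hK0 ?_
      simp only [measureReal_restrict_apply_univ]
      exact measureReal_le_one
    · exact (((measurable_const.mul (Finset.measurable_sum _ fun i _ => hYi i)).sub
        (hbar.comp measurable_fst)).pow_const 2).stronglyMeasurable
    · intro ω z
      rw [Real.norm_eq_abs, abs_pow]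
      refine pow_le_pow_left₀ (abs_nonneg _) ((abs_sub _ _).trans ?_) 2
      have := abs_integral_le_of_abs_le (μ := κ (V ω)) (hK ω)
      linarith [hav ω z]
  · exact fun ω hω => by simp [h0 _ hω]

lemma IsCondIID.norm_charFun_sub_le (h : IsCondIID μ V D κ ζ) (hN : N ≠ 0)
    (hV : Measurable V) (hζ : ∀ i, Measurable (ζ i))
    (hY : Measurable (Function.uncurry Y)) (hK : ∀ ω z, |Y (V ω) z| ≤ K)
    (h0 : ∀ e ∉ D, ∀ z, Y e z = 0) (u : ℝ) :
    ‖∫ ω, Complex.exp (Complex.I * (u * (√N * ((N : ℝ)⁻¹ * ∑ i, Y (V ω) (ζ i ω))) : ℝ)) ∂μ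
      - ∫ ω, Complex.exp (Complex.I * (u * (√N * ∫ z, Y (V ω) z ∂(κ (V ω))) : ℝ))
        * Real.exp (-(u ^ 2 * ((∫ z, Y (V ω) z ^ 2 ∂(κ (V ω)))
          - (∫ z, Y (V ω) z ∂(κ (V ω))) ^ 2) / 2)) ∂μ‖ ≤ cltConst u K / √N := by
  have hYm : ∀ e, Measurable (Y e) := fun e => hY.of_uncurry_left
  have hYi : ∀ i : Fin N, Measurable fun p : E × (Fin N → 𝒵) => Y p.1 (p.2 i) := fun i =>
    hY.comp (measurable_fst.prodMk ((measurable_pi_apply i).comp measurable_snd))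
  have hbar : Measurable fun e => ∫ z, Y e z ∂(κ e) :=
    (hY.stronglyMeasurable.integral_kernel_prod_right (κ := κ)).measurable
  have hbar2 : Measurable fun e => ∫ z, Y e z ^ 2 ∂(κ e) :=
    (StronglyMeasurable.integral_kernel_prod_right (κ := κ) (f := fun e z => Y e z ^ 2)
      (hY.pow_const 2).stronglyMeasurable).measurable
  have hζ' : Measurable fun ω i => ζ i ω := measurable_pi_lambda _ hζ
  set a : E × (Fin N → 𝒵) → ℂ := fun p =>
    Complex.exp (Complex.I * (u * (√N * ((N : ℝ)⁻¹ * ∑ i, Y p.1 (p.2 i))) : ℝ)) with ha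
  set b : E → ℂ := fun e => Complex.exp (Complex.I * (u * (√N * ∫ z, Y e z ∂(κ e)) : ℝ))
        * Real.exp (-(u ^ 2 * ((∫ z, Y e z ^ 2 ∂(κ e)) - (∫ z, Y e z ∂(κ e)) ^ 2) / 2)) with hb
  have ham : Measurable a := by
    have : Measurable fun p : E × (Fin N → 𝒵) => ∑ i, Y p.1 (p.2 i) :=
      Finset.measurable_sum _ fun i _ => hYi i
    fun_prop
  have hbm : Measurable b := by fun_prop
  have ha1 : ∀ p, ‖a p‖ ≤ 1 := fun p => by rw [ha, Complex.norm_exp_I_mul_ofReal]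
  have hb1 : ∀ ω, ‖b (V ω)‖ ≤ 1 := fun ω => by
    rw [hb, norm_mul, Complex.norm_exp_I_mul_ofReal, one_mul, Complex.norm_real, Real.norm_eq_abs,
      Real.abs_exp, Real.exp_le_one_iff]
    have hmem : MemLp (Y (V ω)) 2 (κ (V ω)) :=
      MemLp.of_bound (hYm _).aestronglyMeasurable K (ae_of_all _ (hK ω))
    have h2 := variance_nonneg (Y (V ω)) (κ (V ω))
    rw [variance_eq_sub hmem] at h2
    have := mul_nonneg (sq_nonneg u) h2
    simp only [Pi.pow_apply] at this
    linarith
  have hai : Integrable (fun ω => a (V ω, fun i => ζ i ω)) μ :=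
    Integrable.of_bound (ham.comp (hV.prodMk hζ')).aestronglyMeasurable 1
      (ae_of_all _ fun ω => ha1 _)
  have hbi : Integrable (fun ω => b (V ω)) μ :=
    Integrable.of_bound (hbm.comp hV).aestronglyMeasurable 1 (ae_of_all _ hb1)
  change ‖∫ ω, a (V ω, fun i => ζ i ω) ∂μ - ∫ ω, b (V ω) ∂μ‖ ≤ _
  rw [← integral_sub hai hbi, ← setIntegral_eq_integral_of_forall_compl_eq_zero (s := V ⁻¹' D)]
  · rw [integral_sub hai.integrableOn hbi.integrableOn,
      h.setIntegral_eq hV hζ ham.stronglyMeasurable (fun ω z => ha1 _), ← integral_sub]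
    · have hC : ∀ ω, ‖∫ z, a (V ω, z) ∂(Measure.pi fun _ => κ (V ω)) - b (V ω)‖
          ≤ cltConst u K / √N := fun ω => norm_charFun_average_sub_le hN (hYm _) (hK ω) u
      refine (norm_integral_le_of_norm_le_const (ae_of_all _ hC)).trans ?_
      obtain ⟨ω⟩ : Nonempty Ω := nonempty_of_isProbabilityMeasure μ
      refine mul_le_of_le_one_right ((norm_nonneg _).trans (hC ω)) ?_
      simp only [measureReal_restrict_apply_univ]
      exact measureReal_le_one
    · refine Integrable.of_bound (C := 1) ?_ (ae_of_all _ fun ω => ?_)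
      · exact ((ham.stronglyMeasurable.integral_kernel_prod_right'
          (κ := iidKernel N κ)).comp_measurable hV).aestronglyMeasurable
      · exact (norm_integral_le_of_norm_le_const (ae_of_all _ fun z => ha1 _)).trans (by simp)
    · exact hbi.integrableOn
  -- Off `D` both exponentials equal `1`, so the difference vanishes there.
  · exact fun ω hω => by simp [ha, hb, h0 _ hω]

end CondIID

variable {X Y : Type*} [MeasurableSpace X] [MeasurableSpace Y]

/-! ### Markov kernels given by a density. -/

section Density

variable {ν : Measure X} [SigmaFinite ν] {q : X → X → ℝ}

lemma density_kernel_apply (hq : Measurable (Function.uncurry q)) (x : X) :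
    Kernel.withDensity (Kernel.const X ν) (fun x x' => ENNReal.ofReal (q x x')) x
      = ν.withDensity (fun x' => ENNReal.ofReal (q x x')) := by
  rw [Kernel.withDensity_apply _ (by exact hq.ennreal_ofReal), Kernel.const_apply]

lemma density_kernel_isMarkov (hq : Measurable (Function.uncurry q))
    (h1 : ∀ x, ∫⁻ x', ENNReal.ofReal (q x x') ∂ν = 1) :
    IsMarkovKernel
      (Kernel.withDensity (Kernel.const X ν) (fun x x' => ENNReal.ofReal (q x x'))) := by
  refine ⟨fun x => ⟨?_⟩⟩
  rw [density_kernel_apply hq, withDensity_apply _ MeasurableSet.univ, Measure.restrict_univ, h1]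

lemma integral_density_kernel (hq : Measurable (Function.uncurry q)) (h0 : ∀ x x', 0 ≤ q x x')
    (x : X) (f : X → ℝ) :
    ∫ x', f x' ∂(Kernel.withDensity (Kernel.const X ν) (fun x x' => ENNReal.ofReal (q x x')) x)
      = ∫ x', q x x' * f x' ∂ν := by
  rw [density_kernel_apply hq, integral_withDensity_eq_integral_toReal_smul
    (hq.of_uncurry_left.ennreal_ofReal) (ae_of_all _ fun _ => ENNReal.ofReal_lt_top)]
  simp [ENNReal.toReal_ofReal (h0 _ _)]

end Density

/-! ### Transition and backward kernels of the model; the reversal identity. -/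

namespace HMM

variable (H : HMM X Y) (y : ℕ → Y)

instance : IsMarkovKernel H.M := density_kernel_isMarkov H.measurable_m H.lintegral_m

lemma integral_M (x : X) (f : X → ℝ) : ∫ x', f x' ∂(H.M x) = ∫ x', H.m x x' * f x' ∂H.ν :=
  integral_density_kernel H.measurable_m H.m_nonneg x f

lemma measurable_g (t : ℕ) : Measurable (H.g y t) := H.measurable_obs.of_uncurry_right

lemma g_nonneg (t : ℕ) (x : X) : 0 ≤ H.g y t x := H.obs_nonneg _ _

lemma integrable_m_prod (η : Measure X) [IsFiniteMeasure η] :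
    Integrable (Function.uncurry H.m) (η.prod H.ν) := by
  refine ⟨H.measurable_m.aestronglyMeasurable, ?_⟩
  rw [HasFiniteIntegral, lintegral_prod _ H.measurable_m.enorm.aemeasurable]
  have : ∀ x, ∫⁻ x', ‖Function.uncurry H.m (x, x')‖ₑ ∂H.ν = 1 := fun x => by
    rw [← H.lintegral_m x]
    refine lintegral_congr fun x' => ?_
    rw [Function.uncurry_apply_pair, Real.enorm_eq_ofReal (H.m_nonneg _ _)]
  simp_rw [this]
  simp

lemma integrable_m_mul_prod (η : Measure X) [IsFiniteMeasure η] {f : X → X → ℝ}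
    (hf : Measurable (Function.uncurry f)) {K : ℝ} (hK : ∀ x x', |f x x'| ≤ K) :
    Integrable (fun p : X × X => H.m p.1 p.2 * f p.1 p.2) (η.prod H.ν) :=
  (H.integrable_m_prod η).mul_bdd (c := K) hf.aestronglyMeasurable (ae_of_all _ fun p => hK p.1 p.2)

/-- Exchange of a finite measure with the transition kernel. -/
lemma integral_integral_M (η : Measure X) [IsFiniteMeasure η] {f : X → X → ℝ}
    (hf : Measurable (Function.uncurry f)) {K : ℝ} (hK : ∀ x x', |f x x'| ≤ K) :
    ∫ x, ∫ x', f x x' ∂(H.M x) ∂η = ∫ x', ∫ x, H.m x x' * f x x' ∂η ∂H.ν := by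
  simp_rw [H.integral_M]
  exact integral_integral_swap (H.integrable_m_mul_prod η hf hK)

section Backward

variable {H} {C : ℝ}

lemma integrable_m_left (hm : ∀ x x', H.m x x' ≤ C) (η : Measure X) [IsFiniteMeasure η] (x : X) :
    Integrable (fun x' => H.m x' x) η :=
  integrable_of_abs_le H.measurable_m.of_uncurry_right fun x' => by
    rw [abs_of_nonneg (H.m_nonneg _ _)]; exact hm _ _

lemma abs_integral_m_mul_le (hm : ∀ x x', H.m x x' ≤ C)
    (η : Measure X) [IsFiniteMeasure η] (x : X) {f : X → ℝ} {K : ℝ}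
    (hK : ∀ x, |f x| ≤ K) : |∫ x', H.m x' x * f x' ∂η| ≤ K * ∫ x', H.m x' x ∂η := by
  rw [← integral_const_mul, ← Real.norm_eq_abs]
  refine norm_integral_le_of_norm_le ((integrable_m_left hm η x).const_mul K)
    (ae_of_all _ fun x' => ?_)
  rw [Real.norm_eq_abs, abs_mul, abs_of_nonneg (H.m_nonneg _ _), mul_comm]
  exact mul_le_mul_of_nonneg_right (hK x') (H.m_nonneg _ _)

lemma abs_B_le (hm : ∀ x x', H.m x x' ≤ C)
    (η : Measure X) [IsFiniteMeasure η] (x : X) {f : X → ℝ} {K : ℝ} (hK0 : 0 ≤ K)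
    (hK : ∀ x, |f x| ≤ K) : |H.B η x f| ≤ K := by
  have h0 : 0 ≤ ∫ x', H.m x' x ∂η := integral_nonneg fun x' => H.m_nonneg _ _
  rw [B, abs_div, abs_of_nonneg h0]
  exact div_le_of_le_mul₀ h0 hK0 (abs_integral_m_mul_le hm η x hK)

/-- Where the denominator vanishes the numerator does too, so the convention `0/0 = 0` does no harm
in this multiplied form. Only this form is used in the reversal identity. -/
lemma B_mul_integral (hm : ∀ x x', H.m x x' ≤ C)
    (η : Measure X) [IsFiniteMeasure η] (x : X) {f : X → ℝ} {K : ℝ}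
    (hK : ∀ x, |f x| ≤ K) :
    (∫ x', H.m x' x ∂η) * H.B η x f = ∫ x', H.m x' x * f x' ∂η := by
  rw [B]
  rcases eq_or_ne (∫ x', H.m x' x ∂η) 0 with h | h
  · have := abs_integral_m_mul_le hm η x hK
    rw [h, mul_zero] at this
    rw [h, zero_mul, abs_nonpos_iff.1 this]
  · field_simp

lemma measurable_B {E : Type*} [MeasurableSpace E] (η : Kernel E X) [IsSFiniteKernel η]
    {a : E → X} (ha : Measurable a) {f : E → X → ℝ} (hf : Measurable (Function.uncurry f)) :
    Measurable fun e => H.B (η e) (a e) (f e) := by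
  have h1 : Measurable fun p : E × X => H.m p.2 (a p.1) :=
    H.measurable_m.comp (measurable_snd.prodMk (ha.comp measurable_fst))
  refine Measurable.div ?_ ?_
  · exact (StronglyMeasurable.integral_kernel_prod_right (κ := η)
      (f := fun e x' => H.m x' (a e) * f e x') (h1.mul hf).stronglyMeasurable).measurable
  · exact (StronglyMeasurable.integral_kernel_prod_right (κ := η)
      (f := fun e x' => H.m x' (a e)) h1.stronglyMeasurable).measurable

lemma measurable_backwardInt {E : Type*} [MeasurableSpace E] (η : ℕ → Kernel E X)
    [∀ t, IsSFiniteKernel (η t)] {f : (ℕ → X) → ℝ} (hf : Measurable f) (t : ℕ) :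
    Measurable fun p : E × (ℕ → X) => H.backwardInt (fun s => η s p.1) t f p.2 := by
  induction t with
  | zero => exact hf.comp measurable_snd
  | succ t ih =>
    refine measurable_B (E := E × (ℕ → X)) ((η t).comap Prod.fst measurable_fst)
      (a := fun p => p.2 (t + 1)) ((measurable_pi_apply _).comp measurable_snd)
      (f := fun p x' => H.backwardInt (fun s => η s p.1) t f (Function.update p.2 t x')) ?_
    exact ih.comp ((measurable_fst.comp measurable_fst).prodMk
      (measurable_update'.comp ((measurable_snd.comp measurable_fst).prodMk measurable_snd)))

lemma measurable_backwardInt_right (η : ℕ → Measure X) [∀ t, SFinite (η t)] {f : (ℕ → X) → ℝ}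
    (hf : Measurable f) (t : ℕ) : Measurable (H.backwardInt η t f) :=
  (measurable_backwardInt (fun s => Kernel.const Unit (η s)) hf t).comp
    (measurable_const (a := ()).prodMk measurable_id)

lemma abs_backwardInt_le (hm : ∀ x x', H.m x x' ≤ C)
    (η : ℕ → Measure X) [∀ t, IsFiniteMeasure (η t)] {f : (ℕ → X) → ℝ}
    {K : ℝ} (hK : ∀ x, |f x| ≤ K) (t : ℕ) (x : ℕ → X) : |H.backwardInt η t f x| ≤ K := by
  induction t generalizing x with
  | zero => exact hK x
  | succ t ih => exact abs_B_le hm (η t) _ ((abs_nonneg _).trans (hK x)) fun x' => ih _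

/-- The coordinates below `t` are overwritten by the recursion, the coordinate `t` selects the first
kernel, and the later ones are merely carried along to `f`. -/
lemma backwardInt_congr {η η' : ℕ → Measure X} {f f' : (ℕ → X) → ℝ} (t : ℕ) {x x' : ℕ → X}
    (hη : ∀ s < t, η s = η' s) (hx : x t = x' t)
    (h : ∀ z z' : ℕ → X, (∀ k < t, z k = z' k) → (∀ k, t ≤ k → z k = x k) →
      (∀ k, t ≤ k → z' k = x' k) → f z = f' z') :
    H.backwardInt η t f x = H.backwardInt η' t f' x' := by
  induction t generalizing x x' with
  | zero => exact h x x' (by simp) (by simp) (by simp)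
  | succ t ih =>
    simp only [backwardInt]
    rw [hx, hη t t.lt_succ_self]
    congr 1
    funext u
    refine ih (fun s hs => hη s (hs.trans t.lt_succ_self)) (by simp) fun z z' h1 h2 h3 => ?_
    refine h z z' (fun k hk => ?_) (fun k hk => ?_) (fun k hk => ?_)
    · rcases Nat.lt_succ_iff_lt_or_eq.1 hk with hk | rfl
      · exact h1 k hk
      · rw [h2 k le_rfl, h3 k le_rfl]; simp
    · rw [h2 k (by omega), Function.update_of_ne (by omega)]
    · rw [h3 k (by omega), Function.update_of_ne (by omega)]

lemma backwardInt_const_mul (η : ℕ → Measure X) (a : ℝ) (f : (ℕ → X) → ℝ) (t : ℕ) (x : ℕ → X) :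
    H.backwardInt η t (fun z => a * f z) x = a * H.backwardInt η t f x := by
  induction t generalizing x with
  | zero => rfl
  | succ t ih =>
    simp only [backwardInt, B, ih]
    rw [← mul_div_assoc, ← integral_const_mul]
    simp only [mul_left_comm]

/-- A coordinate `n ≥ t` is never integrated over, so a factor depending on it alone is a constant.
-/
lemma backwardInt_mul (η : ℕ → Measure X) (a : X → ℝ) (f : (ℕ → X) → ℝ) {t n : ℕ} (hn : t ≤ n)
    (x : ℕ → X) :
    H.backwardInt η t (fun z => a (z n) * f z) x = a (x n) * H.backwardInt η t f x := by
  rw [← backwardInt_const_mul]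
  refine backwardInt_congr t (fun _ _ => rfl) rfl fun z z' h1 h2 h3 => ?_
  have : z = z' := funext fun k => by
    rcases lt_or_ge k t with hk | hk
    · exact h1 k hk
    · rw [h2 k hk, h3 k hk]
  rw [← this, h2 n hn]

lemma backwardInt_sub (hm : ∀ x x', H.m x x' ≤ C)
    (η : ℕ → Measure X) [∀ t, IsFiniteMeasure (η t)] {f f' : (ℕ → X) → ℝ}
    (hf : Measurable f) (hf' : Measurable f') {K : ℝ} (hK : ∀ x, |f x| ≤ K)
    (hK' : ∀ x, |f' x| ≤ K) (t : ℕ) (x : ℕ → X) :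
    H.backwardInt η t (fun z => f z - f' z) x
      = H.backwardInt η t f x - H.backwardInt η t f' x := by
  induction t generalizing x with
  | zero => rfl
  | succ t ih =>
    have hint : ∀ f : (ℕ → X) → ℝ, Measurable f → (∀ x, |f x| ≤ K) →
        Integrable (fun x' => H.m x' (x (t + 1))
          * H.backwardInt η t f (Function.update x t x')) (η t) := fun f hf hK =>
      (integrable_m_left hm (η t) _).mul_bdd (c := K)
        ((measurable_backwardInt_right η hf t).comp (measurable_update _)).aestronglyMeasurable
        (ae_of_all _ fun x' => abs_backwardInt_le hm η hK t _)
    simp only [backwardInt, B, ih, mul_sub]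
    rw [integral_sub (hint f hf hK) (hint f' hf' hK'), sub_div]

/-- The backward kernels do not see a coordinate beyond `t`, so integrating that coordinate out
commutes with them by Fubini; all integrands are bounded. -/
lemma backwardInt_integral (hm : ∀ x x', H.m x x' ≤ C)
    (η : ℕ → Measure X) [∀ t, IsFiniteMeasure (η t)] (ρ : Measure X)
    [IsFiniteMeasure ρ] {f : (ℕ → X) → ℝ} (hf : Measurable f) {K : ℝ} (hK : ∀ x, |f x| ≤ K)
    {t n : ℕ} (hn : t < n) (x : ℕ → X) :
    H.backwardInt η t (fun z => ∫ x', f (Function.update z n x') ∂ρ) x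
      = ∫ x', H.backwardInt η t f (Function.update x n x') ∂ρ := by
  induction t generalizing x with
  | zero => rfl
  | succ t ih =>
    have hswap : ∫ x'', H.m x'' (x (t + 1))
          * ∫ x', H.backwardInt η t f (Function.update (Function.update x t x'') n x') ∂ρ ∂(η t)
        = ∫ x', ∫ x'', H.m x'' (x (t + 1))
          * H.backwardInt η t f (Function.update (Function.update x n x') t x'') ∂(η t) ∂ρ := by
      simp_rw [← integral_const_mul]
      rw [integral_integral_swap]
      · refine integral_congr_ae (ae_of_all _ fun x' => ?_)
        refine integral_congr_ae (ae_of_all _ fun x'' => ?_)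
        simp only
        rw [Function.update_comm (by omega)]
      · refine integrable_of_abs_le (K := C * K) ?_ fun p => ?_
        · refine Measurable.mul (H.measurable_m.comp (measurable_fst.prodMk measurable_const)) ?_
          exact (measurable_backwardInt_right η hf t).comp (measurable_update'.comp
            (((measurable_update _).comp measurable_fst).prodMk measurable_snd))
        · simp only [Function.uncurry]
          rw [abs_mul, abs_of_nonneg (H.m_nonneg _ _)]
          exact mul_le_mul (hm _ _) (abs_backwardInt_le hm η hK t _) (abs_nonneg _)
            ((H.m_nonneg (x t) (x t)).trans (hm _ _))
    simp only [backwardInt, B]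
    simp_rw [ih (by omega)]
    rw [hswap, ← integral_div]
    refine integral_congr_ae (ae_of_all _ fun x' => ?_)
    simp only [Function.update_of_ne (show t + 1 ≠ n by omega)]

/-- The reversal identity: the backward kernel of `η` disintegrates `η(dx) M(x, dx')`. -/
lemma integral_integral_B (hm : ∀ x x', H.m x x' ≤ C)
    (η : Measure X) [IsFiniteMeasure η] {f : X → X → ℝ}
    (hf : Measurable (Function.uncurry f)) {K : ℝ} (hK : ∀ x x', |f x x'| ≤ K) {a : X → ℝ}
    (ha : Measurable a) {Ka : ℝ} (hKa : ∀ x, |a x| ≤ Ka) :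
    ∫ x, ∫ x', a x' * H.B η x' (fun x => f x x') ∂(H.M x) ∂η
      = ∫ x, ∫ x', a x' * f x x' ∂(H.M x) ∂η := by
  rcases isEmpty_or_nonempty X with hX | ⟨⟨x₀⟩⟩
  · simp [Measure.eq_zero_of_isEmpty]
  have hK0 : 0 ≤ K := (abs_nonneg _).trans (hK x₀ x₀)
  have hKa0 : 0 ≤ Ka := (abs_nonneg _).trans (hKa x₀)
  have hB : Measurable fun x' => H.B η x' (fun x => f x x') :=
    measurable_B (Kernel.const X η) measurable_id (f := fun x' x => f x x')
      (hf.comp measurable_swap)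
  have hbound : ∀ b c : ℝ, |b| ≤ Ka → |c| ≤ K → |b * c| ≤ Ka * K := fun b c hb hc => by
    rw [abs_mul]; exact mul_le_mul hb hc (abs_nonneg _) hKa0
  rw [H.integral_integral_M η (f := fun _ x' => a x' * H.B η x' (fun x => f x x')) (K := Ka * K)
      ((ha.mul hB).comp measurable_snd)
      (fun x x' => hbound _ _ (hKa _) (abs_B_le hm η _ hK0 fun _ => hK _ _)),
    H.integral_integral_M η (f := fun x x' => a x' * f x x') (K := Ka * K)
      ((ha.comp measurable_snd).mul hf) (fun x x' => hbound _ _ (hKa _) (hK _ _))]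
  refine integral_congr_ae (ae_of_all _ fun x' => ?_)
  simp only
  -- With `ν(dx')` outermost, `B` no longer depends on the inner variable, and multiplying it by its
  -- denominator gives back its numerator.
  rw [integral_mul_const, mul_left_comm, B_mul_integral hm η x' (fun x => hK x x'),
    ← integral_const_mul]
  refine integral_congr_ae (ae_of_all _ fun x => ?_)
  simp only
  ring

end Backward

end HMM

/-! ### Forward integrals and their interplay with the backward kernels. -/

namespace HMM

variable {H : HMM X Y} {y : ℕ → Y}

lemma measurable_forwardInt {f : (ℕ → X) → ℝ} (hf : Measurable f) (k t : ℕ) :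
    Measurable (H.forwardInt y k t f) := by
  induction k generalizing t with
  | zero => exact hf
  | succ k ih =>
    refine (StronglyMeasurable.integral_kernel_prod_right
      (κ := H.M.comap (fun x : ℕ → X => x t) (measurable_pi_apply t))
      (f := fun x x' =>
        H.g y (t + 1) x' * H.forwardInt y k (t + 1) f (Function.update x (t + 1) x'))
      (Measurable.stronglyMeasurable ?_)).measurable
    exact ((H.measurable_g y _).comp measurable_snd).mul ((ih (t + 1)).comp measurable_update')

lemma forwardInt_dependsOn {f : (ℕ → X) → ℝ} {k t : ℕ} (hf : DependsOn f (Set.Iic (t + k))) :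
    DependsOn (H.forwardInt y k t f) (Set.Iic t) := by
  induction k generalizing t with
  | zero => exact hf
  | succ k ih =>
    intro x x' hx
    simp only [forwardInt]
    rw [hx t (by simp)]
    refine integral_congr_ae (ae_of_all _ fun u => ?_)
    simp only
    congr 1
    refine ih (by rwa [show t + 1 + k = t + (k + 1) by ring]) fun i hi => ?_
    rcases eq_or_ne i (t + 1) with rfl | hne
    · simp
    · rw [Function.update_of_ne hne, Function.update_of_ne hne]
      refine hx i ?_
      simp only [Set.mem_Iic] at hi ⊢
      omega

variable {C : ℝ} {T : ℕ}

lemma abs_g_mul_le (hg : ∀ s ≤ T, ∀ x, H.g y s x ≤ C)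
    {t : ℕ} (ht : t ≤ T) (x : X) {a K : ℝ} (ha : |a| ≤ K) :
    |H.g y t x * a| ≤ C * K := by
  rw [abs_mul, abs_of_nonneg (H.g_nonneg y t x)]
  exact mul_le_mul (hg t ht x) ha (abs_nonneg _) ((H.g_nonneg y t x).trans (hg t ht x))

lemma abs_forwardInt_le (hg : ∀ s ≤ T, ∀ x, H.g y s x ≤ C)
    {f : (ℕ → X) → ℝ} {K : ℝ} (hK : ∀ x, |f x| ≤ K) (k : ℕ) {t : ℕ}
    (ht : t + k ≤ T) (x : ℕ → X) : |H.forwardInt y k t f x| ≤ C ^ k * K := by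
  induction k generalizing t x with
  | zero => simpa [forwardInt] using hK x
  | succ k ih =>
    refine abs_integral_le_of_abs_le fun x' => ?_
    rw [pow_succ', mul_assoc]
    exact abs_g_mul_le hg (by omega) _ (ih (by omega) _)

lemma forwardInt_sub_mul (hg : ∀ s ≤ T, ∀ x, H.g y s x ≤ C)
    {f f' : (ℕ → X) → ℝ} (hf : Measurable f) (hf' : Measurable f') {K K' : ℝ}
    (hK : ∀ x, |f x| ≤ K) (hK' : ∀ x, |f' x| ≤ K') (c : ℝ) (k : ℕ) {t : ℕ}
    (ht : t + k ≤ T) (x : ℕ → X) :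
    H.forwardInt y k t (fun z => f z - c * f' z) x
      = H.forwardInt y k t f x - c * H.forwardInt y k t f' x := by
  induction k generalizing t x with
  | zero => rfl
  | succ k ih =>
    have hint : ∀ f : (ℕ → X) → ℝ, Measurable f → ∀ K, (∀ x, |f x| ≤ K) →
        Integrable (fun x' => H.g y (t + 1) x'
          * H.forwardInt y k (t + 1) f (Function.update x (t + 1) x')) (H.M (x t)) :=
      fun f hf K hK => integrable_of_abs_le (K := C * (C ^ k * K))
        ((H.measurable_g y _).mul ((measurable_forwardInt hf k _).comp (measurable_update _)))
        fun x' => abs_g_mul_le hg (by omega) _ (abs_forwardInt_le hg hK k (by omega) _)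
    simp only [forwardInt]
    rw [← integral_const_mul, ← integral_sub (hint f hf K hK) ((hint f' hf' K' hK').const_mul c)]
    refine integral_congr_ae (ae_of_all _ fun x' => ?_)
    simp only
    rw [ih (by omega)]
    ring

section Backward

variable {Cm : ℝ}

/-- The backward integration from `t` leaves the coordinate `t` fixed, hence also the law `M(x_t,
·)` of the next one, and so passes under the first forward integral. -/
lemma backwardInt_forwardInt_succ (hg : ∀ s ≤ T, ∀ x, H.g y s x ≤ C) (hm : ∀ x x', H.m x x' ≤ Cm)
    (η : ℕ → Measure X) [∀ t, IsFiniteMeasure (η t)]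
    {f : (ℕ → X) → ℝ} (hf : Measurable f) {K : ℝ} (hK : ∀ x, |f x| ≤ K) {k t : ℕ}
    (ht : t + (k + 1) ≤ T) (x : ℕ → X) :
    H.backwardInt η t (H.forwardInt y (k + 1) t f) x
      = ∫ x', H.g y (t + 1) x'
          * H.backwardInt η t (H.forwardInt y k (t + 1) f) (Function.update x (t + 1) x')
          ∂(H.M (x t)) := by
  have hF := measurable_forwardInt (H := H) (y := y) hf k (t + 1)
  have hFK := abs_forwardInt_le hg hK k (t := t + 1) (by omega)
  have h1 : H.backwardInt η t (H.forwardInt y (k + 1) t f) x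
      = H.backwardInt η t (fun z => ∫ x', (fun z : ℕ → X => H.g y (t + 1) (z (t + 1))
          * H.forwardInt y k (t + 1) f z) (Function.update z (t + 1) x') ∂(H.M (x t))) x := by
    refine backwardInt_congr t (fun _ _ => rfl) rfl fun z z' h1 h2 h3 => ?_
    have : z = z' := funext fun k => by
      rcases lt_or_ge k t with hk | hk
      · exact h1 k hk
      · rw [h2 k hk, h3 k hk]
    subst this
    simp only [forwardInt, h2 t le_rfl, Function.update_self]
  rw [h1]
  refine (backwardInt_integral hm η (H.M (x t)) (K := C * (C ^ k * K))
    (f := fun z => H.g y (t + 1) (z (t + 1)) * H.forwardInt y k (t + 1) f z)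
    (((H.measurable_g y _).comp (measurable_pi_apply _)).mul hF)
    (fun z => abs_g_mul_le hg (by omega) _ (hFK z)) (show t < t + 1 by omega) x).trans ?_
  refine integral_congr_ae (ae_of_all _ fun x' => ?_)
  simp only
  rw [backwardInt_mul η (H.g y (t + 1)) _ (Nat.le_succ t), Function.update_self]

/-- One step of the forward recursion is absorbed by one step of the backward recursion. -/
lemma integral_backwardInt_forwardInt_succ (hg : ∀ s ≤ T, ∀ x, H.g y s x ≤ C)
    (hm : ∀ x x', H.m x x' ≤ Cm) (η : ℕ → Measure X) [∀ t, IsFiniteMeasure (η t)]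
    {f : (ℕ → X) → ℝ} (hf : Measurable f) {K : ℝ} (hK : ∀ x, |f x| ≤ K) {k t : ℕ}
    (hdep : DependsOn f (Set.Iic (t + (k + 1)))) (ht : t + (k + 1) ≤ T) {c : ℝ≥0∞}
    {γ' : Measure X} (hγ : γ' = c • η t) :
    ∫ x, H.backwardInt η t (H.forwardInt y (k + 1) t f) (fun _ => x) ∂γ'
      = ∫ x, ∫ x', H.g y (t + 1) x'
          * H.backwardInt η (t + 1) (H.forwardInt y k (t + 1) f) (fun _ => x') ∂(H.M x) ∂γ' := by
  have hF := measurable_forwardInt (H := H) (y := y) hf k (t + 1)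
  have hFK := abs_forwardInt_le hg hK k (t := t + 1) (by omega)
  -- Only proportionality of `γ'` to `η t` is needed, both sides being linear in `γ'`. This serves
  -- both `γ` with `φ` and `gHat` with `filterHat`.
  rw [hγ, integral_smul_measure, integral_smul_measure]
  congr 1
  have hcoord : Measurable fun p : X × X => Function.update (fun _ : ℕ => p.2) t p.1 :=
    measurable_update'.comp
      ((measurable_pi_lambda _ fun _ => measurable_snd).prodMk measurable_fst)
  have hB := integral_integral_B hm (η t)
    (f := fun x x' => H.backwardInt η t (H.forwardInt y k (t + 1) f)
      (Function.update (fun _ => x') t x)) ((measurable_backwardInt_right η hF t).comp hcoord)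
    (fun x x' => abs_backwardInt_le hm η hFK t _) (H.measurable_g y (t + 1)) (Ka := C)
    (fun x => by rw [abs_of_nonneg (H.g_nonneg y _ x)]; exact hg _ (by omega) x)
  refine Eq.trans ?_ hB.symm
  refine integral_congr_ae (ae_of_all _ fun x => ?_)
  simp only
  rw [backwardInt_forwardInt_succ hg hm η hf hK ht]
  refine integral_congr_ae (ae_of_all _ fun x' => ?_)
  simp only
  congr 1
  -- The two sequences differ only beyond `t + 1`, and the remaining forward integral does not see
  -- those coordinates.
  refine backwardInt_congr t (fun _ _ => rfl) ?_ fun z z' h1 h2 h3 => ?_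
  · rw [Function.update_self, Function.update_of_ne (by omega)]
  refine forwardInt_dependsOn (by rwa [show t + 1 + k = t + (k + 1) by ring]) fun i hi => ?_
  simp only [Set.mem_Iic] at hi
  rcases lt_trichotomy i t with hit | rfl | hit
  · exact h1 i hit
  · rw [h2 i le_rfl, h3 i le_rfl, Function.update_self, Function.update_of_ne (by omega)]
  · obtain rfl : i = t + 1 := by omega
    rw [h2 _ (by omega), h3 _ (by omega), Function.update_self, Function.update_of_ne (by omega)]

end Backward

/-! ### The unnormalised filter and its pairing with path functionals. -/

section Filter

lemma γ_succ (t : ℕ) : H.γ y (t + 1)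
    = ((H.γ y t).bind H.M).withDensity (fun x => ENNReal.ofReal (H.g y (t + 1) x)) := rfl

lemma isFiniteMeasure_withDensity_g (hg : ∀ s ≤ T, ∀ x, H.g y s x ≤ C)
    {t : ℕ} (ht : t ≤ T) (η : Measure X) [IsFiniteMeasure η] :
    IsFiniteMeasure (η.withDensity (fun x => ENNReal.ofReal (H.g y t x))) := by
  refine isFiniteMeasure_withDensity ?_
  refine ne_top_of_le_ne_top (b := ENNReal.ofReal C * η Set.univ) (by finiteness) ?_
  rw [← lintegral_const]
  exact lintegral_mono fun x => ENNReal.ofReal_le_ofReal (hg t ht x)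

lemma isFiniteMeasure_γ (hg : ∀ s ≤ T, ∀ x, H.g y s x ≤ C)
    {t : ℕ} (ht : t ≤ T) : IsFiniteMeasure (H.γ y t) := by
  induction t with
  | zero => exact isFiniteMeasure_withDensity_g hg ht H.χ
  | succ t ih =>
    have := ih (by omega)
    have : IsFiniteMeasure ((H.γ y t).bind H.M) := by
      refine ⟨?_⟩
      rw [Measure.bind_apply MeasurableSet.univ H.M.aemeasurable]
      simp
    exact isFiniteMeasure_withDensity_g hg ht _

lemma integral_withDensity_g (η : Measure X) (t : ℕ) (f : X → ℝ) :
    ∫ x, f x ∂(η.withDensity (fun x => ENNReal.ofReal (H.g y t x)))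
      = ∫ x, H.g y t x * f x ∂η := by
  rw [integral_withDensity_eq_integral_toReal_smul (H.measurable_g y t).ennreal_ofReal
    (ae_of_all _ fun _ => ENNReal.ofReal_lt_top)]
  simp [ENNReal.toReal_ofReal (H.g_nonneg y _ _)]

lemma integral_γ_zero (f : X → ℝ) : ∫ x, f x ∂(H.γ y 0) = ∫ x, H.g y 0 x * f x ∂H.χ :=
  integral_withDensity_g H.χ 0 f

lemma integral_γ_succ (hg : ∀ s ≤ T, ∀ x, H.g y s x ≤ C)
    {t : ℕ} (ht : t + 1 ≤ T) {f : X → ℝ} (hf : Measurable f) {K : ℝ}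
    (hK : ∀ x, |f x| ≤ K) :
    ∫ x, f x ∂(H.γ y (t + 1)) = ∫ x, ∫ x', H.g y (t + 1) x' * f x' ∂(H.M x) ∂(H.γ y t) := by
  have := isFiniteMeasure_γ hg (t := t) (by omega)
  rw [γ_succ, integral_withDensity_g]
  have hint : Integrable (fun p : X × X => H.g y (t + 1) p.2 * f p.2) (H.γ y t ⊗ₘ H.M) :=
    integrable_of_abs_le (K := C * K) (((H.measurable_g y _).mul hf).comp measurable_snd)
      fun p => abs_g_mul_le hg ht _ (hK _)
  have := Measure.integral_compProd hint
  simp only at this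
  rw [← this, ← Measure.snd_compProd, Measure.snd, integral_map measurable_snd.aemeasurable]
  exact ((H.measurable_g y _).mul hf).aestronglyMeasurable

lemma withDensity_g_ne_zero {t : ℕ} (h : ∀ x, 0 < H.g y t x) {η : Measure X} (hη : η ≠ 0) :
    η.withDensity (fun x => ENNReal.ofReal (H.g y t x)) ≠ 0 := by
  intro h0
  rw [withDensity_eq_zero_iff (H.measurable_g y t).ennreal_ofReal.aemeasurable] at h0
  refine hη (Measure.measure_univ_eq_zero.1 ?_)
  refine measure_mono_null (fun x _ => ?_) (ae_iff.1 h0)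
  simpa using h x

lemma γ_ne_zero (hg0 : ∀ s ≤ T, ∀ x, 0 < H.g y s x) {t : ℕ} (ht : t ≤ T) : H.γ y t ≠ 0 := by
  induction t with
  | zero => exact withDensity_g_ne_zero (hg0 0 ht) (IsProbabilityMeasure.ne_zero H.χ)
  | succ t ih =>
    refine withDensity_g_ne_zero (hg0 _ ht) fun h0 => ih (by omega) ?_
    rw [← Measure.measure_univ_eq_zero] at h0 ⊢
    rw [Measure.bind_apply MeasurableSet.univ H.M.aemeasurable] at h0
    simpa using h0

lemma γ_eq_smul_φ (hg : ∀ s ≤ T, ∀ x, H.g y s x ≤ C) (hg0 : ∀ s ≤ T, ∀ x, 0 < H.g y s x)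
    {t : ℕ} (ht : t ≤ T) : H.γ y t = H.γ y t Set.univ • H.φ y t := by
  have := isFiniteMeasure_γ hg ht
  rw [φ, smul_smul, ENNReal.mul_inv_cancel, one_smul]
  · simpa using γ_ne_zero hg0 ht
  · finiteness

instance : IsFiniteMeasure (H.φ y T) := by
  rw [φ]
  refine ⟨?_⟩
  rw [Measure.smul_apply, smul_eq_mul]
  exact (ENNReal.inv_mul_le_one _).trans_lt ENNReal.one_lt_top

lemma integral_φ (t : ℕ) (f : X → ℝ) :
    ∫ x, f x ∂(H.φ y t) = (∫ x, f x ∂(H.γ y t)) / (H.γ y t).real Set.univ := by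
  rw [φ, integral_smul_measure, ENNReal.toReal_inv, smul_eq_mul, inv_mul_eq_div, Measure.real]

variable {Cm : ℝ}

/-- By the reversal identity applied to the true filter, the left side keeps its value when a step
is moved from the forward to the backward part; at time `0` no backward kernel is left. -/
lemma integral_γ_backwardInt (hg : ∀ s ≤ T, ∀ x, H.g y s x ≤ C)
    (hg0 : ∀ s ≤ T, ∀ x, 0 < H.g y s x) (hm : ∀ x x', H.m x x' ≤ Cm)
    {f : (ℕ → X) → ℝ} (hf : Measurable f) {K : ℝ} (hK : ∀ x, |f x| ≤ K)
    {k t : ℕ} (hdep : DependsOn f (Set.Iic (t + k))) (ht : t + k ≤ T) :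
    ∫ x, H.backwardInt (H.φ y) t (H.forwardInt y k t f) (fun _ => x) ∂(H.γ y t)
      = ∫ x, H.forwardInt y (t + k) 0 f (fun _ => x) ∂(H.γ y 0) := by
  induction t generalizing k with
  | zero => simp [backwardInt]
  | succ t ih =>
    have hFm := measurable_backwardInt_right (H := H) (H.φ y)
      (measurable_forwardInt (H := H) (y := y) hf k (t + 1)) (t + 1)
    have hFK := abs_backwardInt_le hm (H.φ y) (abs_forwardInt_le hg hK k (t := t + 1) ht) (t + 1)
    rw [integral_γ_succ hg (t := t) (by omega)
      (f := fun x => H.backwardInt (H.φ y) (t + 1) (H.forwardInt y k (t + 1) f) (fun _ => x))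
      (hFm.comp (measurable_pi_lambda _ fun _ => measurable_id)) (fun x => hFK _)]
    have hdep' : DependsOn f (Set.Iic (t + (k + 1))) := by
      rwa [show t + (k + 1) = t + 1 + k by ring]
    have := integral_backwardInt_forwardInt_succ hg hm (H.φ y) hf hK hdep' (by omega)
      (γ_eq_smul_φ hg hg0 (t := t) (by omega))
    rw [← this, ih hdep' (by omega), show t + (k + 1) = t + 1 + k by ring]

lemma integral_γ_forwardInt_one (hg : ∀ s ≤ T, ∀ x, H.g y s x ≤ C)
    (k : ℕ) {t : ℕ} (ht : t + k ≤ T) :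
    ∫ x, H.forwardInt y k t (fun _ => 1) (fun _ => x) ∂(H.γ y t)
      = (H.γ y (t + k)).real Set.univ := by
  induction k generalizing t with
  | zero => simp [forwardInt, Measure.real]
  | succ k ih =>
    rw [show t + (k + 1) = t + 1 + k by ring, ← ih (by omega), integral_γ_succ hg (by omega)
      (f := fun x => H.forwardInt y k (t + 1) (fun _ => 1) (fun _ => x)) (K := C ^ k * 1)
      ((measurable_forwardInt measurable_const k _).comp
        (measurable_pi_lambda _ fun _ => measurable_id))
      (fun x => abs_forwardInt_le hg (by simp) k (by omega) _)]
    simp only [forwardInt]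
    refine integral_congr_ae (ae_of_all _ fun x => ?_)
    refine integral_congr_ae (ae_of_all _ fun x' => ?_)
    simp only
    congr 1
    -- For a constant integrand only the coordinate `t` matters. Dependence on all coordinates up to
    -- `t` would not suffice, since the sequences compared below differ before it.
    have key : ∀ (k t : ℕ) (z z' : ℕ → X), z t = z' t →
        H.forwardInt y k t (fun _ => 1) z = H.forwardInt y k t (fun _ => 1) z' := by
      intro k
      induction k with
      | zero => intros; rfl
      | succ k ih =>
        intro t z z' hz
        simp only [forwardInt, hz]
        refine integral_congr_ae (ae_of_all _ fun u => ?_)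
        simp only
        rw [ih (t + 1) (Function.update z (t + 1) u) (Function.update z' (t + 1) u) (by simp)]
    exact key k (t + 1) _ _ (by simp)

end Filter

end HMM

/-! ### Importance weights and the unnormalised particle measure. -/

namespace Proposal

variable {H : HMM X Y} {A : Proposal H} {y : ℕ → Y} {T : ℕ} {C : ℝ}

/-- All the functions that define the particle filter are bounded by `C` up to time `T`. -/
structure BoundedBy (A : Proposal H) (y : ℕ → Y) (T : ℕ) (C : ℝ) : Prop where
  one_le : 1 ≤ C
  g_pos : ∀ t ≤ T, ∀ x, 0 < H.g y t x
  g_le : ∀ t ≤ T, ∀ x, H.g y t x ≤ C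
  m_le : ∀ x x', H.m x x' ≤ C
  ϑ_le : ∀ t, 1 ≤ t → t ≤ T → ∀ x, A.ϑ t x ≤ C
  w₀_le : ∀ x, A.w₀ y x ≤ C
  m_eq_zero : ∀ t, 1 ≤ t → t ≤ T → ∀ x x', A.p t x x' = 0 → H.m x x' = 0
  w_le : ∀ t, 1 ≤ t → t ≤ T → ∀ x x', A.w y t x x' ≤ C

lemma exists_boundedBy (hg : H.BoundedLikelihood y T) (hw : A.BoundedWeights y T)
    (hd : A.BoundedDensities T) : ∃ C, A.BoundedBy y T C := by
  obtain ⟨hg0, C₁, h₁⟩ := hg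
  obtain ⟨⟨C₂, h₂⟩, ⟨C₃, h₃⟩, h₄, ⟨C₅, h₅⟩⟩ := hw
  obtain ⟨⟨C₆, h₆⟩, -⟩ := hd
  refine ⟨max 1 (max C₁ (max C₂ (max C₃ (max C₅ C₆)))), ?_⟩
  constructor
  · simp
  · exact hg0
  · exact fun t ht x => (h₁ t ht x).trans (by simp)
  · exact fun x x' => (h₆ x x').trans (by simp)
  · exact fun t h1 ht x => (h₂ t h1 ht x).trans (by simp)
  · exact fun x => (h₃ x).trans (by simp)
  · exact h₄
  · exact fun t h1 ht x x' => (h₅ t h1 ht x x').trans (by simp)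

instance (t : ℕ) : IsMarkovKernel (A.P t) :=
  density_kernel_isMarkov (A.measurable_p t) (A.lintegral_p t)

lemma integral_P (t : ℕ) (x : X) (f : X → ℝ) :
    ∫ x', f x' ∂(A.P t x) = ∫ x', A.p t x x' * f x' ∂H.ν :=
  integral_density_kernel (A.measurable_p t) (A.p_nonneg t) x f

lemma measurable_w₀ : Measurable (A.w₀ y) := A.measurable_dχ.mul (H.measurable_g y 0)

lemma measurable_w (t : ℕ) : Measurable (Function.uncurry (A.w y t)) :=
  (H.measurable_m.mul ((H.measurable_g y t).comp measurable_snd)).div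
    (((A.measurable_ϑ t).comp measurable_fst).mul (A.measurable_p t))

lemma w₀_nonneg (x : X) : 0 ≤ A.w₀ y x := mul_nonneg (A.dχ_nonneg x) (H.g_nonneg y 0 x)

lemma w_nonneg (t : ℕ) (x x' : X) : 0 ≤ A.w y t x x' :=
  div_nonneg (mul_nonneg (H.m_nonneg _ _) (H.g_nonneg y t _))
    (mul_nonneg (A.ϑ_pos t x).le (A.p_nonneg t x _))

/-- The importance weights correct the proposal into the target dynamics. -/
lemma ϑ_mul_integral_P (hC : A.BoundedBy y T C) {t : ℕ} (h1 : 1 ≤ t) (ht : t ≤ T) (x : X)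
    (f : X → ℝ) :
    A.ϑ t x * ∫ x', A.w y t x x' * f x' ∂(A.P t x) = ∫ x', H.g y t x' * f x' ∂(H.M x) := by
  rw [integral_P, H.integral_M, ← integral_const_mul]
  refine integral_congr_ae (ae_of_all _ fun x' => ?_)
  simp only [w]
  have := A.ϑ_pos t x
  rcases eq_or_ne (A.p t x x') 0 with hp | hp
  · simp [hp, hC.m_eq_zero t h1 ht x x' hp]
  · field_simp

lemma integral_w₀ (f : X → ℝ) : ∫ x, A.w₀ y x * f x ∂A.ρ₀ = ∫ x, f x ∂(H.γ y 0) := by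
  rw [HMM.integral_γ_zero, A.χ_eq, integral_withDensity_eq_integral_toReal_smul
    A.measurable_dχ.ennreal_ofReal (ae_of_all _ fun _ => ENNReal.ofReal_lt_top)]
  simp [ENNReal.toReal_ofReal (A.dχ_nonneg _), w₀, mul_assoc]

section Particles

variable {Ω : Type*} {N : ℕ} (A) (y) (ξ : ℕ → Fin N → Ω → X) (I : ℕ → Fin N → Ω → Fin N)

/-- The estimator `∏_{u < t} N⁻¹ ∑ⱼ ω_u^j ϑ_{u+1}(ξ_u^j)` of the normalising constant. -/
noncomputable def zHat : ℕ → Ω → ℝ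
  | 0, _ => 1
  | t + 1, ω => zHat t ω * ((N : ℝ)⁻¹ * ∑ j, A.weight y ξ I t j ω * A.ϑ (t + 1) (ξ t j ω))

/-- The unbiased particle approximation of the unnormalised filter. -/
noncomputable def gHat (t : ℕ) (ω : Ω) : Measure X :=
  ENNReal.ofReal (A.zHat y ξ I t ω * (N : ℝ)⁻¹) •
    ∑ i, ENNReal.ofReal (A.weight y ξ I t i ω) • Measure.dirac (ξ t i ω)

variable {A y ξ I}

lemma weight_nonneg (t : ℕ) (i : Fin N) (ω : Ω) : 0 ≤ A.weight y ξ I t i ω := by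
  cases t with
  | zero => exact w₀_nonneg _
  | succ t => exact w_nonneg _ _ _

lemma weight_le (hC : A.BoundedBy y T C) {t : ℕ} (ht : t ≤ T) (i : Fin N) (ω : Ω) :
    A.weight y ξ I t i ω ≤ C := by
  cases t with
  | zero => exact hC.w₀_le _
  | succ t => exact hC.w_le _ (by omega) ht _ _

lemma zHat_nonneg (t : ℕ) (ω : Ω) : 0 ≤ A.zHat y ξ I t ω := by
  induction t with
  | zero => exact zero_le_one
  | succ t ih =>
    exact mul_nonneg ih (mul_nonneg (by positivity) (Finset.sum_nonneg fun j _ =>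
      mul_nonneg (weight_nonneg _ _ _) (A.ϑ_pos _ _).le))

lemma inv_mul_sum_le {a : Fin N → ℝ} {K : ℝ} (hK : 0 ≤ K) (ha : ∀ i, a i ≤ K) :
    (N : ℝ)⁻¹ * ∑ i, a i ≤ K := by
  rcases Nat.eq_zero_or_pos N with rfl | hN
  · simpa using hK
  rw [inv_mul_le_iff₀ (by positivity)]
  exact (Finset.sum_le_sum fun i _ => ha i).trans (by simp)

lemma zHat_le (hC : A.BoundedBy y T C) {t : ℕ} (ht : t ≤ T) (ω : Ω) :
    A.zHat y ξ I t ω ≤ (C * C) ^ t := by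
  have hC0 : 0 ≤ C := zero_le_one.trans hC.one_le
  induction t with
  | zero => simp [zHat]
  | succ t ih =>
    rw [zHat, pow_succ]
    refine mul_le_mul (ih (by omega)) (inv_mul_sum_le (by positivity) fun j => ?_) ?_
      (by positivity)
    · exact mul_le_mul (weight_le hC (by omega) j ω) (hC.ϑ_le _ (by omega) ht _)
        (A.ϑ_pos _ _).le hC0
    · exact mul_nonneg (by positivity) (Finset.sum_nonneg fun j _ =>
        mul_nonneg (weight_nonneg _ _ _) (A.ϑ_pos _ _).le)

instance (t : ℕ) (ω : Ω) : IsFiniteMeasure (∑ i, ENNReal.ofReal (A.weight y ξ I t i ω) •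
    Measure.dirac (ξ t i ω)) := by
  refine ⟨?_⟩
  simp only [Measure.coe_finsetSum, Finset.sum_apply, Measure.smul_apply, measure_univ,
    smul_eq_mul, mul_one]
  exact ENNReal.sum_lt_top.2 fun i _ => ENNReal.ofReal_lt_top

instance (t : ℕ) (ω : Ω) : IsFiniteMeasure (A.gHat y ξ I t ω) := by
  refine ⟨?_⟩
  rw [gHat, Measure.smul_apply, smul_eq_mul]
  exact ENNReal.mul_lt_top ENNReal.ofReal_lt_top (measure_lt_top _ _)

instance (t : ℕ) (ω : Ω) : IsFiniteMeasure (A.filterHat y ξ I t ω) := by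
  refine ⟨?_⟩
  rw [filterHat, Measure.smul_apply, smul_eq_mul]
  simp only [Measure.coe_finsetSum, Finset.sum_apply, Measure.smul_apply, measure_univ,
    smul_eq_mul, mul_one]
  exact (ENNReal.inv_mul_le_one _).trans_lt ENNReal.one_lt_top

lemma integral_gHat (t : ℕ) (ω : Ω) {f : X → ℝ} (hf : Measurable f) :
    ∫ x, f x ∂(A.gHat y ξ I t ω)
      = A.zHat y ξ I t ω * (N : ℝ)⁻¹ * ∑ i, A.weight y ξ I t i ω * f (ξ t i ω) := by
  rw [gHat, integral_smul_measure, integral_finsetSum_measure]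
  · simp only [integral_smul_measure, integral_dirac' _ _ hf.stronglyMeasurable, smul_eq_mul]
    rw [ENNReal.toReal_ofReal (mul_nonneg (zHat_nonneg _ _) (by positivity))]
    simp [ENNReal.toReal_ofReal (weight_nonneg _ _ _)]
  · intro i _
    refine Integrable.smul_measure ?_ ENNReal.ofReal_ne_top
    exact Integrable.of_bound hf.aestronglyMeasurable |f (ξ t i ω)|
      ((ae_dirac_iff (measurableSet_le hf.norm measurable_const)).2 le_rfl)

/-- The unnormalised and the normalised particle filters are proportional. -/
lemma gHat_eq_smul (t : ℕ) (ω : Ω) :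
    A.gHat y ξ I t ω = (ENNReal.ofReal (A.zHat y ξ I t ω * (N : ℝ)⁻¹) *
      ∑ i, ENNReal.ofReal (A.weight y ξ I t i ω)) • A.filterHat y ξ I t ω := by
  rw [gHat, filterHat, smul_smul, mul_assoc]
  rcases eq_or_ne (∑ i, ENNReal.ofReal (A.weight y ξ I t i ω)) 0 with h | h
  · have : ∀ i, ENNReal.ofReal (A.weight y ξ I t i ω) = 0 := fun i =>
      Finset.sum_eq_zero_iff.1 h i (Finset.mem_univ i)
    simp [this]
  · rw [ENNReal.mul_inv_cancel h (ENNReal.sum_ne_top.2 fun i _ => ENNReal.ofReal_ne_top), mul_one]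

lemma abs_integral_gHat_le (hC : A.BoundedBy y T C) {t : ℕ} (ht : t ≤ T) (ω : Ω) {f : X → ℝ}
    (hf : Measurable f) {K : ℝ} (hK : ∀ x, |f x| ≤ K) :
    |∫ x, f x ∂(A.gHat y ξ I t ω)| ≤ (C * C) ^ t * C * K := by
  have hC0 : 0 ≤ C := zero_le_one.trans hC.one_le
  rcases Nat.eq_zero_or_pos N with rfl | hN
  · rcases isEmpty_or_nonempty X with hX | ⟨⟨x⟩⟩
    · simp only [gHat, Finset.univ_eq_empty, Finset.sum_empty, smul_zero, integral_zero_measure,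
        abs_zero]
      have := A.isProb_ρ₀
      exact absurd (nonempty_of_isProbabilityMeasure A.ρ₀) (by simpa using hX)
    · have := (abs_nonneg _).trans (hK x)
      simp only [gHat, Finset.univ_eq_empty, Finset.sum_empty, smul_zero, integral_zero_measure,
        abs_zero]
      positivity
  have hK0 : 0 ≤ K := (abs_nonneg _).trans (hK (ξ t ⟨0, hN⟩ ω))
  rw [integral_gHat t ω hf, mul_assoc, abs_mul, abs_of_nonneg (zHat_nonneg _ _), abs_mul,
    abs_of_nonneg (by positivity : (0 : ℝ) ≤ (N : ℝ)⁻¹), mul_assoc]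
  refine mul_le_mul (zHat_le hC ht ω) ?_ (by positivity) (by positivity)
  refine (mul_le_mul_of_nonneg_left (Finset.abs_sum_le_sum_abs _ _) (by positivity)).trans ?_
  refine inv_mul_sum_le (by positivity) fun i => ?_
  rw [abs_mul, abs_of_nonneg (weight_nonneg _ _ _)]
  exact mul_le_mul (weight_le hC ht i ω) (hK _) (abs_nonneg _) hC0

/-- On the event where the next draw is unspecified, everything that is multiplied by `zHat` is
zero. -/
lemma zHat_succ_eq_zero {t : ℕ} {ω : Ω} (h : ¬ 0 < ∑ i, A.weight y ξ I t i ω) :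
    (∀ i, A.weight y ξ I t i ω = 0) ∧ A.zHat y ξ I (t + 1) ω = 0
      ∧ A.gHat y ξ I t ω = 0 := by
  have h0 : ∀ i, A.weight y ξ I t i ω = 0 := fun i =>
    (Finset.sum_eq_zero_iff_of_nonneg (fun i _ => weight_nonneg t i ω)).1
      (le_antisymm (not_lt.1 h) (Finset.sum_nonneg fun i _ => weight_nonneg t i ω)) i
      (Finset.mem_univ i)
  exact ⟨h0, by simp [zHat, h0], by simp [gHat, h0]⟩

section Measurability

variable [MeasurableSpace Ω]

lemma measurable_weight (hξ : ∀ t i, Measurable (ξ t i)) (hI : ∀ t i, Measurable (I t i)) (t : ℕ)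
    (i : Fin N) : Measurable (A.weight y ξ I t i) := by
  cases t with
  | zero => exact measurable_w₀.comp (hξ 0 i)
  | succ t =>
    refine (measurable_w (t + 1)).comp (Measurable.prodMk ?_ (hξ _ i))
    exact (measurable_from_prod_countable_left (f := fun p : Ω × Fin N => ξ t p.2 p.1)
      (fun j => hξ t j)).comp (measurable_id.prodMk (hI (t + 1) i))

variable {t : ℕ}

/-- The σ-algebra on `Ω` is left arbitrary, and only particles and weights up to `t` are assumed
measurable: this lemma and the next ones are applied to the ambient σ-algebra and to `hist`. -/
lemma measurable_zHat (hξ : ∀ s ≤ t, ∀ i, Measurable (ξ s i))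
    (hw : ∀ s ≤ t, ∀ i, Measurable (A.weight y ξ I s i)) {s : ℕ} (hs : s ≤ t + 1) :
    Measurable (A.zHat y ξ I s) := by
  induction s with
  | zero => exact measurable_const
  | succ s ih =>
    exact (ih (by omega)).mul (measurable_const.mul (Finset.measurable_sum _ fun j _ =>
      (hw s (by omega) j).mul ((A.measurable_ϑ _).comp (hξ s (by omega) j))))

lemma measurable_filterHat (hξ : ∀ s ≤ t, ∀ i, Measurable (ξ s i))
    (hw : ∀ s ≤ t, ∀ i, Measurable (A.weight y ξ I s i)) {s : ℕ} (hs : s ≤ t) :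
    Measurable (A.filterHat y ξ I s) := by
  refine Measure.measurable_of_measurable_coe _ fun S hS => ?_
  simp only [filterHat, Measure.smul_apply, Measure.coe_finsetSum, Finset.sum_apply, smul_eq_mul]
  exact (Finset.measurable_sum _ fun i _ => (hw s hs i).ennreal_ofReal).inv.mul
    (Finset.measurable_sum _ fun i _ => (hw s hs i).ennreal_ofReal.mul
      ((Measure.measurable_coe hS).comp (Measure.measurable_dirac.comp (hξ s hs i))))

lemma measurable_backwardInt_filterHat (hξ : ∀ s ≤ t, ∀ i, Measurable (ξ s i))
    (hw : ∀ s ≤ t, ∀ i, Measurable (A.weight y ξ I s i)) {f : (ℕ → X) → ℝ} (hf : Measurable f)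
    {s : ℕ} (hs : s ≤ t + 1) :
    Measurable fun p : Ω × (ℕ → X) => H.backwardInt (fun u => A.filterHat y ξ I u p.1) s f p.2 := by
  -- Truncation at `t` makes every `η u` a kernel for the given σ-algebra. The recursion from `s ≤ t
  -- + 1` uses only `u < s`, where the truncation has no effect.
  let η : ℕ → Kernel Ω X := fun u =>
    ⟨A.filterHat y ξ I (min u t), measurable_filterHat hξ hw (min_le_right u t)⟩
  have : ∀ u, IsFiniteKernel (η u) := fun u => ⟨1, ENNReal.one_lt_top, fun ω => by
    change A.filterHat y ξ I (min u t) ω Set.univ ≤ 1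
    rw [filterHat, Measure.smul_apply, smul_eq_mul]
    simp only [Measure.coe_finsetSum, Finset.sum_apply, Measure.smul_apply, measure_univ,
      smul_eq_mul, mul_one]
    exact ENNReal.inv_mul_le_one _⟩
  convert HMM.measurable_backwardInt (H := H) η hf s using 1
  funext p
  refine HMM.backwardInt_congr s (fun u hu => ?_) rfl fun z z' h1 h2 h3 => ?_
  · change _ = A.filterHat y ξ I (min u t) p.1
    rw [min_eq_left (by omega)]
  · congr 1
    funext k
    rcases lt_or_ge k s with hk | hk
    · exact h1 k hk
    · rw [h2 k hk, h3 k hk]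

lemma measurable_backwardInt_filterHat_const (hξ : ∀ s ≤ t, ∀ i, Measurable (ξ s i))
    (hw : ∀ s ≤ t, ∀ i, Measurable (A.weight y ξ I s i)) {f : (ℕ → X) → ℝ} (hf : Measurable f)
    {s : ℕ} (hs : s ≤ t + 1) :
    Measurable (Function.uncurry fun (ω : Ω) (x : X) =>
      H.backwardInt (fun u => A.filterHat y ξ I u ω) s f (fun _ => x)) := by
  have h := measurable_backwardInt_filterHat hξ hw hf hs
  have h' : Measurable fun p : Ω × X => ((p.1, fun _ => p.2) : Ω × (ℕ → X)) := by fun_prop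
  have h2 := h.comp h'
  simp only [Function.comp_def] at h2
  exact h2

lemma measurable_integral_gHat (hξ : ∀ s ≤ t, ∀ i, Measurable (ξ s i))
    (hw : ∀ s ≤ t, ∀ i, Measurable (A.weight y ξ I s i)) {s : ℕ} (hs : s ≤ t)
    {E : Type*} [MeasurableSpace E] {f : Ω → E → X → ℝ}
    (hf : Measurable fun p : (Ω × E) × X => f p.1.1 p.1.2 p.2) :
    Measurable fun p : Ω × E => ∫ x, f p.1 p.2 x ∂(A.gHat y ξ I s p.1) := by
  have h : ∀ p : Ω × E, Measurable (f p.1 p.2) := fun p => hf.comp measurable_prodMk_left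
  simp_rw [fun p : Ω × E => integral_gHat (A := A) (y := y) (ξ := ξ) (I := I) s p.1 (h p)]
  refine (((measurable_zHat hξ hw (by omega)).comp measurable_fst).mul_const _).mul
    (Finset.measurable_sum _ fun i _ => ((hw s hs i).comp measurable_fst).mul ?_)
  exact hf.comp (measurable_id.prodMk ((hξ s hs i).comp measurable_fst))

end Measurability

end Particles

end Proposal

/-- The space `Ω` equipped with the σ-algebra `m`. -/
def WithSigma {Ω : Type*} (_ : MeasurableSpace Ω) : Type _ := Ω

instance {Ω : Type*} (m : MeasurableSpace Ω) : MeasurableSpace (WithSigma m) := m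

/-! ### The law of one draw, and what is known at time `t`. -/

namespace Proposal

variable {H : HMM X Y} {A : Proposal H} {y : ℕ → Y} {T : ℕ} {C : ℝ}

section Draw

variable {Ω : Type*} {N : ℕ} {ξ : ℕ → Fin N → Ω → X} {I : ℕ → Fin N → Ω → Fin N}

/-- The law of a pair (index, particle) of time `t + 1`, with the value `δ_{z₀}` on the event that
all weights of time `t` vanish. -/
noncomputable def draw (A : Proposal H) (y : ℕ → Y) (ξ : ℕ → Fin N → Ω → X)
    (I : ℕ → Fin N → Ω → Fin N) (z₀ : Fin N × X) (t : ℕ) (ω : Ω) : Measure (Fin N × X) :=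
  open Classical in
  if 0 < ∑ i, A.weight y ξ I t i ω then A.instr y ξ I t ω else Measure.dirac z₀

lemma sum_weight_mul_ϑ_pos {t : ℕ} {ω : Ω} (h : 0 < ∑ i, A.weight y ξ I t i ω) :
    0 < ∑ i, A.weight y ξ I t i ω * A.ϑ (t + 1) (ξ t i ω) := by
  obtain ⟨i, -, hi⟩ := Finset.exists_lt_of_sum_lt (f := fun _ => (0 : ℝ)) (by simpa using h)
  exact Finset.sum_pos' (fun i _ => mul_nonneg (weight_nonneg _ _ _) (A.ϑ_pos _ _).le)
    ⟨i, Finset.mem_univ i, mul_pos hi (A.ϑ_pos _ _)⟩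

lemma sum_ofReal_weight_mul_ϑ (t : ℕ) (ω : Ω) :
    ∑ i, ENNReal.ofReal (A.weight y ξ I t i ω * A.ϑ (t + 1) (ξ t i ω))
      = ENNReal.ofReal (∑ i, A.weight y ξ I t i ω * A.ϑ (t + 1) (ξ t i ω)) :=
  (ENNReal.ofReal_sum_of_nonneg fun _ _ =>
    mul_nonneg (weight_nonneg _ _ _) (A.ϑ_pos _ _).le).symm

instance isProbabilityMeasure_draw (z₀ : Fin N × X) (t : ℕ) (ω : Ω) :
    IsProbabilityMeasure (A.draw y ξ I z₀ t ω) := by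
  rw [draw]
  split_ifs with h
  · refine ⟨?_⟩
    rw [instr, Measure.smul_apply, smul_eq_mul]
    simp only [Measure.coe_finsetSum, Finset.sum_apply, Measure.smul_apply, measure_univ,
      smul_eq_mul, mul_one]
    rw [sum_ofReal_weight_mul_ϑ]
    exact ENNReal.inv_mul_cancel (ENNReal.ofReal_pos.2 (sum_weight_mul_ϑ_pos h)).ne'
      ENNReal.ofReal_ne_top
  · infer_instance

lemma measurable_draw [MeasurableSpace Ω] {t : ℕ} (hξ : ∀ i, Measurable (ξ t i))
    (hw : ∀ i, Measurable (A.weight y ξ I t i)) (z₀ : Fin N × X) :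
    Measurable (A.draw y ξ I z₀ t) := by
  refine Measurable.ite (measurableSet_lt measurable_const
    (Finset.measurable_sum _ fun i _ => hw i)) ?_ measurable_const
  have hwϑ : ∀ i, Measurable fun ω =>
      ENNReal.ofReal (A.weight y ξ I t i ω * A.ϑ (t + 1) (ξ t i ω)) := fun i =>
    ((hw i).mul ((A.measurable_ϑ _).comp (hξ i))).ennreal_ofReal
  refine Measure.measurable_of_measurable_coe _ fun S hS => ?_
  simp only [instr, Measure.smul_apply, Measure.coe_finsetSum, Finset.sum_apply, smul_eq_mul]
  refine (Finset.measurable_sum _ fun i _ => hwϑ i).inv.mul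
    (Finset.measurable_sum _ fun i _ => (hwϑ i).mul ?_)
  simp_rw [Measure.dirac_prod, Measure.map_apply measurable_prodMk_left hS]
  exact ((A.P (t + 1)).measurable_coe (measurable_prodMk_left hS)).comp (hξ i)

/-- The last factor of `zHat` at `t + 1` is, up to `1/N`, the normalising sum of the instrumental
law. Cancelling it leaves an expression linear in `gHat`; when all weights vanish both sides are
`0`. -/
lemma zHat_succ_mul_integral_draw (z₀ : Fin N × X) (t : ℕ) (ω : Ω) {ψ : X → X → ℝ}
    (hψ : Measurable (Function.uncurry ψ)) {K : ℝ} (hK : ∀ x x', |ψ x x'| ≤ K) :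
    A.zHat y ξ I (t + 1) ω * ∫ z, ψ (ξ t z.1 ω) z.2 ∂(A.draw y ξ I z₀ t ω)
      = ∫ x, A.ϑ (t + 1) x * ∫ x', ψ x x' ∂(A.P (t + 1) x) ∂(A.gHat y ξ I t ω) := by
  by_cases h : 0 < ∑ i, A.weight y ξ I t i ω
  swap
  · obtain ⟨-, h1, h2⟩ := zHat_succ_eq_zero h
    simp [h1, h2]
  have hpos := sum_weight_mul_ϑ_pos h
  have hψP : Measurable fun x => ∫ x', ψ x x' ∂(A.P (t + 1) x) :=
    (hψ.stronglyMeasurable.integral_kernel_prod_right (κ := A.P (t + 1))).measurable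
  have hψξ : Measurable fun z : Fin N × X => ψ (ξ t z.1 ω) z.2 :=
    hψ.comp ((measurable_from_top (f := fun i => ξ t i ω)).comp measurable_fst |>.prodMk
      measurable_snd)
  rw [integral_gHat t ω (f := fun x => A.ϑ (t + 1) x * ∫ x', ψ x x' ∂(A.P (t + 1) x))
    ((A.measurable_ϑ _).mul hψP), draw, if_pos h, instr, integral_smul_measure,
    integral_finsetSum_measure]
  · have hi : ∀ i, ∫ z : Fin N × X, ψ (ξ t z.1 ω) z.2
        ∂((Measure.dirac i).prod (A.P (t + 1) (ξ t i ω)))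
        = ∫ x', ψ (ξ t i ω) x' ∂(A.P (t + 1) (ξ t i ω)) := fun i => by
      rw [Measure.dirac_prod, integral_map measurable_prodMk_left.aemeasurable
        hψξ.aestronglyMeasurable]
    simp only [integral_smul_measure, smul_eq_mul, hi]
    rw [sum_ofReal_weight_mul_ϑ, ENNReal.toReal_inv, ENNReal.toReal_ofReal hpos.le, zHat]
    simp only [ENNReal.toReal_ofReal (mul_nonneg (weight_nonneg _ _ _) (A.ϑ_pos _ _).le),
      mul_assoc] at hpos ⊢
    field_simp
  · intro i _
    exact (integrable_of_abs_le hψξ fun z => hK _ _).smul_measure ENNReal.ofReal_ne_top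

lemma measurable_hist_pair {s t : ℕ} (hs : s ≤ t) (i : Fin N) :
    Measurable[A.hist y ξ I t] fun ω => (ξ s i ω, A.weight y ξ I s i ω) := by
  refine Measurable.mono (comap_measurable _) ?_ le_rfl
  exact le_iSup₂_of_le s (by simp; omega) (le_iSup_of_le i le_rfl)

lemma measurable_hist_ξ {s t : ℕ} (hs : s ≤ t) (i : Fin N) :
    Measurable[A.hist y ξ I t] (ξ s i) :=
  measurable_fst.comp (measurable_hist_pair hs i)

lemma measurable_hist_weight {s t : ℕ} (hs : s ≤ t) (i : Fin N) :
    Measurable[A.hist y ξ I t] (A.weight y ξ I s i) :=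
  measurable_snd.comp (measurable_hist_pair hs i)

lemma integral_gHat_zero (ω : Ω) {f : X → ℝ} (hf : Measurable f) :
    ∫ x, f x ∂(A.gHat y ξ I 0 ω) = (N : ℝ)⁻¹ * ∑ i, A.w₀ y (ξ 0 i ω) * f (ξ 0 i ω) := by
  simp [integral_gHat 0 ω hf, zHat, weight]

lemma abs_w₀_mul_le (hC : A.BoundedBy y T C) {f : X → ℝ} {K : ℝ} (hK : ∀ x, |f x| ≤ K) (x : X) :
    |A.w₀ y x * f x| ≤ C * K := by
  rw [abs_mul, abs_of_nonneg (w₀_nonneg _)]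
  exact mul_le_mul (hC.w₀_le x) (hK x) (abs_nonneg _) (zero_le_one.trans hC.one_le)

end Draw

/-! ### One step of the particle filter as a conditionally i.i.d. mean. -/

section Steps

variable {Ω : Type*} [mΩ : MeasurableSpace Ω] {N : ℕ} {ξ : ℕ → Fin N → Ω → X}
  {I : ℕ → Fin N → Ω → Fin N} {μ : Measure Ω}

lemma IsParticleFilter.measurable_weight (hF : A.IsParticleFilter y ξ I μ T) (t : ℕ) (i : Fin N) :
    Measurable (A.weight y ξ I t i) :=
  Proposal.measurable_weight hF.measurable_ξ hF.measurable_I t i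

lemma IsParticleFilter.hist_le (hF : A.IsParticleFilter y ξ I μ T) (t : ℕ) :
    A.hist y ξ I t ≤ mΩ :=
  iSup₂_le fun s _ => iSup_le fun i =>
    ((hF.measurable_ξ s i).prodMk (hF.measurable_weight s i)).comap_le

variable [IsProbabilityMeasure μ]

/-- The data of a conditionally i.i.d. draw that represents the step from time `t` to `t + 1`. -/
lemma IsParticleFilter.exists_isCondIID (hF : A.IsParticleFilter y ξ I μ T)
    (hC : A.BoundedBy y T C) (hN : N ≠ 0) {t : ℕ} (ht : t < T)
    {Φ : WithSigma (A.hist y ξ I t) → X → ℝ} (hΦ : Measurable (Function.uncurry Φ)) {K : ℝ}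
    (hK : ∀ ω x, |Φ ω x| ≤ K) :
    ∃ (κ : Kernel (WithSigma (A.hist y ξ I t)) (Fin N × X)) (_ : IsMarkovKernel κ)
      (V : Ω → WithSigma (A.hist y ξ I t)) (D : Set (WithSigma (A.hist y ξ I t)))
      (ζ : Fin N → Ω → Fin N × X) (Ψ : WithSigma (A.hist y ξ I t) → Fin N × X → ℝ),
      IsCondIID μ V D κ ζ ∧ Measurable V ∧ (∀ i, Measurable (ζ i))
        ∧ Measurable (Function.uncurry Ψ)
        ∧ (∀ ω z, |Ψ (V ω) z| ≤ (C * C) ^ (t + 1) * C * K) ∧ (∀ e ∉ D, ∀ z, Ψ e z = 0)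
        ∧ (∀ ω, (N : ℝ)⁻¹ * ∑ i, Ψ (V ω) (ζ i ω) = ∫ x, Φ ω x ∂(A.gHat y ξ I (t + 1) ω))
        ∧ (∀ ω, ∫ z, Ψ (V ω) z ∂(κ (V ω))
          = ∫ x, ∫ x', H.g y (t + 1) x' * Φ ω x' ∂(H.M x) ∂(A.gHat y ξ I t ω))
        ∧ (∀ ω, ∫ z, Ψ (V ω) z ^ 2 ∂(κ (V ω)) = A.zHat y ξ I (t + 1) ω
          * ∫ x, A.ϑ (t + 1) x * ∫ x', A.w y (t + 1) x x' ^ 2 * Φ ω x' ^ 2 ∂(A.P (t + 1) x)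
            ∂(A.gHat y ξ I t ω)) := by
  have hC0 : 0 ≤ C := zero_le_one.trans hC.one_le
  obtain ⟨x₀⟩ : Nonempty X := nonempty_of_isProbabilityMeasure A.ρ₀
  obtain ⟨ω₀⟩ : Nonempty Ω := nonempty_of_isProbabilityMeasure μ
  have hK0 : 0 ≤ K := (abs_nonneg _).trans (hK ω₀ x₀)
  let z₀ : Fin N × X := (⟨0, Nat.pos_of_ne_zero hN⟩, x₀)
  have hξ : ∀ s ≤ t, ∀ i, Measurable[A.hist y ξ I t] (ξ s i) := fun s hs i =>
    measurable_hist_ξ hs i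
  have hw : ∀ s ≤ t, ∀ i, Measurable[A.hist y ξ I t] (A.weight y ξ I s i) := fun s hs i =>
    measurable_hist_weight hs i
  have hΦm : ∀ ω, Measurable (Φ ω) := fun ω => hΦ.of_uncurry_left
  let κ : Kernel (WithSigma (A.hist y ξ I t)) (Fin N × X) :=
    ⟨A.draw y ξ I z₀ t, @measurable_draw _ _ _ _ H A y Ω N ξ I (A.hist y ξ I t) t (hξ t le_rfl)
      (hw t le_rfl) z₀⟩
  have hκ : ∀ ω, κ ω = A.draw y ξ I z₀ t ω := fun ω => rfl
  have hκm : IsMarkovKernel κ := ⟨fun ω => isProbabilityMeasure_draw (Ω := Ω) z₀ t ω⟩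
  -- The conditioning variable is the identity onto `Ω` with the history σ-algebra, so `Φ` may
  -- depend on the whole past.
  let V : Ω → WithSigma (A.hist y ξ I t) := id
  let D : Set (WithSigma (A.hist y ξ I t)) := {ω | 0 < ∑ i, A.weight y ξ I t i ω}
  let ζ : Fin N → Ω → Fin N × X := fun i ω => (I (t + 1) i ω, ξ (t + 1) i ω)
  -- The mean of `Ψ` over the draws is the integral of `Φ` against `gHat` at time `t + 1`. The
  -- factor `zHat` is known at time `t` and vanishes off `D`.
  let Ψ : WithSigma (A.hist y ξ I t) → Fin N × X → ℝ := fun ω z =>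
    A.zHat y ξ I (t + 1) ω * (A.w y (t + 1) (ξ t z.1 ω) z.2 * Φ ω z.2)
  have hVm : Measurable V := measurable_id'' (hF.hist_le t)
  have hζm : ∀ i, Measurable (ζ i) := fun i =>
    (hF.measurable_I _ i).prodMk (hF.measurable_ξ _ i)
  have hSm : Measurable fun ω : WithSigma (A.hist y ξ I t) => ∑ i, A.weight y ξ I t i ω :=
    Finset.measurable_sum _ fun i _ => hw t le_rfl i
  have hDm : MeasurableSet D := measurableSet_lt measurable_const hSm
  have hw_abs : ∀ x x', |A.w y (t + 1) x x'| ≤ C := fun x x' => by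
    rw [abs_of_nonneg (w_nonneg _ _ _)]; exact hC.w_le _ (by omega) (by omega) _ _
  have hwm := measurable_w (A := A) (y := y) (t + 1)
  have hψm : ∀ ω, Measurable (Function.uncurry fun x x' => A.w y (t + 1) x x' * Φ ω x') := fun ω =>
    hwm.mul ((hΦm ω).comp measurable_snd)
  have hψK : ∀ ω x x', |A.w y (t + 1) x x' * Φ ω x'| ≤ C * K := fun ω x x' => by
    rw [abs_mul]; exact mul_le_mul (hw_abs _ _) (hK _ _) (abs_nonneg _) hC0
  refine ⟨κ, hκm, V, D, ζ, Ψ, ?_, hVm, hζm, ?_, ?_, ?_, ?_, ?_, ?_⟩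
  · refine isCondIID_of_condExp hVm hDm hζm fun S hS => ?_
    have hcomap : MeasurableSpace.comap V inferInstance = A.hist y ξ I t :=
      MeasurableSpace.comap_id
    rw [hcomap]
    filter_upwards [hF.step t ht S hS,
      ae_restrict_mem (μ := μ) (hVm hDm)] with ω hω hωD
    refine hω.trans ?_
    have : (κ (V ω)) = A.instr y ξ I t ω := by
      rw [hκ]; exact if_pos hωD
    rw [this]
  · refine Measurable.mul ?_ (Measurable.mul (hwm.comp (Measurable.prodMk ?_ ?_)) ?_)
    · exact (@measurable_zHat _ _ _ _ H A y Ω N ξ I (A.hist y ξ I t) t hξ hw (t + 1) le_rfl).comp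
        measurable_fst
    · exact (measurable_from_prod_countable_left
        (f := fun p : WithSigma (A.hist y ξ I t) × Fin N => ξ t p.2 p.1)
        (fun j => hξ t le_rfl j)).comp
        (measurable_fst.prodMk (measurable_fst.comp measurable_snd))
    · exact measurable_snd.comp measurable_snd
    · exact hΦ.comp (measurable_fst.prodMk (measurable_snd.comp measurable_snd))
  · intro ω z
    simp only [Ψ]
    rw [abs_mul, abs_of_nonneg (zHat_nonneg _ _), mul_assoc]
    exact mul_le_mul (zHat_le hC (by omega) _) (hψK _ _ _) (abs_nonneg _) (by positivity)
  · intro ω hω z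
    simp only [Ψ]
    rw [(zHat_succ_eq_zero hω).2.1, zero_mul]
  · intro ω
    rw [integral_gHat _ _ (hΦm ω)]
    simp only [Ψ, ζ, V, weight, id]
    rw [← Finset.mul_sum]
    ring
  · intro ω
    change ∫ z, A.zHat y ξ I (t + 1) ω * (A.w y (t + 1) (ξ t z.1 ω) z.2 * Φ ω z.2)
      ∂(A.draw y ξ I z₀ t ω) = _
    rw [integral_const_mul, zHat_succ_mul_integral_draw (A := A) (y := y) (ξ := ξ) (I := I) z₀ t ω
      (ψ := fun x x' => A.w y (t + 1) x x' * Φ ω x') (hψm ω) (hψK ω)]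
    simp only [ϑ_mul_integral_P hC (show 1 ≤ t + 1 by omega) (show t + 1 ≤ T by omega)]
  · intro ω
    have hsq : ∀ φ : X → ℝ, Measurable φ →
        Measurable (Function.uncurry fun x x' => A.w y (t + 1) x x' ^ 2 * φ x' ^ 2) := fun φ hφ =>
      (hwm.pow_const 2).mul ((hφ.pow_const 2).comp measurable_snd)
    -- The square contains two factors `zHat`: this identity absorbs one, the other stays in front.
    have hψ2 := zHat_succ_mul_integral_draw (A := A) (y := y) (ξ := ξ) (I := I) z₀ t ω
      (ψ := fun x x' => A.w y (t + 1) x x' ^ 2 * Φ ω x' ^ 2) (K := (C * K) ^ 2)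
      (hsq _ (hΦm ω)) (fun x x' => by
        rw [← mul_pow, abs_pow]; exact pow_le_pow_left₀ (abs_nonneg _) (hψK ω x x') 2)
    change ∫ z, (A.zHat y ξ I (t + 1) ω * (A.w y (t + 1) (ξ t z.1 ω) z.2 * Φ ω z.2)) ^ 2
      ∂(A.draw y ξ I z₀ t ω) = _
    simp only [mul_pow, integral_const_mul]
    rw [← hψ2]
    ring

lemma IsParticleFilter.integral_gHat_succ (hF : A.IsParticleFilter y ξ I μ T)
    (hC : A.BoundedBy y T C) (hN : N ≠ 0) {t : ℕ} (ht : t < T)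
    {Φ : WithSigma (A.hist y ξ I t) → X → ℝ} (hΦ : Measurable (Function.uncurry Φ)) {K : ℝ}
    (hK : ∀ ω x, |Φ ω x| ≤ K) :
    ∫ ω, ∫ x, Φ ω x ∂(A.gHat y ξ I (t + 1) ω) ∂μ
      = ∫ ω, ∫ x, ∫ x', H.g y (t + 1) x' * Φ ω x' ∂(H.M x) ∂(A.gHat y ξ I t ω) ∂μ := by
  obtain ⟨κ, _, V, D, ζ, Ψ, h, hV, hζ, hΨ, hb, h0, h1, h2, -⟩ :=
    hF.exists_isCondIID hC hN ht hΦ hK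
  simpa only [h1, h2] using h.integral_average hN hV hζ hΨ hb h0

lemma IsParticleFilter.integral_gHat_succ_sub_sq_le (hF : A.IsParticleFilter y ξ I μ T)
    (hC : A.BoundedBy y T C) (hN : N ≠ 0) {t : ℕ} (ht : t < T)
    {Φ : WithSigma (A.hist y ξ I t) → X → ℝ} (hΦ : Measurable (Function.uncurry Φ)) {K : ℝ}
    (hK : ∀ ω x, |Φ ω x| ≤ K) :
    ∫ ω, (∫ x, Φ ω x ∂(A.gHat y ξ I (t + 1) ω)
      - ∫ x, ∫ x', H.g y (t + 1) x' * Φ ω x' ∂(H.M x) ∂(A.gHat y ξ I t ω)) ^ 2 ∂μ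
      ≤ ((C * C) ^ (t + 1) * C * K) ^ 2 / N := by
  obtain ⟨κ, _, V, D, ζ, Ψ, h, hV, hζ, hΨ, hb, h0, h1, h2, -⟩ :=
    hF.exists_isCondIID hC hN ht hΦ hK
  simpa only [h1, h2] using h.integral_average_sub_sq_le hN hV hζ hΨ hb h0

lemma IsParticleFilter.norm_charFun_succ_sub_le (hF : A.IsParticleFilter y ξ I μ T)
    (hC : A.BoundedBy y T C) (hN : N ≠ 0) {t : ℕ} (ht : t < T)
    {Φ : WithSigma (A.hist y ξ I t) → X → ℝ} (hΦ : Measurable (Function.uncurry Φ)) {K : ℝ}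
    (hK : ∀ ω x, |Φ ω x| ≤ K) (u : ℝ) :
    ‖∫ ω, Complex.exp (Complex.I * (u * (√N * ∫ x, Φ ω x ∂(A.gHat y ξ I (t + 1) ω)) : ℝ)) ∂μ
      - ∫ ω, Complex.exp (Complex.I * (u * (√N *
          ∫ x, ∫ x', H.g y (t + 1) x' * Φ ω x' ∂(H.M x) ∂(A.gHat y ξ I t ω)) : ℝ))
        * Real.exp (-(u ^ 2 * (A.zHat y ξ I (t + 1) ω
          * (∫ x, A.ϑ (t + 1) x * ∫ x', A.w y (t + 1) x x' ^ 2 * Φ ω x' ^ 2 ∂(A.P (t + 1) x)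
            ∂(A.gHat y ξ I t ω))
          - (∫ x, ∫ x', H.g y (t + 1) x' * Φ ω x' ∂(H.M x) ∂(A.gHat y ξ I t ω)) ^ 2) / 2)) ∂μ‖
      ≤ cltConst u ((C * C) ^ (t + 1) * C * K) / √N := by
  obtain ⟨κ, _, V, D, ζ, Ψ, h, hV, hζ, hΨ, hb, h0, h1, h2, h3⟩ :=
    hF.exists_isCondIID hC hN ht hΦ hK
  simpa only [h1, h2, h3] using h.norm_charFun_sub_le hN hV hζ hΨ hb h0 u

/-- Conditioning on a trivial variable brings the initial sample under the same estimates as the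
later steps. -/
lemma IsParticleFilter.isCondIID_zero (hF : A.IsParticleFilter y ξ I μ T) :
    IsCondIID μ (fun _ : Ω => ()) Set.univ (Kernel.const Unit A.ρ₀) (ξ 0) := by
  refine isCondIID_of_condExp measurable_const MeasurableSet.univ (hF.measurable_ξ 0)
    fun S hS => ?_
  have hm : Measurable fun ω i => ξ 0 i ω := measurable_pi_lambda _ (hF.measurable_ξ 0)
  have hmap : μ.map (fun ω i => ξ 0 i ω) = Measure.pi fun _ => A.ρ₀ := by
    rw [hF.indep_init.map_fun_eq_pi_map fun i => (hF.measurable_ξ 0 i).aemeasurable]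
    simp only [hF.law_init]
  rw [MeasurableSpace.comap_const, condExp_bot]
  refine ae_of_all _ fun ω => ?_
  simp only [Kernel.const_apply]
  rw [← hmap, map_measureReal_apply hm hS]
  exact integral_indicator_one (hm hS)

lemma IsParticleFilter.integral_gHat_zero (hF : A.IsParticleFilter y ξ I μ T)
    (hC : A.BoundedBy y T C) (hN : N ≠ 0) {f : X → ℝ} (hf : Measurable f) {K : ℝ}
    (hK : ∀ x, |f x| ≤ K) :
    ∫ ω, ∫ x, f x ∂(A.gHat y ξ I 0 ω) ∂μ = ∫ x, f x ∂(H.γ y 0) := by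
  simp only [Proposal.integral_gHat_zero _ hf]
  have := hF.isCondIID_zero.integral_average hN measurable_const (hF.measurable_ξ 0)
    (Y := fun _ x => A.w₀ y x * f x) ((measurable_w₀.mul hf).comp measurable_snd)
    (fun _ x => abs_w₀_mul_le hC hK x) (by simp)
  rw [this]
  simp [integral_w₀]

lemma IsParticleFilter.integral_gHat_zero_sub_sq_le (hF : A.IsParticleFilter y ξ I μ T)
    (hC : A.BoundedBy y T C) (hN : N ≠ 0) {f : X → ℝ} (hf : Measurable f) {K : ℝ}
    (hK : ∀ x, |f x| ≤ K) :
    ∫ ω, (∫ x, f x ∂(A.gHat y ξ I 0 ω) - ∫ x, f x ∂(H.γ y 0)) ^ 2 ∂μ ≤ (C * K) ^ 2 / N := by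
  simp only [Proposal.integral_gHat_zero _ hf]
  have := hF.isCondIID_zero.integral_average_sub_sq_le hN measurable_const (hF.measurable_ξ 0)
    (Y := fun _ x => A.w₀ y x * f x) ((measurable_w₀.mul hf).comp measurable_snd)
    (fun _ x => abs_w₀_mul_le hC hK x) (by simp)
  simpa [integral_w₀] using this

lemma IsParticleFilter.norm_charFun_zero_sub_le (hF : A.IsParticleFilter y ξ I μ T)
    (hC : A.BoundedBy y T C) (hN : N ≠ 0) {f : X → ℝ} (hf : Measurable f) {K : ℝ}
    (hK : ∀ x, |f x| ≤ K) (h0 : ∫ x, f x ∂(H.γ y 0) = 0) (u : ℝ) :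
    ‖∫ ω, Complex.exp (Complex.I * (u * (√N * ∫ x, f x ∂(A.gHat y ξ I 0 ω)) : ℝ)) ∂μ
      - Real.exp (-(u ^ 2 * (∫ x, A.w₀ y x ^ 2 * f x ^ 2 ∂A.ρ₀) / 2))‖
      ≤ cltConst u (C * K) / √N := by
  simp only [Proposal.integral_gHat_zero _ hf]
  have := hF.isCondIID_zero.norm_charFun_sub_le hN measurable_const (hF.measurable_ξ 0)
    (Y := fun _ x => A.w₀ y x * f x) ((measurable_w₀.mul hf).comp measurable_snd)
    (fun _ x => abs_w₀_mul_le hC hK x) (by simp) u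
  simpa [integral_w₀, h0, mul_pow] using this

end Steps

end Proposal

/-! ### Unbiasedness, mean square errors and normalisation of the backward kernels. -/

lemma integral_abs_le_sqrt {Ω : Type*} [MeasurableSpace Ω] {μ : Measure Ω}
    [IsProbabilityMeasure μ] {Z : Ω → ℝ} (hZ : Measurable Z) {K : ℝ} (hK : ∀ ω, |Z ω| ≤ K)
    {B : ℝ} (hB : ∫ ω, Z ω ^ 2 ∂μ ≤ B) : ∫ ω, |Z ω| ∂μ ≤ √B := by
  have hmem : MemLp (fun ω => |Z ω|) 2 μ := MemLp.of_bound hZ.abs.aestronglyMeasurable K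
    (ae_of_all _ fun ω => by simpa using hK ω)
  -- Jensen's inequality, read off from the variance of `|Z|` being nonnegative.
  have h := variance_nonneg (fun ω => |Z ω|) μ
  rw [variance_eq_sub hmem] at h
  simp only [Pi.pow_apply, sq_abs] at h
  exact Real.le_sqrt_of_sq_le (by linarith)

lemma integral_sub_sq_le {Ω : Type*} [MeasurableSpace Ω] {μ : Measure Ω} [IsProbabilityMeasure μ]
    {Z Z' : Ω → ℝ} (hZ : Measurable Z) (hZ' : Measurable Z') {K K' : ℝ} (hK : ∀ ω, |Z ω| ≤ K)
    (hK' : ∀ ω, |Z' ω| ≤ K') (c : ℝ) {B B' : ℝ} (hB : ∫ ω, (Z ω - Z' ω) ^ 2 ∂μ ≤ B)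
    (hB' : ∫ ω, (Z' ω - c) ^ 2 ∂μ ≤ B') : ∫ ω, (Z ω - c) ^ 2 ∂μ ≤ 2 * B + 2 * B' := by
  have h1 : Integrable (fun ω => (Z ω - Z' ω) ^ 2) μ :=
    integrable_of_abs_le (K := (K + K') ^ 2) (by fun_prop) fun ω => by
      rw [abs_pow]
      exact pow_le_pow_left₀ (abs_nonneg _) ((abs_sub _ _).trans (add_le_add (hK ω) (hK' ω))) 2
  have h2 : Integrable (fun ω => (Z' ω - c) ^ 2) μ :=
    integrable_of_abs_le (K := (K' + |c|) ^ 2) (by fun_prop) fun ω => by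
      rw [abs_pow]
      exact pow_le_pow_left₀ (abs_nonneg _) ((abs_sub _ _).trans (add_le_add (hK' ω) le_rfl)) 2
  calc ∫ ω, (Z ω - c) ^ 2 ∂μ ≤ ∫ ω, (2 * (Z ω - Z' ω) ^ 2 + 2 * (Z' ω - c) ^ 2) ∂μ := by
        refine integral_mono_of_nonneg (ae_of_all _ fun ω => sq_nonneg _)
          ((h1.const_mul 2).add (h2.const_mul 2)) (ae_of_all _ fun ω => ?_)
        simp only
        nlinarith [sq_nonneg ((Z ω - Z' ω) - (Z' ω - c))]
    _ = 2 * ∫ ω, (Z ω - Z' ω) ^ 2 ∂μ + 2 * ∫ ω, (Z' ω - c) ^ 2 ∂μ := by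
        rw [integral_add (h1.const_mul 2) (h2.const_mul 2), integral_const_mul, integral_const_mul]
    _ ≤ 2 * B + 2 * B' := by gcongr

namespace Proposal

variable {H : HMM X Y} {A : Proposal H} {y : ℕ → Y} {T : ℕ} {C : ℝ}

/-- The constant in the mean square error of the particle approximation at time `t`. -/
def mseConst (C : ℝ) : ℕ → ℝ
  | 0 => C ^ 2
  | t + 1 => 2 * ((C * C) ^ (t + 1) * C) ^ 2 + 2 * (mseConst C t * C ^ 2)

section Particles

variable {Ω : Type*} {N : ℕ} {ξ : ℕ → Fin N → Ω → X} {I : ℕ → Fin N → Ω → Fin N}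

/-- The unnormalised smoothing functional of the particle filter at time `t`. -/
noncomputable def pathHat (A : Proposal H) (y : ℕ → Y) (ξ : ℕ → Fin N → Ω → X)
    (I : ℕ → Fin N → Ω → Fin N) (t : ℕ) (f : (ℕ → X) → ℝ) (ω : Ω) : ℝ :=
  ∫ x, H.backwardInt (fun s => A.filterHat y ξ I s ω) t f (fun _ => x) ∂(A.gHat y ξ I t ω)

lemma abs_pathHat_le (hC : A.BoundedBy y T C) {t : ℕ} (ht : t ≤ T) {f : (ℕ → X) → ℝ}
    (hf : Measurable f) {K : ℝ} (hK : ∀ x, |f x| ≤ K) (ω : Ω) :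
    |A.pathHat y ξ I t f ω| ≤ (C * C) ^ t * C * K :=
  abs_integral_gHat_le hC ht ω ((HMM.measurable_backwardInt_right _ hf t).comp
    (measurable_pi_lambda _ fun _ => measurable_id))
    fun _ => HMM.abs_backwardInt_le hC.m_le _ hK t _

/-- The martingale identity: the right side is the conditional mean, given the history up to `t`, of
the functional at time `t + 1`. It is the reversal identity for the particle filter itself. -/
lemma pathHat_forwardInt_succ (hC : A.BoundedBy y T C) {f : (ℕ → X) → ℝ} (hf : Measurable f)
    {K : ℝ} (hK : ∀ x, |f x| ≤ K) {k t : ℕ} (hdep : DependsOn f (Set.Iic (t + (k + 1))))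
    (ht : t + (k + 1) ≤ T) (ω : Ω) :
    A.pathHat y ξ I t (H.forwardInt y (k + 1) t f) ω
      = ∫ x, ∫ x', H.g y (t + 1) x' * H.backwardInt (fun s => A.filterHat y ξ I s ω) (t + 1)
          (H.forwardInt y k (t + 1) f) (fun _ => x') ∂(H.M x) ∂(A.gHat y ξ I t ω) :=
  HMM.integral_backwardInt_forwardInt_succ hC.g_le hC.m_le _ hf hK hdep ht (gHat_eq_smul t ω)

/-- The backward kernels started at `t + 1` use filters up to `t` only, so the integrand is known
before the particles of time `t + 1` are drawn. -/
lemma measurable_hist_backwardInt (t : ℕ) {f : (ℕ → X) → ℝ} (hf : Measurable f) :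
    Measurable (Function.uncurry fun (ω : WithSigma (A.hist y ξ I t)) x =>
      H.backwardInt (fun s => A.filterHat y ξ I s ω) (t + 1) f (fun _ => x)) :=
  @measurable_backwardInt_filterHat_const _ _ _ _ H A y Ω N ξ I (A.hist y ξ I t) t
    (fun _ hs i => measurable_hist_ξ hs i) (fun _ hs i => measurable_hist_weight hs i) f hf
    (t + 1) le_rfl

end Particles

section Particles

variable {Ω : Type*} [mΩ : MeasurableSpace Ω] {N : ℕ} {ξ : ℕ → Fin N → Ω → X}
  {I : ℕ → Fin N → Ω → Fin N} {μ : Measure Ω}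

lemma IsParticleFilter.measurable_integral (hF : A.IsParticleFilter y ξ I μ T) (t : ℕ)
    {f : Ω → X → ℝ} (hf : Measurable (Function.uncurry f)) :
    Measurable fun ω => ∫ x, f ω x ∂(A.gHat y ξ I t ω) :=
  (measurable_integral_gHat (t := t) (fun s _ i => hF.measurable_ξ s i)
    (fun s _ i => hF.measurable_weight s i) le_rfl (E := Unit) (f := fun ω _ x => f ω x)
    (hf.comp ((measurable_fst.comp measurable_fst).prodMk measurable_snd))).comp
    (measurable_id.prodMk (measurable_const (a := ())))

lemma IsParticleFilter.measurable_backwardInt (hF : A.IsParticleFilter y ξ I μ T) (t : ℕ)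
    {f : (ℕ → X) → ℝ} (hf : Measurable f) :
    Measurable (Function.uncurry fun ω x =>
      H.backwardInt (fun s => A.filterHat y ξ I s ω) t f (fun _ => x)) :=
  measurable_backwardInt_filterHat_const (t := t) (fun s _ i => hF.measurable_ξ s i)
    (fun s _ i => hF.measurable_weight s i) hf (Nat.le_succ t)

lemma IsParticleFilter.measurable_pathHat (hF : A.IsParticleFilter y ξ I μ T) (t : ℕ)
    {f : (ℕ → X) → ℝ} (hf : Measurable f) : Measurable (A.pathHat y ξ I t f) :=
  hF.measurable_integral t (hF.measurable_backwardInt t hf)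

lemma measurable_integral_M_g (t : ℕ) {f : X → ℝ} (hf : Measurable f) :
    Measurable fun x => ∫ x', H.g y t x' * f x' ∂(H.M x) :=
  (StronglyMeasurable.integral_kernel_prod_right (κ := H.M) (f := fun _ x' => H.g y t x' * f x')
    (((H.measurable_g y t).mul hf).comp measurable_snd).stronglyMeasurable).measurable

lemma abs_integral_M_g_le (hC : A.BoundedBy y T C) {t : ℕ} (ht : t ≤ T) {f : X → ℝ} {K : ℝ}
    (hK : ∀ x, |f x| ≤ K) (x : X) : |∫ x', H.g y t x' * f x' ∂(H.M x)| ≤ C * K :=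
  abs_integral_le_of_abs_le fun x' => HMM.abs_g_mul_le hC.g_le ht x' (hK x')

variable [IsProbabilityMeasure μ]

/-- The particle approximation of the unnormalised filter is unbiased. -/
lemma IsParticleFilter.integral_integral_gHat (hF : A.IsParticleFilter y ξ I μ T)
    (hC : A.BoundedBy y T C) (hN : N ≠ 0) {t : ℕ} (ht : t ≤ T) {f : X → ℝ} (hf : Measurable f)
    {K : ℝ} (hK : ∀ x, |f x| ≤ K) :
    ∫ ω, ∫ x, f x ∂(A.gHat y ξ I t ω) ∂μ = ∫ x, f x ∂(H.γ y t) := by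
  induction t generalizing f K with
  | zero => exact hF.integral_gHat_zero hC hN hf hK
  | succ t ih =>
    rw [hF.integral_gHat_succ hC hN ht (Φ := fun _ x => f x) (hf.comp measurable_snd)
      (fun _ x => hK x), HMM.integral_γ_succ hC.g_le ht hf hK]
    exact ih (by omega) (measurable_integral_M_g _ hf) (abs_integral_M_g_le hC ht hK)

/-- The error at `t + 1` is a sampling error of order `1/N` plus the error at `t` for the propagated
function, which is bounded by `C * K`. -/
lemma IsParticleFilter.integral_gHat_sub_sq_le (hF : A.IsParticleFilter y ξ I μ T)
    (hC : A.BoundedBy y T C) (hN : N ≠ 0) {t : ℕ} (ht : t ≤ T) {f : X → ℝ} (hf : Measurable f)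
    {K : ℝ} (hK : ∀ x, |f x| ≤ K) :
    ∫ ω, (∫ x, f x ∂(A.gHat y ξ I t ω) - ∫ x, f x ∂(H.γ y t)) ^ 2 ∂μ
      ≤ mseConst C t * K ^ 2 / N := by
  induction t generalizing f K with
  | zero => simpa [mseConst, mul_pow] using hF.integral_gHat_zero_sub_sq_le hC hN hf hK
  | succ t ih =>
    have hfM := measurable_integral_M_g (H := H) (y := y) (t + 1) hf
    have hKM := abs_integral_M_g_le hC ht hK
    rw [HMM.integral_γ_succ hC.g_le ht hf hK]
    refine (integral_sub_sq_le (hF.measurable_integral (t + 1) (f := fun _ x => f x)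
      (hf.comp measurable_snd))
      (hF.measurable_integral t (f := fun _ x => ∫ x', H.g y (t + 1) x' * f x' ∂(H.M x))
        (hfM.comp measurable_snd))
      (fun ω => abs_integral_gHat_le hC ht ω hf hK)
      (fun ω => abs_integral_gHat_le hC (by omega) ω hfM hKM) _
      (hF.integral_gHat_succ_sub_sq_le hC hN ht (Φ := fun _ x => f x) (hf.comp measurable_snd)
        (fun _ x => hK x)) (ih (by omega) hfM hKM)).trans_eq ?_
    rw [mseConst]
    ring

/-- The particle approximation of the unnormalised smoothing functional is unbiased. -/
lemma IsParticleFilter.integral_pathHat (hF : A.IsParticleFilter y ξ I μ T)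
    (hC : A.BoundedBy y T C) (hN : N ≠ 0) {k t : ℕ} (ht : t + k ≤ T) {f : (ℕ → X) → ℝ}
    (hf : Measurable f) {K : ℝ} (hK : ∀ x, |f x| ≤ K) (hdep : DependsOn f (Set.Iic (t + k))) :
    ∫ ω, A.pathHat y ξ I t (H.forwardInt y k t f) ω ∂μ
      = ∫ x, H.forwardInt y (t + k) 0 f (fun _ => x) ∂(H.γ y 0) := by
  induction t generalizing k with
  | zero =>
    rw [zero_add] at ht ⊢
    exact hF.integral_gHat_zero hC hN ((HMM.measurable_forwardInt hf k 0).comp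
      (measurable_pi_lambda _ fun _ => measurable_id))
      (fun x => HMM.abs_forwardInt_le hC.g_le hK k (by omega) _)
  | succ t ih =>
    have e : t + (k + 1) = t + 1 + k := by ring
    rw [← e] at hdep ht ⊢
    rw [← ih ht hdep]
    simp_rw [pathHat_forwardInt_succ hC hf hK hdep ht]
    exact hF.integral_gHat_succ hC hN (by omega)
      (measurable_hist_backwardInt t (HMM.measurable_forwardInt hf k _))
      (fun (ω : Ω) x => HMM.abs_backwardInt_le hC.m_le _
        (HMM.abs_forwardInt_le hC.g_le hK k (by omega)) _ _)

/-- The same recursion for path functionals. No ratio has to be controlled, because by the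
martingale identity the propagated functional is again a `pathHat`. -/
lemma IsParticleFilter.integral_pathHat_sub_sq_le (hF : A.IsParticleFilter y ξ I μ T)
    (hC : A.BoundedBy y T C) (hN : N ≠ 0) {k t : ℕ} (ht : t + k ≤ T) {f : (ℕ → X) → ℝ}
    (hf : Measurable f) {K : ℝ} (hK : ∀ x, |f x| ≤ K) (hdep : DependsOn f (Set.Iic (t + k))) :
    ∫ ω, (A.pathHat y ξ I t (H.forwardInt y k t f) ω
      - ∫ x, H.forwardInt y (t + k) 0 f (fun _ => x) ∂(H.γ y 0)) ^ 2 ∂μ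
      ≤ mseConst C t * (C ^ k * K) ^ 2 / N := by
  induction t generalizing k with
  | zero =>
    rw [zero_add] at ht ⊢
    refine (hF.integral_gHat_zero_sub_sq_le hC hN ((HMM.measurable_forwardInt hf k 0).comp
      (measurable_pi_lambda _ fun _ => measurable_id))
      (fun x => HMM.abs_forwardInt_le hC.g_le hK k (by omega) _)).trans_eq ?_
    rw [mseConst]; ring
  | succ t ih =>
    have e : t + (k + 1) = t + 1 + k := by ring
    rw [← e] at hdep ht ⊢
    have hmF := HMM.measurable_forwardInt (H := H) (y := y) hf k (t + 1)
    have hKF := HMM.abs_forwardInt_le hC.g_le hK k (t := t + 1) (by omega)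
    have hmF' := HMM.measurable_forwardInt (H := H) (y := y) hf (k + 1) t
    have hKF' := HMM.abs_forwardInt_le hC.g_le hK (k + 1) (t := t) (by omega)
    have h2 := ih ht hdep
    refine (integral_sub_sq_le (hF.measurable_pathHat (t + 1) hmF) (hF.measurable_pathHat t hmF')
      (abs_pathHat_le hC (by omega) hmF hKF) (abs_pathHat_le hC (by omega) hmF' hKF') _
      (B := ((C * C) ^ (t + 1) * C * (C ^ k * K)) ^ 2 / N) ?_ h2).trans_eq ?_
    · simp_rw [pathHat_forwardInt_succ hC hf hK hdep ht]
      exact hF.integral_gHat_succ_sub_sq_le hC hN (by omega)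
        (measurable_hist_backwardInt t hmF)
        (fun (ω : Ω) x => HMM.abs_backwardInt_le hC.m_le _ hKF _ _)
    · rw [mseConst]; ring

/-- Almost surely, the backward kernels of the particle filter are normalised along the particles
that carry a positive mass. -/
lemma IsParticleFilter.pathHat_one_ae_eq (hF : A.IsParticleFilter y ξ I μ T)
    (hC : A.BoundedBy y T C) (hN : N ≠ 0) {t : ℕ} (ht : t ≤ T) :
    A.pathHat y ξ I t (fun _ => 1) =ᵐ[μ] fun ω => (A.gHat y ξ I t ω).real Set.univ := by
  have h1m : Measurable fun _ : ℕ → X => (1 : ℝ) := measurable_const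
  have hmeas := hF.measurable_pathHat t h1m
  have hmeas' : Measurable fun ω => (A.gHat y ξ I t ω).real Set.univ := by
    simpa using hF.measurable_integral t (f := fun _ _ => (1 : ℝ)) measurable_const
  -- A backward kernel has mass `1`, or `0` where its denominator vanishes.
  have hle : ∀ ω, A.pathHat y ξ I t (fun _ => 1) ω ≤ (A.gHat y ξ I t ω).real Set.univ := by
    intro ω
    have hb : ∀ x, |H.backwardInt (fun s => A.filterHat y ξ I s ω) t (fun _ => 1) x| ≤ 1 :=
      HMM.abs_backwardInt_le hC.m_le _ (by simp) t
    have : (A.gHat y ξ I t ω).real Set.univ = ∫ _, (1 : ℝ) ∂(A.gHat y ξ I t ω) := by simp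
    rw [this]
    refine integral_mono (integrable_of_abs_le ((HMM.measurable_backwardInt_right _ h1m t).comp
      (measurable_pi_lambda _ fun _ => measurable_id)) fun x => hb _) (integrable_const _)
      fun x => (le_abs_self _).trans (hb _)
  have hi : Integrable (A.pathHat y ξ I t (fun _ => 1)) μ :=
    integrable_of_abs_le hmeas (abs_pathHat_le hC ht h1m (K := 1) (by simp))
  have hb' : ∀ ω, |(A.gHat y ξ I t ω).real Set.univ| ≤ (C * C) ^ t * C * 1 := fun ω => by
    simpa using abs_integral_gHat_le (ξ := ξ) (I := I) hC ht ω (f := fun _ => 1) measurable_const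
      (K := 1) (by simp)
  have hi' : Integrable (fun ω => (A.gHat y ξ I t ω).real Set.univ) μ :=
    integrable_of_abs_le hmeas' hb'
  have e1 := hF.integral_pathHat hC hN (k := 0) ht h1m (K := 1) (by simp) (fun _ _ _ => rfl)
  have e2 := hF.integral_integral_gHat hC hN ht (f := fun _ => 1) measurable_const (K := 1)
    (by simp)
  have e3 := HMM.integral_γ_forwardInt_one hC.g_le t (t := 0) (by omega)
  simp only [HMM.forwardInt, add_zero, zero_add] at e1 e3
  -- By unbiasedness both terms have expectation `γ_t(X)`; a nonnegative variable with mean zero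
  -- vanishes almost surely.
  have hzero : ∫ ω, ((A.gHat y ξ I t ω).real Set.univ - A.pathHat y ξ I t (fun _ => 1) ω) ∂μ
      = 0 := by
    rw [integral_sub hi' hi, e1, e3]
    simp only [integral_const, smul_eq_mul, mul_one] at e2
    rw [e2, sub_self]
  rw [integral_eq_zero_iff_of_nonneg (fun ω => sub_nonneg.2 (hle ω)) (hi'.sub hi)] at hzero
  filter_upwards [hzero] with ω hω
  simp only [Pi.zero_apply] at hω
  linarith

end Particles

end Proposal

/-! ### Convergence in mean of the conditional second moment. -/

lemma abs_mul_sq_sub_le {a a' b b' c c' F F' K D : ℝ} (hb : c * F = b) (hb' : c' * F' = b')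
    (hF : |F| ≤ K) (hF' : |F'| ≤ K) (ha' : 0 ≤ a') (hD : a' ≤ D * c') (hD0 : 0 ≤ D)
    (hc' : 0 ≤ c') :
    |a' * F' ^ 2 - a * F ^ 2| ≤ K ^ 2 * |a' - a| + 2 * K * D * (|b' - b| + K * |c' - c|) := by
  have hK0 : 0 ≤ K := (abs_nonneg _).trans hF
  have h1 : |(a' - a) * F ^ 2| ≤ K ^ 2 * |a' - a| := by
    rw [abs_mul, abs_pow, mul_comm]
    gcongr
  -- The difference of the ratios `F = b/c` is controlled only after multiplication by `c'`. The
  -- hypothesis `a' ≤ D * c'` supplies this factor, so nothing is divided by a small number.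
  have h2 : c' * |F' - F| ≤ |b' - b| + K * |c' - c| := by
    calc c' * |F' - F| = |(b' - b) - (c' - c) * F| := by
          rw [← abs_of_nonneg hc', ← abs_mul, abs_of_nonneg hc', ← hb, ← hb']; congr 1; ring
      _ ≤ |b' - b| + |(c' - c) * F| := abs_sub _ _
      _ ≤ |b' - b| + K * |c' - c| := by
          rw [abs_mul, mul_comm |c' - c|]; gcongr
  have h3 : |a' * (F' ^ 2 - F ^ 2)| ≤ 2 * K * D * (|b' - b| + K * |c' - c|) := by
    have hs : |F' + F| ≤ 2 * K := (abs_add_le _ _).trans (by linarith)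
    calc |a' * (F' ^ 2 - F ^ 2)| = a' * (|F' - F| * |F' + F|) := by
          rw [abs_mul, abs_of_nonneg ha', ← abs_mul]; congr 2; ring
      _ ≤ (D * c') * (|F' - F| * (2 * K)) := by gcongr
      _ = 2 * K * D * (c' * |F' - F|) := by ring
      _ ≤ _ := by gcongr
  calc |a' * F' ^ 2 - a * F ^ 2| = |(a' - a) * F ^ 2 + a' * (F' ^ 2 - F ^ 2)| := by
        congr 1; ring
    _ ≤ _ := (abs_add_le _ _).trans (add_le_add h1 h3)

lemma tendsto_sqrt_const_div (B : ℝ) :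
    Tendsto (fun N : ℕ => √(B / N)) atTop (𝓝 0) := by
  have h : Tendsto (fun N : ℕ => B / (N : ℝ)) atTop (𝓝 0) :=
    tendsto_const_nhds.div_atTop tendsto_natCast_atTop_atTop
  have h' := (Real.continuous_sqrt.tendsto 0).comp h
  rw [Real.sqrt_zero] at h'
  exact h'

namespace HMM

/-- Multiplying by its denominator turns the ratio at a fixed endpoint `x'` into a path functional
at time `t`, for which the mean square bounds are available. -/
lemma integral_m_mul_backwardInt_succ {H : HMM X Y} {C : ℝ} (hm : ∀ x x', H.m x x' ≤ C)
    (η : ℕ → Measure X) [∀ t, IsFiniteMeasure (η t)] {f : (ℕ → X) → ℝ} {K : ℝ}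
    (hK : ∀ x, |f x| ≤ K) {t : ℕ} (hdep : DependsOn f (Set.Iic (t + 1))) {c : ℝ≥0∞}
    {γ' : Measure X} (hγ : γ' = c • η t) (x' : X) :
    (∫ x, H.m x x' ∂γ') * H.backwardInt η (t + 1) f (fun _ => x')
      = ∫ x, H.backwardInt η t (fun z => H.m (z t) x' * f (Function.update z (t + 1) x'))
          (fun _ => x) ∂γ' := by
  rw [hγ, integral_smul_measure, integral_smul_measure, smul_eq_mul, smul_eq_mul, mul_assoc]
  congr 1
  rw [backwardInt, B_mul_integral hm (η t) x' (fun x => abs_backwardInt_le hm η hK t _)]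
  refine integral_congr_ae (ae_of_all _ fun x => ?_)
  simp only
  rw [backwardInt_mul η (fun u => H.m u x') _ le_rfl]
  congr 1
  refine backwardInt_congr t (fun _ _ => rfl) (by simp) fun z z' h1 h2 h3 => hdep fun i hi => ?_
  simp only [Set.mem_Iic] at hi
  rcases lt_trichotomy i t with hit | rfl | hit
  · rw [Function.update_of_ne (by omega)]; exact h1 i hit
  · rw [h2 i le_rfl, Function.update_self, Function.update_of_ne (by omega), h3 i le_rfl]
  · obtain rfl : i = t + 1 := by omega
    rw [h2 _ (by omega), Function.update_self, Function.update_of_ne (by omega)]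

end HMM

namespace Proposal

variable {H : HMM X Y} {A : Proposal H} {y : ℕ → Y} {T : ℕ} {C : ℝ}

lemma measurable_g_mul_w (t : ℕ) :
    Measurable (Function.uncurry fun x x' => H.g y t x' * A.w y t x x') :=
  ((H.measurable_g y t).comp measurable_snd).mul (measurable_w t)

lemma g_mul_w_nonneg (t : ℕ) (x x' : X) : 0 ≤ H.g y t x' * A.w y t x x' :=
  mul_nonneg (H.g_nonneg y t _) (w_nonneg _ _ _)

lemma g_mul_w_le (hC : A.BoundedBy y T C) {t : ℕ} (h1 : 1 ≤ t) (ht : t ≤ T) (x x' : X) :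
    H.g y t x' * A.w y t x x' ≤ C * C :=
  mul_le_mul (hC.g_le t ht _) (hC.w_le t h1 ht _ _) (w_nonneg _ _ _)
    (zero_le_one.trans hC.one_le)

lemma measurable_g_mul_w_mul_sq (t : ℕ) {Φ : X → ℝ} (hΦ : Measurable Φ) :
    Measurable (Function.uncurry fun x x' => (H.g y t x' * A.w y t x x') * Φ x' ^ 2) :=
  Measurable.mul (f := fun p : X × X => H.g y t p.2 * A.w y t p.1 p.2)
    (g := fun p : X × X => Φ p.2 ^ 2) (measurable_g_mul_w t)
    ((hΦ.pow_const 2).comp measurable_snd)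

lemma abs_g_mul_w_mul_sq_le (hC : A.BoundedBy y T C) {t : ℕ} (h1 : 1 ≤ t) (ht : t ≤ T)
    {Φ : X → ℝ} {K : ℝ} (hK : ∀ x, |Φ x| ≤ K) (x x' : X) :
    |(H.g y t x' * A.w y t x x') * Φ x' ^ 2| ≤ C * C * K ^ 2 := by
  have hC0 : 0 ≤ C := zero_le_one.trans hC.one_le
  rw [abs_mul, abs_of_nonneg (g_mul_w_nonneg t x x'), abs_pow]
  exact mul_le_mul (g_mul_w_le hC h1 ht x x') (pow_le_pow_left₀ (abs_nonneg _) (hK x') 2)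
    (by positivity) (by positivity)

lemma integrable_weighted_sq (hC : A.BoundedBy y T C) (η : Measure X) [IsFiniteMeasure η] {t : ℕ}
    (h1 : 1 ≤ t) (ht : t ≤ T) {Φ : X → ℝ} (hΦ : Measurable Φ) {K : ℝ} (hK : ∀ x, |Φ x| ≤ K) :
    Integrable (fun x' => (∫ x, H.m x x' * (H.g y t x' * A.w y t x x') ∂η) * Φ x' ^ 2) H.ν := by
  have hi := H.integrable_m_mul_prod η
    (f := fun x x' => (H.g y t x' * A.w y t x x') * Φ x' ^ 2) (K := C * C * K ^ 2)
    (measurable_g_mul_w_mul_sq t hΦ) (abs_g_mul_w_mul_sq_le hC h1 ht hK)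
  have := hi.integral_prod_right
  simp only [← mul_assoc, integral_mul_const] at this ⊢
  exact this

/-- One of the two weights converts `ϑ P` into `M` with likelihood `g`. Fubini then puts `ν(dx')`
outside, where `Φ x'` is constant for the inner integral. -/
lemma integral_ϑ_mul_integral_P (hC : A.BoundedBy y T C) (η : Measure X) [IsFiniteMeasure η]
    {t : ℕ} (h1 : 1 ≤ t) (ht : t ≤ T) {Φ : X → ℝ} (hΦ : Measurable Φ) {K : ℝ}
    (hK : ∀ x, |Φ x| ≤ K) :
    ∫ x, A.ϑ t x * ∫ x', A.w y t x x' ^ 2 * Φ x' ^ 2 ∂(A.P t x) ∂η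
      = ∫ x', (∫ x, H.m x x' * (H.g y t x' * A.w y t x x') ∂η) * Φ x' ^ 2 ∂H.ν := by
  have e : ∀ x, A.ϑ t x * ∫ x', A.w y t x x' ^ 2 * Φ x' ^ 2 ∂(A.P t x)
      = ∫ x', (H.g y t x' * A.w y t x x') * Φ x' ^ 2 ∂(H.M x) := fun x => by
    have := ϑ_mul_integral_P hC h1 ht x (fun x' => A.w y t x x' * Φ x' ^ 2)
    simp only [← mul_assoc, ← sq] at this
    exact this
  simp_rw [e]
  rw [H.integral_integral_M η (f := fun x x' => (H.g y t x' * A.w y t x x') * Φ x' ^ 2)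
    (K := C * C * K ^ 2) (measurable_g_mul_w_mul_sq t hΦ)
    (abs_g_mul_w_mul_sq_le hC h1 ht hK)]
  simp only [← mul_assoc, integral_mul_const]

section Pointwise

variable {Ω : Type*} {N : ℕ} {ξ : ℕ → Fin N → Ω → X} {I : ℕ → Fin N → Ω → Fin N}

/-- The integrand, with respect to `ν(dx')`, of the particle approximation of the conditional
second moment. -/
noncomputable def sqDensityHat (A : Proposal H) (y : ℕ → Y) (ξ : ℕ → Fin N → Ω → X)
    (I : ℕ → Fin N → Ω → Fin N) (t : ℕ) (f : (ℕ → X) → ℝ) (ω : Ω) (x' : X) : ℝ :=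
  (∫ x, H.m x x' * (H.g y (t + 1) x' * A.w y (t + 1) x x') ∂(A.gHat y ξ I t ω))
    * H.backwardInt (fun s => A.filterHat y ξ I s ω) (t + 1) f (fun _ => x') ^ 2

/-- The limit of `sqDensityHat`. -/
noncomputable def sqDensity (A : Proposal H) (y : ℕ → Y) (t : ℕ) (f : (ℕ → X) → ℝ) (x' : X) : ℝ :=
  (∫ x, H.m x x' * (H.g y (t + 1) x' * A.w y (t + 1) x x') ∂(H.γ y t))
    * H.backwardInt (H.φ y) (t + 1) f (fun _ => x') ^ 2

lemma measurable_sqDensity (hC : A.BoundedBy y T C) {t : ℕ} (ht : t ≤ T)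
    {f : (ℕ → X) → ℝ} (hf : Measurable f) : Measurable (A.sqDensity y t f) := by
  have := HMM.isFiniteMeasure_γ hC.g_le ht
  refine Measurable.mul ?_ (((HMM.measurable_backwardInt_right _ hf (t + 1)).comp
    (measurable_pi_lambda _ fun _ => measurable_id)).pow_const 2)
  exact (StronglyMeasurable.integral_prod_left (μ := H.γ y t)
    (f := fun x x' => H.m x x' * (H.g y (t + 1) x' * A.w y (t + 1) x x'))
    (H.measurable_m.mul (measurable_g_mul_w (A := A) (y := y) (t + 1))).stronglyMeasurable
    ).measurable

variable {t : ℕ} {f : (ℕ → X) → ℝ} {K : ℝ}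

lemma integral_m_mul_g_mul_w_nonneg (η : Measure X) (x' : X) :
    0 ≤ ∫ x, H.m x x' * (H.g y t x' * A.w y t x x') ∂η :=
  integral_nonneg fun _ => mul_nonneg (H.m_nonneg _ _) (g_mul_w_nonneg _ _ _)

lemma integral_m_mul_g_mul_w_le (hC : A.BoundedBy y T C) (η : Measure X) [IsFiniteMeasure η]
    (h1 : 1 ≤ t) (ht : t ≤ T) (x' : X) :
    ∫ x, H.m x x' * (H.g y t x' * A.w y t x x') ∂η ≤ C * C * ∫ x, H.m x x' ∂η := by
  rw [← integral_const_mul]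
  refine integral_mono_of_nonneg
    (ae_of_all _ fun x => mul_nonneg (H.m_nonneg _ _) (g_mul_w_nonneg _ _ _))
    ((HMM.integrable_m_left hC.m_le η x').const_mul _) (ae_of_all _ fun x => ?_)
  simp only
  rw [mul_comm]
  exact mul_le_mul_of_nonneg_right (g_mul_w_le hC h1 ht _ _) (H.m_nonneg _ _)

lemma abs_sqDensityHat_le (hC : A.BoundedBy y T C) (ht : t + 1 ≤ T) (hK : ∀ x, |f x| ≤ K)
    (ω : Ω) (x' : X) : |A.sqDensityHat y ξ I t f ω x'|
      ≤ C * C * K ^ 2 * ∫ x, H.m x x' ∂(A.gHat y ξ I t ω) := by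
  rw [sqDensityHat, abs_mul, abs_of_nonneg (integral_m_mul_g_mul_w_nonneg _ _), abs_pow]
  have h1 := integral_m_mul_g_mul_w_le hC (A.gHat y ξ I t ω) (show 1 ≤ t + 1 by omega) ht x'
  have h2 := pow_le_pow_left₀ (abs_nonneg _) (HMM.abs_backwardInt_le hC.m_le
    (fun s => A.filterHat y ξ I s ω) hK (t + 1) (fun _ => x')) 2
  refine (mul_le_mul h1 h2 (by positivity)
    ((integral_m_mul_g_mul_w_nonneg _ _).trans h1)).trans_eq (by ring)

lemma abs_sqDensity_le (hC : A.BoundedBy y T C) (ht : t + 1 ≤ T) (hK : ∀ x, |f x| ≤ K)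
    (x' : X) : |A.sqDensity y t f x'| ≤ C * C * K ^ 2 * ∫ x, H.m x x' ∂(H.γ y t) := by
  have := HMM.isFiniteMeasure_γ hC.g_le (t := t) (by omega)
  rw [sqDensity, abs_mul, abs_of_nonneg (integral_m_mul_g_mul_w_nonneg _ _), abs_pow]
  have h1 := integral_m_mul_g_mul_w_le hC (H.γ y t) (show 1 ≤ t + 1 by omega) ht x'
  have h2 := pow_le_pow_left₀ (abs_nonneg _) (HMM.abs_backwardInt_le hC.m_le
    (H.φ y) hK (t + 1) (fun _ => x')) 2
  refine (mul_le_mul h1 h2 (by positivity)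
    ((integral_m_mul_g_mul_w_nonneg _ _).trans h1)).trans_eq (by ring)

variable [MeasurableSpace Ω] {μ : Measure Ω}

lemma IsParticleFilter.measurable_sqDensityHat (hF : A.IsParticleFilter y ξ I μ T) (t : ℕ)
    {f : (ℕ → X) → ℝ} (hf : Measurable f) :
    Measurable (Function.uncurry (A.sqDensityHat y ξ I t f)) := by
  refine Measurable.mul ?_ ((hF.measurable_backwardInt (t + 1) hf).pow_const 2)
  refine measurable_integral_gHat (t := t) (fun s _ i => hF.measurable_ξ s i)
    (fun s _ i => hF.measurable_weight s i) le_rfl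
    (f := fun _ x' x => H.m x x' * (H.g y (t + 1) x' * A.w y (t + 1) x x')) ?_
  exact (H.measurable_m.mul (measurable_g_mul_w (A := A) (y := y) (t + 1))).comp
    (measurable_snd.prodMk (measurable_snd.comp measurable_fst))

variable [IsProbabilityMeasure μ]

lemma IsParticleFilter.integral_abs_gHat_sub_le (hF : A.IsParticleFilter y ξ I μ T)
    (hC : A.BoundedBy y T C) (hN : N ≠ 0) {t : ℕ} (ht : t ≤ T) {f : X → ℝ} (hf : Measurable f)
    {K : ℝ} (hK : ∀ x, |f x| ≤ K) :
    ∫ ω, |∫ x, f x ∂(A.gHat y ξ I t ω) - ∫ x, f x ∂(H.γ y t)| ∂μ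
      ≤ √(mseConst C t * K ^ 2 / N) := by
  refine integral_abs_le_sqrt ((hF.measurable_integral t (f := fun _ x => f x)
    (hf.comp measurable_snd)).sub_const _) (K := (C * C) ^ t * C * K + |∫ x, f x ∂(H.γ y t)|)
    (fun ω => (abs_sub _ _).trans (add_le_add (abs_integral_gHat_le hC ht ω hf hK) le_rfl))
    (hF.integral_gHat_sub_sq_le hC hN ht hf hK)

lemma IsParticleFilter.integral_abs_pathHat_sub_le (hF : A.IsParticleFilter y ξ I μ T)
    (hC : A.BoundedBy y T C) (hN : N ≠ 0) {t : ℕ} (ht : t ≤ T) {f : (ℕ → X) → ℝ}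
    (hf : Measurable f) {K : ℝ} (hK : ∀ x, |f x| ≤ K) (hdep : DependsOn f (Set.Iic t)) :
    ∫ ω, |A.pathHat y ξ I t f ω
      - ∫ x, H.backwardInt (H.φ y) t f (fun _ => x) ∂(H.γ y t)| ∂μ
      ≤ √(mseConst C t * K ^ 2 / N) := by
  have e := HMM.integral_γ_backwardInt hC.g_le hC.g_pos hC.m_le hf hK (k := 0) (t := t) hdep ht
  have h := hF.integral_pathHat_sub_sq_le hC hN (k := 0) ht hf hK hdep
  simp only [HMM.forwardInt, pow_zero, one_mul] at e h
  rw [e]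
  exact integral_abs_le_sqrt ((hF.measurable_pathHat t hf).sub_const _)
    (fun ω => (abs_sub _ _).trans (add_le_add (abs_pathHat_le hC ht hf hK ω) le_rfl)) h

lemma IsParticleFilter.integrable_sqDensityHat_sub (hF : A.IsParticleFilter y ξ I μ T)
    (hC : A.BoundedBy y T C) (ht : t + 1 ≤ T) (hf : Measurable f) (hK : ∀ x, |f x| ≤ K) (x' : X) :
    Integrable (fun ω => A.sqDensityHat y ξ I t f ω x' - A.sqDensity y t f x') μ := by
  have hC0 : 0 ≤ C := zero_le_one.trans hC.one_le
  refine integrable_of_abs_le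
    (K := C * C * K ^ 2 * ((C * C) ^ t * C * C) + |A.sqDensity y t f x'|)
    ((hF.measurable_sqDensityHat t hf).of_uncurry_right.sub_const _) fun ω => ?_
  refine (abs_sub _ _).trans (add_le_add ((abs_sqDensityHat_le hC ht hK ω x').trans ?_) le_rfl)
  gcongr
  exact (le_abs_self _).trans (abs_integral_gHat_le hC (by omega) ω
    H.measurable_m.of_uncurry_right fun x => by
      rw [abs_of_nonneg (H.m_nonneg _ _)]; exact hC.m_le _ _)

/-- Unbiasedness of `gHat` makes the bound independent of `N`; as a function of `x'` it is the
dominating function for the integral over `ν`. -/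
lemma IsParticleFilter.integral_abs_sqDensityHat_sub_le (hF : A.IsParticleFilter y ξ I μ T)
    (hC : A.BoundedBy y T C) (hN : N ≠ 0) (ht : t + 1 ≤ T)
    (hK : ∀ x, |f x| ≤ K) (x' : X) :
    ∫ ω, |A.sqDensityHat y ξ I t f ω x' - A.sqDensity y t f x'| ∂μ
      ≤ 2 * (C * C * K ^ 2) * ∫ x, H.m x x' ∂(H.γ y t) := by
  have hm := H.measurable_m.of_uncurry_right (y := x')
  have hmC : ∀ x, |H.m x x'| ≤ C := fun x => by
    rw [abs_of_nonneg (H.m_nonneg _ _)]; exact hC.m_le _ _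
  have hi : Integrable (fun ω => ∫ x, H.m x x' ∂(A.gHat y ξ I t ω)) μ :=
    integrable_of_abs_le (hF.measurable_integral t (f := fun _ x => H.m x x')
      (hm.comp measurable_snd)) fun ω => abs_integral_gHat_le hC (by omega) ω hm hmC
  calc ∫ ω, |A.sqDensityHat y ξ I t f ω x' - A.sqDensity y t f x'| ∂μ
      ≤ ∫ ω, (C * C * K ^ 2 * (∫ x, H.m x x' ∂(A.gHat y ξ I t ω))
        + C * C * K ^ 2 * ∫ x, H.m x x' ∂(H.γ y t)) ∂μ := by
        refine integral_mono_of_nonneg (ae_of_all _ fun ω => abs_nonneg _)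
          ((hi.const_mul _).add (integrable_const _)) (ae_of_all _ fun ω => ?_)
        exact (abs_sub _ _).trans (add_le_add (abs_sqDensityHat_le hC ht hK ω x')
          (abs_sqDensity_le hC ht hK x'))
    _ = 2 * (C * C * K ^ 2) * ∫ x, H.m x x' ∂(H.γ y t) := by
        rw [integral_add (hi.const_mul _) (integrable_const _), integral_const_mul,
          hF.integral_integral_gHat hC hN (by omega) hm hmC]
        simp
        ring

/-- Rate of convergence of `sqDensityHat` at a fixed point. -/
lemma IsParticleFilter.integral_abs_sqDensityHat_sub_le_sqrt (hF : A.IsParticleFilter y ξ I μ T)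
    (hC : A.BoundedBy y T C) (hN : N ≠ 0) (ht : t + 1 ≤ T) (hf : Measurable f)
    (hK : ∀ x, |f x| ≤ K) (hdep : DependsOn f (Set.Iic (t + 1))) (x' : X) :
    ∫ ω, |A.sqDensityHat y ξ I t f ω x' - A.sqDensity y t f x'| ∂μ
      ≤ K ^ 2 * √(mseConst C t * (C * (C * C)) ^ 2 / N)
        + 2 * K * (C * C) * (√(mseConst C t * (C * K) ^ 2 / N)
          + K * √(mseConst C t * C ^ 2 / N)) := by
  have hC0 : 0 ≤ C := zero_le_one.trans hC.one_le
  have hK0 : 0 ≤ K := (abs_nonneg _).trans (hK fun _ => x')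
  have := HMM.isFiniteMeasure_γ hC.g_le (t := t) (by omega)
  have hm := H.measurable_m.of_uncurry_right (y := x')
  have hmC : ∀ x, |H.m x x'| ≤ C := fun x => by
    rw [abs_of_nonneg (H.m_nonneg _ _)]; exact hC.m_le _ _
  have hr : Measurable fun x => H.m x x' * (H.g y (t + 1) x' * A.w y (t + 1) x x') :=
    hm.mul (measurable_g_mul_w (t + 1)).of_uncurry_right
  have hrC : ∀ x, |H.m x x' * (H.g y (t + 1) x' * A.w y (t + 1) x x')| ≤ C * (C * C) := fun x => by
    rw [abs_mul, abs_of_nonneg (g_mul_w_nonneg (t + 1) x x')]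
    exact mul_le_mul (hmC x) (g_mul_w_le hC (by omega) ht _ _) (g_mul_w_nonneg _ _ _) hC0
  -- The numerator of the backward ratio at the endpoint `x'`, as a path function of the coordinates
  -- up to `t`.
  set f' : (ℕ → X) → ℝ := fun z => H.m (z t) x' * f (Function.update z (t + 1) x') with hf'
  have hf'm : Measurable f' :=
    (hm.comp (measurable_pi_apply t)).mul (hf.comp measurable_update_left)
  have hf'K : ∀ z, |f' z| ≤ C * K := fun z => by
    rw [hf', abs_mul]; exact mul_le_mul (hmC _) (hK _) (abs_nonneg _) hC0
  have hf'dep : DependsOn f' (Set.Iic t) := fun z z' h => by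
    simp only [hf']
    rw [h t (by simp), hdep (x := Function.update z (t + 1) x')
      (y := Function.update z' (t + 1) x')]
    intro i hi
    rcases eq_or_ne i (t + 1) with rfl | hne
    · simp
    · rw [Function.update_of_ne hne, Function.update_of_ne hne]
      simp only [Set.mem_Iic] at hi
      exact h i (by simp; omega)
  have key : ∀ ω, |A.sqDensityHat y ξ I t f ω x' - A.sqDensity y t f x'|
      ≤ K ^ 2 * |∫ x, H.m x x' * (H.g y (t + 1) x' * A.w y (t + 1) x x') ∂(A.gHat y ξ I t ω)
          - ∫ x, H.m x x' * (H.g y (t + 1) x' * A.w y (t + 1) x x') ∂(H.γ y t)|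
        + 2 * K * (C * C) * (|A.pathHat y ξ I t f' ω
            - ∫ x, H.backwardInt (H.φ y) t f' (fun _ => x) ∂(H.γ y t)|
          + K * |∫ x, H.m x x' ∂(A.gHat y ξ I t ω) - ∫ x, H.m x x' ∂(H.γ y t)|) := fun ω =>
    abs_mul_sq_sub_le
      (HMM.integral_m_mul_backwardInt_succ hC.m_le (H.φ y) hK hdep
        (HMM.γ_eq_smul_φ hC.g_le hC.g_pos (by omega)) x')
      (HMM.integral_m_mul_backwardInt_succ hC.m_le (fun s => A.filterHat y ξ I s ω) hK hdep
        (gHat_eq_smul t ω) x')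
      (HMM.abs_backwardInt_le hC.m_le _ hK _ _) (HMM.abs_backwardInt_le hC.m_le _ hK _ _)
      (integral_m_mul_g_mul_w_nonneg _ _) (integral_m_mul_g_mul_w_le hC _ (by omega) ht x')
      (by positivity) (integral_nonneg fun x => H.m_nonneg _ _)
  have hint : ∀ (f : X → ℝ) (K : ℝ), Measurable f → (∀ x, |f x| ≤ K) → Integrable
      (fun ω => |∫ x, f x ∂(A.gHat y ξ I t ω) - ∫ x, f x ∂(H.γ y t)|) μ := fun f K hf hK =>
    ((integrable_of_abs_le (hF.measurable_integral t (f := fun _ x => f x)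
      (hf.comp measurable_snd)) fun ω => abs_integral_gHat_le hC (by omega) ω hf hK).sub
      (integrable_const _)).abs
  have hintp : Integrable (fun ω => |A.pathHat y ξ I t f' ω
      - ∫ x, H.backwardInt (H.φ y) t f' (fun _ => x) ∂(H.γ y t)|) μ :=
    ((integrable_of_abs_le (hF.measurable_pathHat t hf'm)
      (abs_pathHat_le hC (by omega) hf'm hf'K)).sub (integrable_const _)).abs
  have hi1 := (hint _ _ hr hrC).const_mul (K ^ 2)
  have hi2 := (hint _ _ hm hmC).const_mul K
  refine (integral_mono_of_nonneg (ae_of_all _ fun ω => abs_nonneg _)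
    (hi1.add ((hintp.add hi2).const_mul (2 * K * (C * C)))) (ae_of_all _ key)).trans ?_
  rw [integral_add' hi1 ((hintp.add hi2).const_mul _), integral_const_mul, integral_const_mul,
    integral_add' hintp hi2, integral_const_mul]
  gcongr
  · exact hF.integral_abs_gHat_sub_le hC hN (by omega) hr hrC
  · exact hF.integral_abs_pathHat_sub_le hC hN (by omega) hf'm hf'K hf'dep
  · exact hF.integral_abs_gHat_sub_le hC hN (by omega) hm hmC

end Pointwise

/-- Convergence in mean of the particle approximation of the conditional second moment. -/
lemma tendsto_lintegral_enorm_second_moment {Ω : Type*} [MeasurableSpace Ω] {μ : Measure Ω}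
    [IsProbabilityMeasure μ] {ξ : (N : ℕ) → ℕ → Fin N → Ω → X}
    {I : (N : ℕ) → ℕ → Fin N → Ω → Fin N} (hF : ∀ N, A.IsParticleFilter y (ξ N) (I N) μ T)
    (hC : A.BoundedBy y T C) {t : ℕ} (ht : t + 1 ≤ T) {f : (ℕ → X) → ℝ} (hf : Measurable f) {K : ℝ}
    (hK : ∀ x, |f x| ≤ K) (hdep : DependsOn f (Set.Iic (t + 1))) :
    Tendsto (fun N : ℕ => ∫⁻ ω, ‖∫ x, A.ϑ (t + 1) x * ∫ x', A.w y (t + 1) x x' ^ 2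
          * H.backwardInt (fun s => A.filterHat y (ξ N) (I N) s ω) (t + 1) f (fun _ => x') ^ 2
            ∂(A.P (t + 1) x) ∂(A.gHat y (ξ N) (I N) t ω)
        - ∫ x, A.ϑ (t + 1) x * ∫ x', A.w y (t + 1) x x' ^ 2
          * H.backwardInt (H.φ y) (t + 1) f (fun _ => x') ^ 2
            ∂(A.P (t + 1) x) ∂(H.γ y t)‖ₑ ∂μ) atTop (𝓝 0) := by
  have hC0 : 0 ≤ C := zero_le_one.trans hC.one_le
  have := HMM.isFiniteMeasure_γ hC.g_le (t := t) (by omega)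
  have hconst : Measurable fun x : X => (fun _ : ℕ => x) :=
    measurable_pi_lambda _ fun _ => measurable_id
  have hBm : ∀ (η : ℕ → Measure X) [∀ t, IsFiniteMeasure (η t)],
      Measurable fun x' => H.backwardInt η (t + 1) f (fun _ => x') := fun η _ =>
    (HMM.measurable_backwardInt_right η hf (t + 1)).comp hconst
  have hlim : Tendsto (fun N : ℕ => ∫⁻ x', ∫⁻ ω,
      ‖A.sqDensityHat y (ξ N) (I N) t f ω x' - A.sqDensity y t f x'‖ₑ ∂μ ∂H.ν) atTop (𝓝 0) := by
    have hmeas : ∀ N, Measurable fun p : Ω × X =>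
        ‖A.sqDensityHat y (ξ N) (I N) t f p.1 p.2 - A.sqDensity y t f p.2‖ₑ := fun N =>
      (((hF N).measurable_sqDensityHat t hf).sub
        ((measurable_sqDensity hC (by omega) hf).comp measurable_snd)).enorm
    have heq : ∀ N x', ∫⁻ ω, ‖A.sqDensityHat y (ξ N) (I N) t f ω x' - A.sqDensity y t f x'‖ₑ ∂μ
        = ENNReal.ofReal
          (∫ ω, |A.sqDensityHat y (ξ N) (I N) t f ω x' - A.sqDensity y t f x'| ∂μ) := fun N x' =>
      (ofReal_integral_norm_eq_lintegral_enorm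
        ((hF N).integrable_sqDensityHat_sub hC ht hf hK x')).symm
    have h0 : (0 : ℝ≥0∞) = ∫⁻ _, 0 ∂H.ν := by simp
    rw [h0]
    refine tendsto_lintegral_filter_of_dominated_convergence
      (fun x' => ENNReal.ofReal (2 * (C * C * K ^ 2) * ∫ x, H.m x x' ∂(H.γ y t)))
      (Eventually.of_forall fun N => (hmeas N).lintegral_prod_left') ?_ ?_ ?_
    · filter_upwards [eventually_ne_atTop 0] with N hN
      refine ae_of_all _ fun x' => ?_
      rw [heq]
      exact ENNReal.ofReal_le_ofReal
        ((hF N).integral_abs_sqDensityHat_sub_le hC hN ht hK x')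
    -- Finite because `m(x, ·)` is a probability density with respect to `ν` and `γ_t` is a finite
    -- measure.
    · exact ((H.integrable_m_prod (H.γ y t)).integral_prod_right.const_mul _).lintegral_lt_top.ne
    · refine ae_of_all _ fun x' => ?_
      simp_rw [heq]
      rw [← ENNReal.ofReal_zero]
      refine ENNReal.tendsto_ofReal ?_
      have hb : Tendsto (fun N : ℕ => K ^ 2 * √(mseConst C t * (C * (C * C)) ^ 2 / N)
        + 2 * K * (C * C) * (√(mseConst C t * (C * K) ^ 2 / N)
          + K * √(mseConst C t * C ^ 2 / N))) atTop (𝓝 0) := by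
        have h1 := tendsto_sqrt_const_div (mseConst C t * (C * (C * C)) ^ 2)
        have h2 := tendsto_sqrt_const_div (mseConst C t * (C * K) ^ 2)
        have h3 := tendsto_sqrt_const_div (mseConst C t * C ^ 2)
        simpa using (h1.const_mul (K ^ 2)).add
          ((h2.add (h3.const_mul K)).const_mul (2 * K * (C * C)))
      refine squeeze_zero' (Eventually.of_forall fun N => integral_nonneg fun ω => abs_nonneg _)
        ?_ hb
      filter_upwards [eventually_ne_atTop 0] with N hN
      exact (hF N).integral_abs_sqDensityHat_sub_le_sqrt hC hN ht hf hK hdep x'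
  refine tendsto_of_tendsto_of_tendsto_of_le_of_le tendsto_const_nhds hlim (fun _ => bot_le)
    fun N => ?_
  simp only
  -- With the expectation outside, the difference of the second moments is bounded pathwise by the
  -- `L¹(ν)` distance of the densities.
  rw [← lintegral_lintegral_swap]
  · refine lintegral_mono fun ω => ?_
    have e1 := integral_ϑ_mul_integral_P hC (A.gHat y (ξ N) (I N) t ω) (t := t + 1) (by omega) ht
      (hBm (fun s => A.filterHat y (ξ N) (I N) s ω))
      (fun x => HMM.abs_backwardInt_le hC.m_le _ hK _ _)
    have i1 := integrable_weighted_sq hC (A.gHat y (ξ N) (I N) t ω) (t := t + 1) (by omega) ht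
      (hBm (fun s => A.filterHat y (ξ N) (I N) s ω))
      (fun x => HMM.abs_backwardInt_le hC.m_le _ hK _ _)
    have e2 := integral_ϑ_mul_integral_P hC (H.γ y t) (t := t + 1) (by omega) ht
      (hBm (H.φ y)) (fun x => HMM.abs_backwardInt_le hC.m_le _ hK _ _)
    have i2 := integrable_weighted_sq hC (H.γ y t) (t := t + 1) (by omega) ht
      (hBm (H.φ y)) (fun x => HMM.abs_backwardInt_le hC.m_le _ hK _ _)
    rw [e1, e2, ← integral_sub i1 i2]
    exact enorm_integral_le_lintegral_enorm _
  · exact (((hF N).measurable_sqDensityHat t hf).sub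
      ((measurable_sqDensity hC (by omega) hf).comp measurable_snd)).enorm.aemeasurable

end Proposal

/-! ### Limit tools: random variances in the exponent, and Slutsky for a ratio. -/

lemma abs_exp_neg_sub_exp_neg_le {a b M : ℝ} (ha : -M ≤ a) (hb : -M ≤ b) :
    |Real.exp (-a) - Real.exp (-b)| ≤ Real.exp M * |a - b| := by
  wlog hab : a ≤ b generalizing a b
  · rw [abs_sub_comm, abs_sub_comm a]
    exact this hb ha (le_of_not_ge hab)
  rw [abs_of_nonneg (sub_nonneg.2 (Real.exp_le_exp.2 (neg_le_neg hab))), abs_sub_comm,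
    abs_of_nonneg (sub_nonneg.2 hab)]
  have h1 : Real.exp (-b) = Real.exp (-a) * Real.exp (-(b - a)) := by
    rw [← Real.exp_add]; congr 1; ring
  have h2 := Real.add_one_le_exp (-(b - a))
  have h3 : Real.exp (-a) ≤ Real.exp M := Real.exp_le_exp.2 (by linarith)
  calc Real.exp (-a) - Real.exp (-b) = Real.exp (-a) * (1 - Real.exp (-(b - a))) := by
        rw [h1]; ring
    _ ≤ Real.exp (-a) * (b - a) :=
        mul_le_mul_of_nonneg_left (by linarith) (Real.exp_pos _).le
    _ ≤ Real.exp M * (b - a) := mul_le_mul_of_nonneg_right h3 (sub_nonneg.2 hab)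

section

variable {Ω : Type*} [MeasurableSpace Ω] {μ : Measure Ω} [IsProbabilityMeasure μ]

lemma tendsto_lintegral_enorm_of_integral_abs_le {Z : ℕ → Ω → ℝ} (hZ : ∀ N, Measurable (Z N))
    {K : ℝ} (hK : ∀ N ω, |Z N ω| ≤ K) {b : ℕ → ℝ} (hb : Tendsto b atTop (𝓝 0))
    (h : ∀ N ≠ 0, ∫ ω, |Z N ω| ∂μ ≤ b N) :
    Tendsto (fun N => ∫⁻ ω, ‖Z N ω‖ₑ ∂μ) atTop (𝓝 0) := by
  simp_rw [fun N => (ofReal_integral_norm_eq_lintegral_enorm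
    (integrable_of_abs_le (μ := μ) (hZ N) (hK N))).symm]
  rw [← ENNReal.ofReal_zero]
  refine ENNReal.tendsto_ofReal (squeeze_zero' (Eventually.of_forall fun N =>
    integral_nonneg fun ω => norm_nonneg _) ?_ hb)
  filter_upwards [eventually_ne_atTop 0] with N hN using h N hN

/-- Replacing random variances by their limit in mean. -/
lemma tendsto_integral_mul_exp {Z : ℕ → Ω → ℂ} (hZ : ∀ N, Measurable (Z N))
    (hZ1 : ∀ N ω, ‖Z N ω‖ ≤ 1) {a : ℂ} (ha : Tendsto (fun N => ∫ ω, Z N ω ∂μ) atTop (𝓝 a))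
    {V : ℕ → Ω → ℝ} (hV : ∀ N, Measurable (V N)) {v M : ℝ} (hM : ∀ N ω, -M ≤ V N ω)
    (hv : -M ≤ v) (h : Tendsto (fun N => ∫⁻ ω, ‖V N ω - v‖ₑ ∂μ) atTop (𝓝 0)) (u : ℝ) :
    Tendsto (fun N => ∫ ω, Z N ω * Real.exp (-(u ^ 2 * V N ω / 2)) ∂μ) atTop
      (𝓝 (a * Real.exp (-(u ^ 2 * v / 2)))) := by
  have hexp : ∀ x, -M ≤ x → -(u ^ 2 * M / 2) ≤ u ^ 2 * x / 2 := fun x hx => by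
    nlinarith [sq_nonneg u]
  have key : Tendsto (fun N => ∫ ω, Z N ω * Real.exp (-(u ^ 2 * V N ω / 2)) ∂μ
      - (∫ ω, Z N ω ∂μ) * Real.exp (-(u ^ 2 * v / 2))) atTop (𝓝 0) := by
    rw [tendsto_zero_iff_enorm_tendsto_zero]
    set c : ℝ := Real.exp (u ^ 2 * M / 2) * (u ^ 2 / 2) with hc
    have h' : Tendsto (fun N => ENNReal.ofReal c * ∫⁻ ω, ‖V N ω - v‖ₑ ∂μ) atTop (𝓝 0) := by
      simpa using ENNReal.Tendsto.const_mul h (Or.inr ENNReal.ofReal_ne_top)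
    refine tendsto_of_tendsto_of_tendsto_of_le_of_le tendsto_const_nhds h' (fun _ => bot_le)
      fun N => ?_
    simp only
    have hmV : Measurable fun ω => ((Real.exp (-(u ^ 2 * V N ω / 2)) : ℝ) : ℂ) := by
      have := hV N
      fun_prop
    have hi : Integrable (Z N) μ := Integrable.of_bound (hZ N).aestronglyMeasurable 1
      (ae_of_all _ (hZ1 N))
    have hi' : Integrable (fun ω => Z N ω * Real.exp (-(u ^ 2 * V N ω / 2))) μ := by
      refine Integrable.of_bound ((hZ N).mul hmV).aestronglyMeasurable
        (Real.exp (u ^ 2 * M / 2)) (ae_of_all _ fun ω => ?_)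
      rw [norm_mul, Complex.norm_real, Real.norm_eq_abs, Real.abs_exp]
      refine (mul_le_of_le_one_left (Real.exp_pos _).le (hZ1 N ω)).trans
        (Real.exp_le_exp.2 ?_)
      linarith [hexp _ (hM N ω)]
    rw [← integral_mul_const, ← integral_sub hi' (hi.mul_const _)]
    refine (enorm_integral_le_lintegral_enorm _).trans ?_
    rw [← lintegral_const_mul' _ _ ENNReal.ofReal_ne_top]
    refine lintegral_mono fun ω => ?_
    rw [← Real.enorm_of_nonneg (by positivity : 0 ≤ c), ← enorm_mul]
    rw [enorm_le_iff_norm_le, ← mul_sub, norm_mul, ← Complex.ofReal_sub, Complex.norm_real,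
      Real.norm_eq_abs, Real.norm_eq_abs, abs_mul, abs_of_nonneg (by positivity : 0 ≤ c)]
    refine (mul_le_of_le_one_left (abs_nonneg _) (hZ1 N ω)).trans
      ((abs_exp_neg_sub_exp_neg_le (hexp _ (hM N ω)) (hexp _ hv)).trans_eq ?_)
    rw [hc, mul_assoc, show u ^ 2 * V N ω / 2 - u ^ 2 * v / 2 = u ^ 2 / 2 * (V N ω - v) by ring,
      abs_mul, abs_of_nonneg (by positivity : 0 ≤ u ^ 2 / 2)]
  have := key.add (ha.mul_const ((Real.exp (-(u ^ 2 * v / 2)) : ℝ) : ℂ))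
  simpa using this

/-- A Slutsky-type statement for a ratio whose denominator may vanish. -/
lemma tendstoInDistribution_of_ae_eq_mul {v : ℝ≥0} {S R G : ℕ → Ω → ℝ} {γ : ℝ} (hγ : 0 < γ)
    (hS : TendstoInDistribution S atTop (id : ℝ → ℝ) (fun _ => μ) (gaussianReal 0 v))
    (hR : ∀ N, Measurable (R N)) (hG : ∀ N, Measurable (G N))
    (hG' : TendstoInMeasure μ G atTop (fun _ => γ))
    (h : ∀ N, (fun ω => γ * S N ω) =ᵐ[μ] fun ω => G N ω * R N ω) :
    TendstoInDistribution R atTop (id : ℝ → ℝ) (fun _ => μ) (gaussianReal 0 v) := by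
  -- Truncating the denominator at `γ / 2` makes the quotient continuous everywhere, so continuous
  -- mapping applies.
  have hpos : ∀ b : ℝ, 0 < max b (γ / 2) := fun b => lt_max_of_lt_right (by positivity)
  have hcont : Continuous fun p : ℝ × ℝ => γ * p.1 * (max p.2 (γ / 2))⁻¹ :=
    (by fun_prop : Continuous fun p : ℝ × ℝ => γ * p.1).mul
      (Continuous.inv₀ (by fun_prop) fun p => (hpos p.2).ne')
  have h1 := hS.continuous_comp_prodMk_of_tendstoInMeasure_const hcont hG'
    fun N => (hG N).aemeasurable
  have hid : (fun ω : ℝ => γ * id ω * (max γ (γ / 2))⁻¹) = id := by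
    funext x
    rw [max_eq_left (by linarith), mul_right_comm, mul_inv_cancel₀ hγ.ne', one_mul]
  simp only [hid] at h1
  refine tendstoInDistribution_of_tendstoInMeasure_sub R id h1 ?_ fun N => (hR N).aemeasurable
  rw [tendstoInMeasure_iff_norm] at hG' ⊢
  intro ε hε
  -- Unless `G` is at distance at least `γ / 2` from `γ`, the truncation is inactive and the
  -- truncated quotient equals `R` almost surely.
  refine tendsto_of_tendsto_of_tendsto_of_le_of_le tendsto_const_nhds
    (hG' (γ / 2) (by positivity)) (fun _ => bot_le) fun N => measure_mono_ae ?_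
  filter_upwards [h N] with ω hω hle
  by_contra hlt
  have hlt' : |G N ω - γ| < γ / 2 := not_le.1 hlt
  have hG2 : γ / 2 < G N ω := by linarith [(abs_lt.1 hlt').1]
  have hle' : ε ≤ ‖R N ω - γ * S N ω * (max (G N ω) (γ / 2))⁻¹ - 0‖ := hle
  rw [hω, max_eq_left hG2.le, mul_right_comm, mul_inv_cancel₀ (by linarith), one_mul, sub_self,
    sub_zero, norm_zero] at hle'
  linarith

end

/-! ### The central limit theorem for the unnormalised functional. -/

namespace Proposal

variable {H : HMM X Y} {A : Proposal H} {y : ℕ → Y} {T : ℕ} {C : ℝ}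

/-- The asymptotic variance at time `t` of the unnormalised smoothing functional of `f`. -/
noncomputable def pathVar (A : Proposal H) (y : ℕ → Y) (T : ℕ) (f : (ℕ → X) → ℝ) (t : ℕ) : ℝ :=
  (∫ x, A.w₀ y x ^ 2 * H.forwardInt y T 0 f (fun _ => x) ^ 2 ∂A.ρ₀)
    + ∑ s ∈ Finset.range t, (∫ x, A.ϑ (s + 1) x ∂(H.γ y s))
      * ∫ x, A.ϑ (s + 1) x * ∫ x', A.w y (s + 1) x x' ^ 2 * H.backwardInt (H.φ y) (s + 1)
        (H.forwardInt y (T - (s + 1)) (s + 1) f) (fun _ => x') ^ 2 ∂(A.P (s + 1) x) ∂(H.γ y s)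

lemma zHat_succ {Ω : Type*} {N : ℕ} {ξ : ℕ → Fin N → Ω → X} {I : ℕ → Fin N → Ω → Fin N} (t : ℕ)
    (ω : Ω) : A.zHat y ξ I (t + 1) ω = ∫ x, A.ϑ (t + 1) x ∂(A.gHat y ξ I t ω) := by
  rw [integral_gHat t ω (A.measurable_ϑ _), zHat, mul_assoc]

lemma integral_ϑ_mul_nonneg (η : Measure X) (t : ℕ) (Φ : X → ℝ) :
    0 ≤ ∫ x, A.ϑ t x * ∫ x', A.w y t x x' ^ 2 * Φ x' ^ 2 ∂(A.P t x) ∂η :=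
  integral_nonneg fun x => mul_nonneg (A.ϑ_pos t x).le (integral_nonneg fun _ => by positivity)

section CLT

variable {Ω : Type*} [MeasurableSpace Ω] {μ : Measure Ω}

lemma IsParticleFilter.measurable_second_moment {N : ℕ} {ξ : ℕ → Fin N → Ω → X}
    {I : ℕ → Fin N → Ω → Fin N} (hF : A.IsParticleFilter y ξ I μ T) (hC : A.BoundedBy y T C)
    {t : ℕ} (ht : t + 1 ≤ T) {f : (ℕ → X) → ℝ} (hf : Measurable f) {K : ℝ}
    (hK : ∀ x, |f x| ≤ K) :
    Measurable fun ω => ∫ x, A.ϑ (t + 1) x * ∫ x', A.w y (t + 1) x x' ^ 2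
          * H.backwardInt (fun s => A.filterHat y ξ I s ω) (t + 1) f (fun _ => x') ^ 2
            ∂(A.P (t + 1) x) ∂(A.gHat y ξ I t ω) := by
  have e : ∀ ω, ∫ x, A.ϑ (t + 1) x * ∫ x', A.w y (t + 1) x x' ^ 2
      * H.backwardInt (fun s => A.filterHat y ξ I s ω) (t + 1) f (fun _ => x') ^ 2
        ∂(A.P (t + 1) x) ∂(A.gHat y ξ I t ω) = ∫ x', A.sqDensityHat y ξ I t f ω x' ∂H.ν := fun ω =>
    integral_ϑ_mul_integral_P hC (A.gHat y ξ I t ω) (t := t + 1) (by omega) ht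
      ((HMM.measurable_backwardInt_right _ hf (t + 1)).comp
        (measurable_pi_lambda _ fun _ => measurable_id))
      (fun x => HMM.abs_backwardInt_le hC.m_le _ hK _ _)
  simp_rw [e]
  exact (hF.measurable_sqDensityHat t hf).stronglyMeasurable.integral_prod_right.measurable

variable [IsProbabilityMeasure μ] {ξ : (N : ℕ) → ℕ → Fin N → Ω → X}
  {I : (N : ℕ) → ℕ → Fin N → Ω → Fin N} {f : (ℕ → X) → ℝ} {K : ℝ}

/-- The conditional variances of the step from `t` to `t + 1` converge in mean. -/
lemma tendsto_lintegral_enorm_variance (hF : ∀ N, A.IsParticleFilter y (ξ N) (I N) μ T)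
    (hC : A.BoundedBy y T C) {k t : ℕ} (ht : t + (k + 1) ≤ T) (hf : Measurable f)
    (hK : ∀ x, |f x| ≤ K) (hdep : DependsOn f (Set.Iic (t + (k + 1))))
    (h0 : ∫ x, H.forwardInt y (t + (k + 1)) 0 f (fun _ => x) ∂(H.γ y 0) = 0) :
    Tendsto (fun N : ℕ => ∫⁻ ω, ‖(A.zHat y (ξ N) (I N) (t + 1) ω
        * (∫ x, A.ϑ (t + 1) x * ∫ x', A.w y (t + 1) x x' ^ 2
          * H.backwardInt (fun s => A.filterHat y (ξ N) (I N) s ω) (t + 1)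
            (H.forwardInt y k (t + 1) f) (fun _ => x') ^ 2
            ∂(A.P (t + 1) x) ∂(A.gHat y (ξ N) (I N) t ω))
        - A.pathHat y (ξ N) (I N) t (H.forwardInt y (k + 1) t f) ω ^ 2)
      - (∫ x, A.ϑ (t + 1) x ∂(H.γ y t)) * ∫ x, A.ϑ (t + 1) x * ∫ x', A.w y (t + 1) x x' ^ 2
          * H.backwardInt (H.φ y) (t + 1) (H.forwardInt y k (t + 1) f) (fun _ => x') ^ 2
            ∂(A.P (t + 1) x) ∂(H.γ y t)‖ₑ ∂μ) atTop (𝓝 0) := by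
  have hC0 : 0 ≤ C := zero_le_one.trans hC.one_le
  have hmF := HMM.measurable_forwardInt (H := H) (y := y) hf k (t + 1)
  have hKF := HMM.abs_forwardInt_le hC.g_le hK k (t := t + 1) (by omega)
  have hmF' := HMM.measurable_forwardInt (H := H) (y := y) hf (k + 1) t
  have hKF' := HMM.abs_forwardInt_le hC.g_le hK (k + 1) (t := t) (by omega)
  have hdepF := HMM.forwardInt_dependsOn (H := H) (y := y) (f := f) (k := k) (t := t + 1)
    (by rwa [show t + 1 + k = t + (k + 1) by ring])
  have hϑ : ∀ x, |A.ϑ (t + 1) x| ≤ C := fun x => by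
    rw [abs_of_pos (A.ϑ_pos _ x)]; exact hC.ϑ_le _ (by omega) (by omega) x
  have hQ := tendsto_lintegral_enorm_second_moment hF hC (by omega) hmF hKF hdepF
  generalize hq : (∫ x, A.ϑ (t + 1) x * ∫ x', A.w y (t + 1) x x' ^ 2
          * H.backwardInt (H.φ y) (t + 1) (H.forwardInt y k (t + 1) f) (fun _ => x') ^ 2
            ∂(A.P (t + 1) x) ∂(H.γ y t)) = q at hQ ⊢
  have hZ : Tendsto (fun N : ℕ => ∫⁻ ω, ‖∫ x, A.ϑ (t + 1) x ∂(A.gHat y (ξ N) (I N) t ω)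
      - ∫ x, A.ϑ (t + 1) x ∂(H.γ y t)‖ₑ ∂μ) atTop (𝓝 0) := by
    refine tendsto_lintegral_enorm_of_integral_abs_le
      (fun N => ((hF N).measurable_integral t (f := fun _ x => A.ϑ (t + 1) x)
        ((A.measurable_ϑ _).comp measurable_snd)).sub_const _)
      (K := (C * C) ^ t * C * C + |∫ x, A.ϑ (t + 1) x ∂(H.γ y t)|)
      (fun N ω => (abs_sub _ _).trans (add_le_add
        (abs_integral_gHat_le hC (by omega) ω (A.measurable_ϑ _) hϑ) le_rfl))
      (tendsto_sqrt_const_div _) fun N hN =>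
        (hF N).integral_abs_gHat_sub_le hC hN (by omega) (A.measurable_ϑ _) hϑ
  -- Centring enters here: the limit of the conditional mean is `0`, so its square drops out of the
  -- limiting variance.
  have hp : Tendsto (fun N : ℕ => ∫⁻ ω, ‖A.pathHat y (ξ N) (I N) t
      (H.forwardInt y (k + 1) t f) ω ^ 2‖ₑ ∂μ) atTop (𝓝 0) := by
    refine tendsto_lintegral_enorm_of_integral_abs_le
      (fun N => ((hF N).measurable_pathHat t hmF').pow_const 2)
      (K := ((C * C) ^ t * C * (C ^ (k + 1) * K)) ^ 2)
      (fun N ω => by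
        rw [abs_pow]
        exact pow_le_pow_left₀ (abs_nonneg _) (abs_pathHat_le hC (by omega) hmF' hKF' ω) 2)
      (b := fun N : ℕ => mseConst C t * (C ^ (k + 1) * K) ^ 2 / N)
      (tendsto_const_nhds.div_atTop tendsto_natCast_atTop_atTop) fun N hN => ?_
    have := (hF N).integral_pathHat_sub_sq_le hC hN ht hf hK hdep
    simpa only [h0, sub_zero, abs_pow, sq_abs] using this
  have hB : Tendsto (fun N : ℕ =>
      ENNReal.ofReal ((C * C) ^ (t + 1)) * (∫⁻ ω, ‖∫ x, A.ϑ (t + 1) x * ∫ x', A.w y (t + 1) x x' ^ 2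
          * H.backwardInt (fun s => A.filterHat y (ξ N) (I N) s ω) (t + 1)
            (H.forwardInt y k (t + 1) f) (fun _ => x') ^ 2
            ∂(A.P (t + 1) x) ∂(A.gHat y (ξ N) (I N) t ω) - q‖ₑ ∂μ)
        + ‖q‖ₑ * (∫⁻ ω, ‖∫ x, A.ϑ (t + 1) x ∂(A.gHat y (ξ N) (I N) t ω)
            - ∫ x, A.ϑ (t + 1) x ∂(H.γ y t)‖ₑ ∂μ)
        + ∫⁻ ω, ‖A.pathHat y (ξ N) (I N) t (H.forwardInt y (k + 1) t f) ω ^ 2‖ₑ ∂μ)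
      atTop (𝓝 0) := by
    simpa using ((ENNReal.Tendsto.const_mul hQ (Or.inr ENNReal.ofReal_ne_top)).add
      (ENNReal.Tendsto.const_mul hZ (Or.inr enorm_ne_top))).add hp
  refine tendsto_of_tendsto_of_tendsto_of_le_of_le tendsto_const_nhds hB (fun _ => bot_le)
    fun N => ?_
  simp only
  have hm1 := ((hF N).measurable_second_moment hC (t := t) (by omega) hmF hKF).sub_const q
  rw [← lintegral_const_mul' _ _ ENNReal.ofReal_ne_top, ← lintegral_const_mul' _ _ enorm_ne_top,
    ← lintegral_add_left (hm1.enorm.const_mul _),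
    ← lintegral_add_right _ (((hF N).measurable_pathHat t hmF').pow_const 2).enorm]
  refine lintegral_mono fun ω => ?_
  simp only
  have hz : ‖A.zHat y (ξ N) (I N) (t + 1) ω‖ₑ ≤ ENNReal.ofReal ((C * C) ^ (t + 1)) := by
    rw [Real.enorm_of_nonneg (zHat_nonneg _ _)]
    exact ENNReal.ofReal_le_ofReal (zHat_le hC (by omega) ω)
  rw [← zHat_succ]
  generalize (∫ x, A.ϑ (t + 1) x * ∫ x', A.w y (t + 1) x x' ^ 2
          * H.backwardInt (fun s => A.filterHat y (ξ N) (I N) s ω) (t + 1)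
            (H.forwardInt y k (t + 1) f) (fun _ => x') ^ 2
            ∂(A.P (t + 1) x) ∂(A.gHat y (ξ N) (I N) t ω)) = Q
  generalize A.zHat y (ξ N) (I N) (t + 1) ω = z at hz ⊢
  generalize ∫ x, A.ϑ (t + 1) x ∂(H.γ y t) = a
  generalize A.pathHat y (ξ N) (I N) t (H.forwardInt y (k + 1) t f) ω ^ 2 = p
  calc ‖z * Q - p - a * q‖ₑ = ‖(z * (Q - q) + q * (z - a)) - p‖ₑ := by congr 1; ring
    _ ≤ ‖z‖ₑ * ‖Q - q‖ₑ + ‖q‖ₑ * ‖z - a‖ₑ + ‖p‖ₑ := by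
        refine enorm_sub_le.trans ?_
        gcongr
        refine (enorm_add_le _ _).trans ?_
        rw [enorm_mul, enorm_mul]
    _ ≤ _ := by gcongr

/-- The central limit theorem for the unnormalised smoothing functional. -/
lemma tendsto_charFun_pathHat (hF : ∀ N, A.IsParticleFilter y (ξ N) (I N) μ T)
    (hC : A.BoundedBy y T C) (hf : Measurable f) (hK : ∀ x, |f x| ≤ K)
    (hdep : DependsOn f (Set.Iic T))
    (h0 : ∫ x, H.forwardInt y T 0 f (fun _ => x) ∂(H.γ y 0) = 0) {t k : ℕ} (htk : t + k = T)
    (u : ℝ) :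
    Tendsto (fun N : ℕ => ∫ ω, Complex.exp (Complex.I *
        (u * (√N * A.pathHat y (ξ N) (I N) t (H.forwardInt y k t f) ω) : ℝ)) ∂μ) atTop
      (𝓝 (Real.exp (-(u ^ 2 * A.pathVar y T f t / 2)) : ℝ)) := by
  have hbound : ∀ c : ℝ, Tendsto (fun N : ℕ => c / √N) atTop (𝓝 0) := fun c =>
    tendsto_const_nhds.div_atTop (Real.tendsto_sqrt_atTop.comp tendsto_natCast_atTop_atTop)
  induction t generalizing k with
  | zero =>
    obtain rfl : k = T := by omega
    rw [tendsto_iff_norm_sub_tendsto_zero]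
    refine squeeze_zero' (Eventually.of_forall fun _ => norm_nonneg _) ?_
      (hbound (cltConst u (C * (C ^ k * K))))
    filter_upwards [eventually_ne_atTop 0] with N hN
    have := (hF N).norm_charFun_zero_sub_le hC hN
      (f := fun x => H.forwardInt y k 0 f (fun _ => x)) ((HMM.measurable_forwardInt hf k 0).comp
      (measurable_pi_lambda _ fun _ => measurable_id))
      (fun x => HMM.abs_forwardInt_le hC.g_le hK k (by omega) _) h0 u
    simpa only [pathVar, Finset.range_zero, Finset.sum_empty, add_zero, pathHat,
      HMM.backwardInt] using this
  | succ t ih =>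
    have e : t + (k + 1) = T := by omega
    have hmF := HMM.measurable_forwardInt (H := H) (y := y) hf k (t + 1)
    have hKF := HMM.abs_forwardInt_le hC.g_le hK k (t := t + 1) (by omega)
    have hmF' := HMM.measurable_forwardInt (H := H) (y := y) hf (k + 1) t
    have hKF' := HMM.abs_forwardInt_le hC.g_le hK (k + 1) (t := t) (by omega)
    have hV := tendsto_lintegral_enorm_variance hF hC e.le hf hK (by rwa [e]) (by rwa [e])
    -- A crude lower bound from dropping the nonnegative second moment; it is all that is needed for
    -- the exponential to be Lipschitz.
    have hM : ∀ N ω, -((C * C) ^ t * C * (C ^ (k + 1) * K)) ^ 2 ≤ A.zHat y (ξ N) (I N) (t + 1) ω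
        * (∫ x, A.ϑ (t + 1) x * ∫ x', A.w y (t + 1) x x' ^ 2
          * H.backwardInt (fun s => A.filterHat y (ξ N) (I N) s ω) (t + 1)
            (H.forwardInt y k (t + 1) f) (fun _ => x') ^ 2
            ∂(A.P (t + 1) x) ∂(A.gHat y (ξ N) (I N) t ω))
        - A.pathHat y (ξ N) (I N) t (H.forwardInt y (k + 1) t f) ω ^ 2 := fun N ω => by
      have h1 := pow_le_pow_left₀ (abs_nonneg _)
        (abs_pathHat_le (ξ := ξ N) (I := I N) hC (t := t) (by omega) hmF' hKF' ω) 2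
      have h2 := mul_nonneg (zHat_nonneg (A := A) (y := y) (ξ := ξ N) (I := I N) (t + 1) ω)
        (integral_ϑ_mul_nonneg (A := A) (y := y) (A.gHat y (ξ N) (I N) t ω) (t + 1)
          fun x' => H.backwardInt (fun s => A.filterHat y (ξ N) (I N) s ω) (t + 1)
            (H.forwardInt y k (t + 1) f) (fun _ => x'))
      rw [sq_abs] at h1
      linarith
    have hlim := tendsto_integral_mul_exp
      (fun N => by
        have := (hF N).measurable_pathHat t hmF'
        fun_prop) (fun N ω => by rw [mul_comm, Complex.norm_exp_ofReal_mul_I])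
      (ih e)
      (fun N => ((measurable_zHat (t := t) (fun s _ i => (hF N).measurable_ξ s i)
        (fun s _ i => (hF N).measurable_weight s i) le_rfl).mul
        ((hF N).measurable_second_moment hC (t := t) (by omega) hmF hKF)).sub
          (((hF N).measurable_pathHat t hmF').pow_const 2)) hM
      ((neg_nonpos.2 (sq_nonneg _)).trans (mul_nonneg
        (integral_nonneg fun x => (A.ϑ_pos _ x).le) (integral_ϑ_mul_nonneg _ _ _))) hV u
    have hval : ((Real.exp (-(u ^ 2 * A.pathVar y T f t / 2)) : ℝ) : ℂ)
        * Real.exp (-(u ^ 2 * ((∫ x, A.ϑ (t + 1) x ∂(H.γ y t))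
          * ∫ x, A.ϑ (t + 1) x * ∫ x', A.w y (t + 1) x x' ^ 2
          * H.backwardInt (H.φ y) (t + 1) (H.forwardInt y k (t + 1) f) (fun _ => x') ^ 2
            ∂(A.P (t + 1) x) ∂(H.γ y t)) / 2))
        = (Real.exp (-(u ^ 2 * A.pathVar y T f (t + 1) / 2)) : ℝ) := by
      rw [← Complex.ofReal_mul, ← Real.exp_add, pathVar, pathVar, Finset.sum_range_succ,
        show T - (t + 1) = k by omega]
      congr 2
      ring
    rw [hval] at hlim
    rw [← sub_add_cancel (fun N : ℕ => ∫ ω, Complex.exp (Complex.I *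
        (u * (√N * A.pathHat y (ξ N) (I N) (t + 1) (H.forwardInt y k (t + 1) f) ω) : ℝ)) ∂μ)]
    rw [← zero_add ((Real.exp (-(u ^ 2 * A.pathVar y T f (t + 1) / 2)) : ℝ) : ℂ)]
    -- The first summand is the one-step Gaussian approximation error, of order `1/√N`; the second
    -- carries the induction hypothesis and the limiting variance.
    refine Tendsto.add ?_ hlim
    refine squeeze_zero_norm' ?_ (hbound (cltConst u ((C * C) ^ (t + 1) * C * (C ^ k * K))))
    filter_upwards [eventually_ne_atTop 0] with N hN
    have := (hF N).norm_charFun_succ_sub_le hC hN (t := t) (by omega)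
      (measurable_hist_backwardInt t hmF)
      (fun (ω : Ω) x => HMM.abs_backwardInt_le hC.m_le _ hKF _ _) u
    have e' : ∀ ω, _ := fun ω =>
      pathHat_forwardInt_succ (ξ := ξ N) (I := I N) hC hf hK (by rwa [e]) e.le ω
    simp only [← e'] at this
    exact this

end CLT

end Proposal

/-! ### Centring, and identification of the asymptotic variance. -/

namespace HMM

variable {H : HMM X Y} {y : ℕ → Y} {T : ℕ} {C : ℝ}

lemma measurable_lift {h : (Fin (T + 1) → X) → ℝ} (hh : Measurable h) : Measurable (lift h) :=
  hh.comp (measurable_pi_lambda _ fun i => measurable_pi_apply (i : ℕ))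

lemma dependsOn_lift {X : Type*} (h : (Fin (T + 1) → X) → ℝ) : DependsOn (lift h) (Set.Iic T) :=
  fun _ _ hx => congrArg h (funext fun i => hx i (Nat.lt_succ_iff.1 i.2))

lemma unnormSmooth_eq (h : (Fin (T + 1) → X) → ℝ) :
    H.unnormSmooth y h = ∫ x, H.forwardInt y T 0 (lift h) (fun _ => x) ∂(H.γ y 0) :=
  (integral_γ_zero _).symm

lemma unnormSmooth_one (hg : ∀ s ≤ T, ∀ x, H.g y s x ≤ C) :
    H.unnormSmooth y (T := T) (fun _ => 1) = (H.γ y T).real Set.univ := by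
  rw [unnormSmooth_eq]
  have := integral_γ_forwardInt_one hg T (t := 0) (by omega)
  rwa [zero_add] at this

lemma real_γ_univ_pos (hg : ∀ s ≤ T, ∀ x, H.g y s x ≤ C) (hg0 : ∀ s ≤ T, ∀ x, 0 < H.g y s x)
    {t : ℕ} (ht : t ≤ T) : 0 < (H.γ y t).real Set.univ := by
  have := isFiniteMeasure_γ hg ht
  have : NeZero (H.γ y t) := ⟨γ_ne_zero hg0 ht⟩
  exact measureReal_univ_pos

/-- The centred function has vanishing unnormalised smoothing functional. -/
lemma unnormSmooth_sub_smooth (hg : ∀ s ≤ T, ∀ x, H.g y s x ≤ C)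
    (hg0 : ∀ s ≤ T, ∀ x, 0 < H.g y s x) {h : (Fin (T + 1) → X) → ℝ} (hh : Measurable h) {K : ℝ}
    (hK : ∀ x, |h x| ≤ K) :
    H.unnormSmooth y (fun z => h z - H.smooth y h) = 0 := by
  have := isFiniteMeasure_γ hg (t := 0) (by omega)
  have hpos := real_γ_univ_pos hg hg0 le_rfl
  rw [← unnormSmooth_one hg] at hpos
  have hint : ∀ (f : (ℕ → X) → ℝ) (K : ℝ), Measurable f → (∀ x, |f x| ≤ K) →
      Integrable (fun x => H.forwardInt y T 0 f (fun _ => x)) (H.γ y 0) := fun f K hf hK =>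
    integrable_of_abs_le ((measurable_forwardInt hf T 0).comp
      (measurable_pi_lambda _ fun _ => measurable_id))
      fun x => abs_forwardInt_le hg hK T (by omega) _
  have e : ∀ x, H.forwardInt y T 0 (lift fun z => h z - H.smooth y h) (fun _ => x)
      = H.forwardInt y T 0 (lift h) (fun _ => x)
        - H.smooth y h * H.forwardInt y T 0 (lift (T := T) fun _ => 1) (fun _ => x) := fun x => by
    rw [← forwardInt_sub_mul hg (measurable_lift hh) (measurable_lift measurable_const)
      (fun x => hK _) (K' := 1) (fun _ => by simp [lift]) _ T (by omega)]
    simp only [lift, mul_one]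
    rfl
  rw [unnormSmooth_eq]
  simp_rw [e]
  rw [integral_sub (hint _ K (measurable_lift hh) fun x => hK _)
    ((hint _ 1 (measurable_lift measurable_const) fun _ => by simp [lift]).const_mul _),
    integral_const_mul, ← unnormSmooth_eq, ← unnormSmooth_eq, smooth,
    div_mul_cancel₀ _ hpos.ne', sub_self]

lemma integral_φ_F_one {Cm : ℝ} (hg : ∀ s ≤ T, ∀ x, H.g y s x ≤ C)
    (hg0 : ∀ s ≤ T, ∀ x, 0 < H.g y s x) (hm : ∀ x x', H.m x x' ≤ Cm) {t : ℕ} (ht : t ≤ T) :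
    ∫ x, H.F y (T := T) t x (fun _ => 1) ∂(H.φ y t)
      = (H.γ y T).real Set.univ / (H.γ y t).real Set.univ := by
  rw [integral_φ]
  congr 1
  have e : t + (T - t) = T := by omega
  have h := integral_γ_backwardInt hg hg0 hm (f := fun _ => 1) measurable_const (K := 1) (by simp)
    (k := T - t) (t := t) (fun _ _ _ => rfl) e.le
  have h' := integral_γ_forwardInt_one hg (T - t + t) (t := 0) (by omega)
  rw [show 0 + (T - t + t) = T by omega] at h'
  rw [add_comm t, h'] at h
  exact h

end HMM

namespace Proposal

variable {H : HMM X Y} {A : Proposal H} {y : ℕ → Y} {T : ℕ} {C : ℝ}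

lemma asymVar_nonneg (h : (Fin (T + 1) → X) → ℝ) : 0 ≤ A.asymVar y h := by
  refine add_nonneg (div_nonneg (integral_nonneg fun x => by positivity) (sq_nonneg _))
    (Finset.sum_nonneg fun t _ => div_nonneg (mul_nonneg (integral_ϑ_mul_nonneg _ _ _)
      (integral_nonneg fun x => (A.ϑ_pos _ x).le)) (sq_nonneg _))

/-- Passing from `φ` to `γ` divides each summand by the squared mass of `γ_t`, which cancels against
the denominator `(γ_T(X) / γ_t(X))²`. -/
lemma asymVar_eq (hC : A.BoundedBy y T C) (h : (Fin (T + 1) → X) → ℝ) :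
    A.asymVar y h = A.pathVar y T (HMM.lift fun z => h z - H.smooth y h) T
      / (H.γ y T).real Set.univ ^ 2 := by
  have hpos : ∀ t ≤ T, 0 < (H.γ y t).real Set.univ := fun t ht =>
    HMM.real_γ_univ_pos hC.g_le hC.g_pos ht
  have e0 : ∫ x, A.w₀ y x * H.F y (T := T) 0 x (fun _ => 1) ∂A.ρ₀ = (H.γ y T).real Set.univ := by
    rw [integral_w₀, ← HMM.unnormSmooth_one hC.g_le, HMM.unnormSmooth_eq]
    rfl
  rw [asymVar, e0, pathVar, add_div, Finset.sum_div]
  refine congrArg₂ _ rfl (Finset.sum_congr rfl fun t ht => ?_)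
  have ht' : t ≤ T := (Finset.mem_range.1 ht).le
  rw [HMM.integral_φ_F_one hC.g_le hC.g_pos hC.m_le ht', HMM.integral_φ, HMM.integral_φ]
  have h1 := (hpos t ht').ne'
  have h2 := (hpos T le_rfl).ne'
  change (∫ x, A.upsilon y (t + 1) x h ∂(H.γ y t)) / _ * _ / _
    = (∫ x, A.ϑ (t + 1) x ∂(H.γ y t)) * (∫ x, A.upsilon y (t + 1) x h ∂(H.γ y t)) / _
  field_simp

section

variable {Ω : Type*} {N : ℕ} {ξ : ℕ → Fin N → Ω → X} {I : ℕ → Fin N → Ω → Fin N}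

/-- The normalised filter has mass `1` unless all weights vanish, and then both sides are `0`. -/
lemma pathHat_lift (h : (Fin (T + 1) → X) → ℝ) (ω : Ω) :
    A.pathHat y ξ I T (HMM.lift h) ω
      = (A.gHat y ξ I T ω).real Set.univ * A.smoothHat y ξ I h ω := by
  have e := gHat_eq_smul (A := A) (y := y) (ξ := ξ) (I := I) T ω
  rw [pathHat, smoothHat, e, integral_smul_measure, smul_eq_mul]
  congr 1
  rw [Measure.real, Measure.smul_apply, smul_eq_mul]
  congr 1
  rcases eq_or_ne (∑ i, ENNReal.ofReal (A.weight y ξ I T i ω)) 0 with h0 | h0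
  · simp [h0]
  · have : A.filterHat y ξ I T ω Set.univ = 1 := by
      rw [filterHat, Measure.smul_apply, smul_eq_mul]
      simp only [Measure.coe_finsetSum, Finset.sum_apply, Measure.smul_apply, measure_univ,
        smul_eq_mul, mul_one]
      exact ENNReal.inv_mul_cancel h0 (ENNReal.sum_ne_top.2 fun i _ => ENNReal.ofReal_ne_top)
    rw [this, mul_one]

lemma pathHat_sub_const (hC : A.BoundedBy y T C) {t : ℕ} {f : (ℕ → X) → ℝ} (hf : Measurable f)
    {K : ℝ} (hK : ∀ x, |f x| ≤ K) (c : ℝ) (ω : Ω) :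
    A.pathHat y ξ I t (fun z => f z - c) ω
      = A.pathHat y ξ I t f ω - c * A.pathHat y ξ I t (fun _ => 1) ω := by
  have h1 : ∀ _ : ℕ → X, |(1 : ℝ)| ≤ 1 := by simp
  have e : ∀ x, H.backwardInt (fun s => A.filterHat y ξ I s ω) t (fun z => f z - c) x
      = H.backwardInt (fun s => A.filterHat y ξ I s ω) t f x
        - c * H.backwardInt (fun s => A.filterHat y ξ I s ω) t (fun _ => 1) x := fun x => by
    rw [HMM.backwardInt_sub hC.m_le _ hf (measurable_const (a := c)) (K := max K |c|)
      (fun x => (hK x).trans (le_max_left _ _)) (fun _ => le_max_right _ _) t x,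
      ← HMM.backwardInt_const_mul]
    simp
  have hint : ∀ (f : (ℕ → X) → ℝ) (K : ℝ), Measurable f → (∀ x, |f x| ≤ K) →
      Integrable (fun x => H.backwardInt (fun s => A.filterHat y ξ I s ω) t f (fun _ => x))
        (A.gHat y ξ I t ω) := fun f K hf hK =>
    integrable_of_abs_le ((HMM.measurable_backwardInt_right _ hf t).comp
      (measurable_pi_lambda _ fun _ => measurable_id))
      fun x => HMM.abs_backwardInt_le hC.m_le _ hK _ _
  simp only [pathHat, e]
  rw [integral_sub (hint f K hf hK) ((hint _ 1 measurable_const h1).const_mul _),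
    integral_const_mul]

variable [MeasurableSpace Ω] {μ : Measure Ω}

lemma IsParticleFilter.measurable_smoothHat (hF : A.IsParticleFilter y ξ I μ T)
    {h : (Fin (T + 1) → X) → ℝ} (hh : Measurable h) : Measurable (A.smoothHat y ξ I h) := by
  let η : Kernel Ω X := ⟨A.filterHat y ξ I T, measurable_filterHat (t := T)
    (fun s _ i => hF.measurable_ξ s i) (fun s _ i => hF.measurable_weight s i) le_rfl⟩
  have : IsFiniteKernel η := ⟨1, ENNReal.one_lt_top, fun ω => by
    change A.filterHat y ξ I T ω Set.univ ≤ 1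
    rw [filterHat, Measure.smul_apply, smul_eq_mul]
    simp only [Measure.coe_finsetSum, Finset.sum_apply, Measure.smul_apply, measure_univ,
      smul_eq_mul, mul_one]
    exact ENNReal.inv_mul_le_one _⟩
  exact (StronglyMeasurable.integral_kernel_prod_right (κ := η)
    (hF.measurable_backwardInt T (HMM.measurable_lift hh)).stronglyMeasurable).measurable

lemma IsParticleFilter.measurable_real_gHat_univ (hF : A.IsParticleFilter y ξ I μ T) (t : ℕ) :
    Measurable fun ω => (A.gHat y ξ I t ω).real Set.univ := by
  simpa using hF.measurable_integral t (f := fun _ _ => (1 : ℝ)) measurable_const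

end

section

variable {Ω : Type*} [MeasurableSpace Ω] {μ : Measure Ω} [IsProbabilityMeasure μ]
  {ξ : (N : ℕ) → ℕ → Fin N → Ω → X} {I : (N : ℕ) → ℕ → Fin N → Ω → Fin N}

/-- Consistency of the particle approximation of the likelihood of the observations. -/
lemma tendstoInMeasure_real_gHat_univ (hF : ∀ N, A.IsParticleFilter y (ξ N) (I N) μ T)
    (hC : A.BoundedBy y T C) {t : ℕ} (ht : t ≤ T) :
    TendstoInMeasure μ (fun N ω => (A.gHat y (ξ N) (I N) t ω).real Set.univ) atTop
      (fun _ => (H.γ y t).real Set.univ) := by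
  refine tendstoInMeasure_of_tendsto_eLpNorm one_ne_zero
    (fun N => ((hF N).measurable_real_gHat_univ t).aestronglyMeasurable)
    aestronglyMeasurable_const ?_
  simp only [eLpNorm_one_eq_lintegral_enorm, Pi.sub_apply]
  refine tendsto_lintegral_enorm_of_integral_abs_le
    (fun N => ((hF N).measurable_real_gHat_univ t).sub_const _)
    (K := (C * C) ^ t * C * 1 + |(H.γ y t).real Set.univ|)
    (fun N ω => (abs_sub _ _).trans (add_le_add ?_ le_rfl))
    (tendsto_sqrt_const_div (mseConst C t * 1 ^ 2)) fun N hN => ?_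
  · simpa using abs_integral_gHat_le (ξ := ξ N) (I := I N) hC ht ω (f := fun _ => 1)
      measurable_const (K := 1) (by simp)
  · simpa using (hF N).integral_abs_gHat_sub_le hC hN ht (f := fun _ => 1) measurable_const
      (K := 1) (by simp)

/-- The central limit theorem for the normalised error of the unnormalised smoothing functional,
in terms of convergence in distribution. -/
lemma tendstoInDistribution_pathHat (hF : ∀ N, A.IsParticleFilter y (ξ N) (I N) μ T)
    (hC : A.BoundedBy y T C) {h : (Fin (T + 1) → X) → ℝ} (hh : Measurable h) {K : ℝ}
    (hK : ∀ x, |h x| ≤ K) :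
    TendstoInDistribution (fun (N : ℕ) ω => √N * (A.pathHat y (ξ N) (I N) T
        (HMM.lift fun z => h z - H.smooth y h) ω / (H.γ y T).real Set.univ))
      atTop (id : ℝ → ℝ) (fun _ => μ) (gaussianReal 0 (A.asymVar y h).toNNReal) := by
  have hf := HMM.measurable_lift (hh.sub_const (H.smooth y h))
  have hKf : ∀ x : ℕ → X, |HMM.lift (fun z => h z - H.smooth y h) x| ≤ K + |H.smooth y h| :=
    fun x => (abs_sub _ _).trans (add_le_add (hK _) le_rfl)
  have hm : ∀ N : ℕ, Measurable fun ω => √N * (A.pathHat y (ξ N) (I N) T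
      (HMM.lift fun z => h z - H.smooth y h) ω / (H.γ y T).real Set.univ) := fun N =>
    (((hF N).measurable_pathHat T hf).div_const _).const_mul _
  refine ⟨fun N => (hm N).aemeasurable, aemeasurable_id, ?_⟩
  refine ProbabilityMeasure.tendsto_iff_tendsto_charFun.2 fun u => ?_
  have h0 := HMM.unnormSmooth_sub_smooth hC.g_le hC.g_pos hh hK
  rw [HMM.unnormSmooth_eq] at h0
  -- Division by `γ_T(X)` is a rescaling of the argument `u`, which accounts for the denominator in
  -- `asymVar_eq`.
  have hlim := tendsto_charFun_pathHat hF hC hf hKf (HMM.dependsOn_lift _) h0 (t := T) (k := 0)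
    rfl (u / (H.γ y T).real Set.univ)
  simp only [ProbabilityMeasure.coe_mk, Measure.map_id, charFun_gaussianReal]
  convert hlim using 2 with N
  · rw [charFun_apply_real, integral_map (hm N).aemeasurable (by fun_prop)]
    refine integral_congr_ae (ae_of_all _ fun ω => ?_)
    simp only [HMM.forwardInt]
    congr 1
    push_cast
    ring
  · rw [Real.coe_toNNReal _ (asymVar_nonneg h), asymVar_eq hC]
    push_cast
    congr 1
    ring

end

end Proposal

end FFBS

/-! ### Passage to the normalised estimator. -/

theorem mainTheorem2 {X Y : Type*}
    [TopologicalSpace X] [PolishSpace X] [MeasurableSpace X] [BorelSpace X]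
    [TopologicalSpace Y] [PolishSpace Y] [MeasurableSpace Y] [BorelSpace Y]
    (H : FFBS.HMM X Y) (A : FFBS.Proposal H) (y : ℕ → Y) (T : ℕ)
    (hg : H.BoundedLikelihood y T)
    (hw : A.BoundedWeights y T)
    (hd : A.BoundedDensities T)
    {Ω : Type*} [MeasurableSpace Ω] (μ : Measure Ω) [IsProbabilityMeasure μ]
    (ξ : (N : ℕ) → ℕ → Fin N → Ω → X) (I : (N : ℕ) → ℕ → Fin N → Ω → Fin N)
    (hξ : ∀ N, A.IsParticleFilter y (ξ N) (I N) μ T)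
    (h : (Fin (T + 1) → X) → ℝ) (h_meas : Measurable h) (h_bdd : ∃ C : ℝ, ∀ x, |h x| ≤ C) :
    0 ≤ A.asymVar y h ∧
    TendstoInDistribution
      (fun (N : ℕ) (ω : Ω) => √(N : ℝ) * (A.smoothHat y (ξ N) (I N) h ω - H.smooth y h))
      atTop (id : ℝ → ℝ) (fun _ => μ) (gaussianReal 0 (A.asymVar y h).toNNReal) := by
  obtain ⟨C, hC⟩ := FFBS.Proposal.exists_boundedBy hg hw hd
  obtain ⟨K, hK⟩ := h_bdd
  have hpos : 0 < (H.γ y T).real Set.univ := FFBS.HMM.real_γ_univ_pos hC.g_le hC.g_pos le_rfl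
  refine ⟨FFBS.Proposal.asymVar_nonneg h, FFBS.tendstoInDistribution_of_ae_eq_mul hpos
    (FFBS.Proposal.tendstoInDistribution_pathHat hξ hC h_meas hK)
    (fun N => (((hξ N).measurable_smoothHat h_meas).sub_const _).const_mul _)
    (fun N => (hξ N).measurable_real_gHat_univ T)
    (FFBS.Proposal.tendstoInMeasure_real_gHat_univ hξ hC le_rfl) fun N => ?_⟩
  -- Without particles both sides vanish because of the factor `√0`.
  rcases eq_or_ne N 0 with rfl | hN
  · simp
  filter_upwards [(hξ N).pathHat_one_ae_eq hC hN le_rfl] with ω hω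
  have e := FFBS.Proposal.pathHat_sub_const (ξ := ξ N) (I := I N) (t := T) hC
    (FFBS.HMM.measurable_lift h_meas) (fun x => hK _) (H.smooth y h) ω
  -- Almost sure normalisation replaces the functional of `1` by the mass of `gHat`, which then
  -- factors out of the smoothing error.
  rw [hω, FFBS.Proposal.pathHat_lift] at e
  change _ * (√(N : ℝ) * (A.pathHat y (ξ N) (I N) T
    (fun z => FFBS.HMM.lift h z - H.smooth y h) ω / _)) = _
  rw [e]
  field_simp
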